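/- **Notation.** Let $\mathbb{B}_n$ be the open unit ball of $\mathbb{C}^n$, $w\overline z=\sum_j w_j\overline{z_j}$, $dV$ Lebesgue measure, $\sigma$ surface measure on $\partial\mathbb{B}_n$, and $\triangle(w,z)=|1-w\overline z|^2-(1-|w|^2)(1-|z|^2)$. With $s_i(w,z)=\overline{w_i}(1-w\overline z)-\overline{z_i}(1-|w|^2)$, the Cauchy kernel is $$\mathcal C_n(w,z)=\frac1{\big(\sum_i s_i(w_i-z_i)\big)^n}\sum_{i=1}^n(-1)^{i-1}s_i\Big[\bigwedge_{j\ne i}ds_j\Big]\wedge\bigwedge_{i=1}^n d(w_i-z_i).$$ For $0\le q\le n-1$, $\mathcal C_n^{0,q}(w,z)$ denotes its component of bidegree $(0,q)$ in $z$ and $(n,n-q-1)$ in $w$, and $\mathcal C_n^{0,q}\eta(z)=\int_{\mathbb{B}_n}\eta(w)\wedge\mathcal C_n^{0,q}(w,z)$ for $(0,q+1)$-forms $\eta=\sum_{|I|=q+1}\eta_I\,d\overline w^I$. For $k\notin J$ let $\mu(k,J)$ be the position of $k$ in the increasing multi-index $J\cup\{k\}$, and for $m\ge0$ put $$\overline{\mathcal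 D}^m\eta(w)=\sum_{|J|=q}\ \sum_{k\notin J}(-1)^{\mu(k,J)}(\overline{w_k}-\overline{z_k})\sum_{\alpha\in\{1,\dots,n\}^m}\Big(\prod_{i=1}^m(\overline{w_{\alpha_i}}-\overline{z_{\alpha_i}})\Big)\frac{\partial^m\eta_{J\cup\{k\}}}{\partial\overline{w_{\alpha_1}}\cdots\partial\overline{w_{\alpha_m}}}(w)\;d\overline z^J ,$$ a $(0,q)$-form in $z$ whose coefficients depend on $w$ and on the parameter $z$. For such forms $F$ let $$\mathcal S_nF(z)=\int_{\partial\mathbb{B}_n}\frac{F(\zeta)}{(1-\overline\zeta z)^n}\,d\sigma(\zeta),\qquad \Phi_n^\ell F(z)=\int_{\mathbb{B}_n}\Phi_n^\ell(w,z)F(w)\,dV(w),\qquad \Phi_n^\ell(w,z)=\frac{(1-w\overline z)^{n-1-\ell}(1-|w|^2)^\ell}{\triangle(w,z)^n}.$$ For $s>n$ let $\mathsf E_s$ extend forms from $\overline{\mathbb{B}_n}$ to $\overline{\mathbb{B}_s}$ with coefficients constant in the extra variables, let $\mathsf R_n$ restrict forms from $\mathbb{B}_s$ to $\mathbb{B}_n$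 by setting the extra variables to $0$ and discarding the terms containing differentials of extra variables, and let $\mathcal C_{n,s}^{0,q}=\mathsf R_n\mathcal C_s^{0,q}\mathsf E_s$. **Statement.** "Smooth on $\overline{\mathbb{B}_n}$" means $C^\infty$ up to the boundary. (a) Let $0\le q\le n-1$. There are constants $c_k$ ($k\ge0$), depending only on $n,q$, and for every $m\ge0$ there are constants $c_\ell^{(m)}$ ($0\le\ell\le q$), depending only on $n,q,m$, such that for every $(0,q+1)$-form $\eta$ smooth on $\overline{\mathbb{B}_n}$ and every $z\in\mathbb{B}_n$ $$\mathcal C_n^{0,q}\eta(z)=\sum_{k=0}^{m-1}c_k\,\mathcal S_n\big(\overline{\mathcal D}^k\eta\big)(z)+\sum_{\ell=0}^q c_\ell^{(m)}\,\Phi_n^\ell\big(\overline{\mathcal D}^m\eta\big)(z),$$ all the integrals being absolutely convergent. (b) Let $s>n$. There are constants $a_{\ell,j}$, depending only on $n,s,\ell,j$, such that the following holds with the operators $\mathcal S_{n,s}$ and $\Phi_{n,s}^\ell$ ($0\le\ell\le n-1$) given by integration over $\mathbb{B}_n$ with respect to $dV(w)$ against the kernels $$\mathcal S_{n,s}(w,z)=\frac{(1-|w|^2)^{s-n-1}}{(1-\overline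 wz)^s},\qquad \Phi_{n,s}^\ell(w,z)=\Phi_n^\ell(w,z)\Big(\frac{1-|w|^2}{1-\overline wz}\Big)^{s-n}\sum_{j=0}^{n-\ell-1}a_{\ell,j}\Big(\frac{(1-|w|^2)(1-|z|^2)}{|1-w\overline z|^2}\Big)^j .$$ For every $0\le q\le n-1$ there are constants $c'_k$ ($k\ge 0$), depending only on $n,s,q$, and for every $m\ge0$ constants $c_\ell^{(m)}$ ($0\le \ell\le q$), depending only on $n,s,q,m$, such that for every $(0,q+1)$-form $\eta$ smooth on $\overline{\mathbb{B}_n}$ and every $z\in\mathbb{B}_n$ $$\mathcal C_{n,s}^{0,q}\eta(z)=\sum_{k=0}^{m-1}c'_k\,\mathcal S_{n,s}\big(\overline{\mathcal D}^k\eta\big)(z)+\sum_{\ell=0}^qc_\ell^{(m)}\,\Phi_{n,s}^\ell\big(\overline{\mathcal D}^m\eta\big)(z),$$ all the integrals being absolutely convergent. -/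

import Mathlib

open scoped ContDiff ComplexConjugate
open MeasureTheory Metric

noncomputable section

namespace BallForms

/-- `ℂⁿ` with its Euclidean norm and Lebesgue measure. -/
abbrev Cn (n : ℕ) : Type := EuclideanSpace ℂ (Fin n)

/-- The bilinear expression `w z̄ = ∑ⱼ wⱼ conj zⱼ`. -/
def dotBar {n : ℕ} (w z : Cn n) : ℂ := ∑ j, w j * conj (z j)

/-- The real number `1 - |w|²`, as a complex number. -/
def oneSubSq {n : ℕ} (w : Cn n) : ℂ := ((1 - ‖w‖ ^ 2 : ℝ) : ℂ)

/-- `△(w,z) = |1 - w z̄|² - (1 - |w|²)(1 - |z|²)`. -/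
def triangle {n : ℕ} (w z : Cn n) : ℝ :=
  ‖1 - dotBar w z‖ ^ 2 - (1 - ‖w‖ ^ 2) * (1 - ‖z‖ ^ 2)

/-! ### Differential forms on `ℂⁿ × ℂⁿ` (variables `w`, `z`) -/

/-- Labels of the coordinate differentials `dwⱼ`, `dw̄ⱼ`, `dzⱼ`, `dz̄ⱼ`, and of the dual coordinate
vector fields `∂/∂wⱼ`, `∂/∂w̄ⱼ`, `∂/∂zⱼ`, `∂/∂z̄ⱼ`, on `ℂⁿ × ℂⁿ`. -/
inductive Coord (n : ℕ) : Type
  | w (j : Fin n) : Coord n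
  | wbar (j : Fin n) : Coord n
  | z (j : Fin n) : Coord n
  | zbar (j : Fin n) : Coord n
  deriving DecidableEq

/-- Complex-valued `1`-forms at a point of `ℂⁿ × ℂⁿ`, in the basis of the coordinate
differentials. -/
abbrev Cotangent (n : ℕ) : Type := Coord n → ℂ

/-- Complex-valued differential forms at a point of `ℂⁿ × ℂⁿ`. The product is the wedge product. -/
abbrev Form (n : ℕ) : Type := ExteriorAlgebra ℂ (Cotangent n)

/-- The derivative of `f : ℂⁿ × ℂⁿ → ℂ` along a coordinate vector field (the usual Wirtinger
derivatives). -/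
def coordDeriv {n : ℕ} (f : Cn n × Cn n → ℂ) (p : Cn n × Cn n) : Coord n → ℂ
  | .w j => (1 / 2) * (fderiv ℝ f p (EuclideanSpace.single j 1, 0)
      - Complex.I * fderiv ℝ f p (EuclideanSpace.single j Complex.I, 0))
  | .wbar j => (1 / 2) * (fderiv ℝ f p (EuclideanSpace.single j 1, 0)
      + Complex.I * fderiv ℝ f p (EuclideanSpace.single j Complex.I, 0))
  | .z j => (1 / 2) * (fderiv ℝ f p (0, EuclideanSpace.single j 1)
      - Complex.I * fderiv ℝ f p (0, EuclideanSpace.single j Complex.I))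
  | .zbar j => (1 / 2) * (fderiv ℝ f p (0, EuclideanSpace.single j 1)
      + Complex.I * fderiv ℝ f p (0, EuclideanSpace.single j Complex.I))

/-- The differential `df` at the point `p`, as a `1`-form. -/
def differential {n : ℕ} (f : Cn n × Cn n → ℂ) (p : Cn n × Cn n) : Form n :=
  ExteriorAlgebra.ι ℂ (fun c => coordDeriv f p c)

/-- A coordinate differential, for example `dw̄ⱼ` for the label `Coord.wbar j`. -/
def coordForm {n : ℕ} (c : Coord n) : Form n :=
  ExteriorAlgebra.ι ℂ (Pi.single c 1)

/-- The wedge product of `α j` over `j ∈ S`, in increasing order of `j`. -/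
def wedgeOver {n : ℕ} (S : Finset (Fin n)) (α : Fin n → Form n) : Form n :=
  (S.sort.map α).prod

/-- The coefficient of `dc₁ ∧ … ∧ dc_N` in a form, for a list `c₁, …, c_N` of distinct labels:
successive interior products with the coordinate vector fields `c₁, …, c_N`, and then the
component of degree zero. -/
def coeff {n : ℕ} (l : List (Coord n)) (x : Form n) : ℂ :=
  ExteriorAlgebra.algebraMapInv
    (l.foldl (fun y c => CliffordAlgebra.contractLeft (LinearMap.proj c) y) x)

/-- The monomial `dz^P ∧ dz̄^Q ∧ dw̄^T ∧ dw^R`. -/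
def monomial {n : ℕ} (P Q T R : Finset (Fin n)) : Form n :=
  wedgeOver P (fun j => coordForm (.z j)) * wedgeOver Q (fun j => coordForm (.zbar j)) *
    wedgeOver T (fun j => coordForm (.wbar j)) * wedgeOver R (fun j => coordForm (.w j))

/-- The labels occurring in `monomial P Q T R`, in the same order. -/
def monomialLabels {n : ℕ} (P Q T R : Finset (Fin n)) : List (Coord n) :=
  P.sort.map Coord.z ++ Q.sort.map Coord.zbar ++ T.sort.map Coord.wbar ++ R.sort.map Coord.w

/-- The component of a form that has bidegree `(p,q)` in `z` and bidegree `(r,t)` in `w`. -/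
def bidegreePart {n : ℕ} (p q r t : ℕ) (x : Form n) : Form n :=
  ∑ P ∈ Finset.powersetCard p Finset.univ, ∑ Q ∈ Finset.powersetCard q Finset.univ,
    ∑ T ∈ Finset.powersetCard t Finset.univ, ∑ R ∈ Finset.powersetCard r Finset.univ,
      coeff (monomialLabels P Q T R) x • monomial P Q T R

/-! ### Charpentier's kernels -/

/-- Charpentier's section `s(w,z) = w̄ (1 - w z̄) - z̄ (1 - |w|²)`, `i`-th component. -/
def charpentierSection {n : ℕ} (i : Fin n) (p : Cn n × Cn n) : ℂ :=
  conj (p.1 i) * (1 - dotBar p.1 p.2) - conj (p.2 i) * oneSubSq p.1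

/-- The Cauchy kernel: the pullback by the section `s` of the Cauchy-Leray form,
`(s (w - z))⁻ⁿ ∑ᵢ (-1)^(i-1) sᵢ [⋀_{j ≠ i} dsⱼ] ∧ ⋀ᵢ d(wᵢ - zᵢ)`
(the index `i` starts from `0` here). -/
def cauchyKernel (n : ℕ) (w z : Cn n) : Form n :=
  (1 / (∑ i, charpentierSection i (w, z) * (w i - z i)) ^ n) •
    ∑ i : Fin n, ((-1) ^ (i : ℕ) * charpentierSection i (w, z)) •
      (wedgeOver (Finset.univ.erase i) (fun j => differential (charpentierSection j) (w, z)) *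
        wedgeOver Finset.univ (fun j => differential (fun p => p.1 j - p.2 j) (w, z)))

/-- Charpentier's kernel `𝒞ₙ^{0,q}(w,z)`: the component of the Cauchy kernel of bidegree `(0,q)` in
`z` and `(n,n-q-1)` in `w`. -/
def charpentierKernel (n q : ℕ) (w z : Cn n) : Form n :=
  bidegreePart 0 q n (n - q - 1) (cauchyKernel n w z)

/-- Increasing multi-indices of length `p` in `{1,…,n}`. -/
abbrev MultiIndex (n p : ℕ) : Type := {I : Finset (Fin n) // I.card = p}

/-- Values at a point of `(0,p)`-forms on `ℂⁿ`, by their coefficients: `η` stands for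
`∑_{|I| = p} η_I dw̄^I` (or `dz̄^I`). A `(0,p)`-form on a set is a function to this type. -/
abbrev AntiForm (n p : ℕ) : Type := MultiIndex n p → ℂ

/-- The form `∑_I η_I dw̄^I`. -/
def AntiForm.toForm {n p : ℕ} (η : AntiForm n p) : Form n :=
  ∑ I, η I • wedgeOver I.1 (fun j => coordForm (.wbar j))

/-- The constant `κ` with `dw̄₁ ∧ … ∧ dw̄ₙ ∧ dw₁ ∧ … ∧ dwₙ = κ dV(w)`, where `dV` is the Euclidean
volume form for the standard orientation of `ℂⁿ`. -/
def volumeConst (n : ℕ) : ℂ := (-1) ^ (n * (n - 1) / 2) * (2 * Complex.I) ^ n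

/-- A form of top degree in `w` and bidegree `(0,q)` in `z` is `∑_{|J| = q} g_J dz̄^J ∧ dV(w)`;
this is `(g_J)_J`, the `(0,q)`-form in `z` to be integrated in `w`. -/
def fiberDensity {n : ℕ} (q : ℕ) (x : Form n) : AntiForm n q := fun J =>
  volumeConst n * coeff (monomialLabels ∅ J.1 Finset.univ Finset.univ) x

/-- The density with respect to `dV(w)` of `f(w) ∧ 𝒞ₙ^{0,q}(w,z)`. -/
def charpentierDensity {n q : ℕ} (f : Cn n → AntiForm n (q + 1)) (z w : Cn n) : AntiForm n q :=
  fiberDensity q ((f w).toForm * charpentierKernel n q w z)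

/-- Charpentier's operator `𝒞ₙ^{0,q} f (z) = ∫_{𝔹ₙ} f(w) ∧ 𝒞ₙ^{0,q}(w,z)`. -/
def charpentierOp {n q : ℕ} (f : Cn n → AntiForm n (q + 1)) (z : Cn n) : AntiForm n q :=
  ∫ w in ball (0 : Cn n) 1, charpentierDensity f z w

/-! ### The derivatives `𝒟̄ᵐ` -/

/-- `∂f/∂w̄ⱼ` for a function on the closed unit ball. -/
def dbarDeriv {n : ℕ} (j : Fin n) (f : Cn n → ℂ) (w : Cn n) : ℂ :=
  (1 / 2) * (fderivWithin ℝ f (closedBall 0 1) w (EuclideanSpace.single j 1)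
    + Complex.I * fderivWithin ℝ f (closedBall 0 1) w (EuclideanSpace.single j Complex.I))

/-- `∂ᵐf/∂w̄^α` for a list `α` of indices. -/
def dbarIter {n : ℕ} (f : Cn n → ℂ) : List (Fin n) → Cn n → ℂ
  | [] => f
  | j :: l => dbarDeriv j (dbarIter f l)

/-- `𝒵̄ᵐ f (w) = ∑_α (w̄ - z̄)^α ∂ᵐf/∂w̄^α (w)` with `α` running over `{1,…,n}ᵐ`: the `m`-th power of
`∑ⱼ (w̄ⱼ - z̄ⱼ) ∂/∂w̄ⱼ` with the monomials in `w̄ - z̄` held fixed. -/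
def zbarPow {n : ℕ} (m : ℕ) (z : Cn n) (f : Cn n → ℂ) (w : Cn n) : ℂ :=
  ∑ α : Fin m → Fin n, (∏ i, (conj (w (α i)) - conj (z (α i)))) * dbarIter f (List.ofFn α) w

/-- `μ(k,J)`: the position (counted from `1`) of `k` in the increasing multi-index `J ∪ {k}`. -/
def insertPos {n : ℕ} (k : Fin n) (J : Finset (Fin n)) : ℕ := (J.filter (· < k)).card + 1

/-- `J ∪ {k}` for `k ∉ J`. -/
def MultiIndex.insert {n q : ℕ} (J : MultiIndex n q) (k : Fin n) (hk : k ∉ J.1) :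
    MultiIndex n (q + 1) :=
  ⟨Insert.insert k J.1, by rw [Finset.card_insert_of_notMem hk, J.2]⟩

/-- The interior product `η ⌟ dw̄^J = ∑_{k ∉ J} (-1)^{μ(k,J)} η_{J ∪ {k}} dw̄_k`, a `(0,1)`-form in
`w`; this is its `k`-th coefficient function. -/
def interiorProd {n q : ℕ} (η : Cn n → AntiForm n (q + 1)) (J : MultiIndex n q) (k : Fin n)
    (w : Cn n) : ℂ :=
  if hk : k ∉ J.1 then (-1) ^ insertPos k J.1 * η w (J.insert k hk) else 0

/-- `𝒟̄ᵐ η (w) = ∑_{|J| = q} 𝒵̄ᵐ(η ⌟ dw̄^J)[𝒵̄](w) dz̄^J`, depending on the parameter `z`. -/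
def dbarPow {n q : ℕ} (m : ℕ) (η : Cn n → AntiForm n (q + 1)) (z w : Cn n) : AntiForm n q :=
  fun J => ∑ k, (conj (w k) - conj (z k)) * zbarPow m z (interiorProd η J k) w

/-! ### The operators on the right-hand side -/

/-- `Φₙ^ℓ(w,z) = (1 - w z̄)^{n-1-ℓ} (1 - |w|²)^ℓ / △(w,z)ⁿ`, for `0 ≤ ℓ ≤ n - 1`. -/
def phi (n ℓ : ℕ) (w z : Cn n) : ℂ :=
  (1 - dotBar w z) ^ (n - 1 - ℓ) * oneSubSq w ^ ℓ / ((triangle w z : ℝ) : ℂ) ^ n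

/-- The Cauchy kernel function `(1 - ζ̄ z)⁻ⁿ`. -/
def szego (n : ℕ) (ζ z : Cn n) : ℂ := 1 / (1 - dotBar z ζ) ^ n

/-- The operator `F ↦ ∫_{𝔹ₙ} K(w) F(w) dV(w)` on `(0,q)`-forms `F`. -/
def volOp {n q : ℕ} (K : Cn n → ℂ) (F : Cn n → AntiForm n q) : AntiForm n q :=
  ∫ w in ball (0 : Cn n) 1, K w • F w

/-- The boundary Cauchy operator `𝒮ₙ F (z) = ∫_{∂𝔹ₙ} (1 - ζ̄ z)⁻ⁿ F(ζ) dσ(ζ)`, with `σ` the surface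
measure of the unit sphere. -/
def bdryOp {n q : ℕ} (F : Cn n → AntiForm n q) (z : Cn n) : AntiForm n q :=
  ∫ ζ : sphere (0 : Cn n) 1, szego n ζ z • F ζ ∂(volume : Measure (Cn n)).toSphere

/-! ### Ameliorated kernels -/

/-- The orthogonal projection `ℂˢ → ℂⁿ` on the first `n` coordinates. -/
def projFirst {n s : ℕ} (h : n ≤ s) (w : Cn s) : Cn n :=
  WithLp.toLp 2 (fun i => w (Fin.castLE h i))

/-- The embedding `ℂⁿ → ℂˢ`, `z ↦ (z,0)`. -/
def embFirst {n : ℕ} (s : ℕ) (z : Cn n) : Cn s :=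
  WithLp.toLp 2 (fun i => if hi : (i : ℕ) < n then z ⟨i, hi⟩ else 0)

/-- A multi-index in `{1,…,n}` regarded as a multi-index in `{1,…,s}`. -/
def MultiIndex.cast {n s p : ℕ} (h : n ≤ s) (I : MultiIndex n p) : MultiIndex s p :=
  ⟨I.1.map (Fin.castLEEmb h), by rw [Finset.card_map, I.2]⟩

/-- The extension `𝖤ₛ` of `(0,p)`-forms: the coefficients are made constant in the extra
variables. -/
def extendForm {n s p : ℕ} (h : n ≤ s) (η : Cn n → AntiForm n p) : Cn s → AntiForm s p :=
  fun w I => ∑ I₀ : MultiIndex n p, if I₀.cast h = I then η (projFirst h w) I₀ else 0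

/-- The restriction `𝖱ₙ` of `(0,p)`-forms: differentials of extra variables are discarded and the
coefficients are restricted. -/
def restrictForm {n s p : ℕ} (h : n ≤ s) (f : Cn s → AntiForm s p) : Cn n → AntiForm n p :=
  fun z J => f (embFirst s z) (J.cast h)

/-- The ameliorated operator `𝒞_{n,s}^{0,q} = 𝖱ₙ 𝒞ₛ^{0,q} 𝖤ₛ`. -/
def amelOp {n s q : ℕ} (h : n ≤ s) (f : Cn n → AntiForm n (q + 1)) : Cn n → AntiForm n q :=
  restrictForm h (charpentierOp (extendForm h f))

/-- The kernel `Φ_{n,s}^ℓ(w,z) = Φₙ^ℓ(w,z) ((1 - |w|²)/(1 - w̄ z))^{s-n}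
∑_{j=0}^{n-ℓ-1} aⱼ ((1 - |w|²)(1 - |z|²)/|1 - w z̄|²)ʲ` with coefficients `aⱼ`. -/
def phiAmel (n s ℓ : ℕ) (a : ℕ → ℂ) (w z : Cn n) : ℂ :=
  phi n ℓ w z * (oneSubSq w / (1 - dotBar z w)) ^ (s - n) *
    ∑ j ∈ Finset.range (n - ℓ),
      a j * (oneSubSq w * oneSubSq z / ((‖1 - dotBar w z‖ ^ 2 : ℝ) : ℂ)) ^ j

/-- The kernel `𝒮_{n,s}(w,z) = (1 - |w|²)^{s-n-1} / (1 - w̄ z)ˢ`. -/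
def szegoAmel (n s : ℕ) (w z : Cn n) : ℂ :=
  oneSubSq w ^ (s - n - 1) / (1 - dotBar z w) ^ s

end BallForms

end

/-!
The kernel can be computed explicitly. Put `r = 1 - |w|²` and `A = 1 - w z̄`. Charpentier's section
satisfies `s = L (w̄ - z̄)` with `L = r I + w̄ wᵀ`, and modulo `s` its derivatives along `∂/∂z̄_k`
and `∂/∂w̄_k` are `-L ε_k` and `(A / r) L ε_k`. As `det L = r^(n-1)`, the determinants which are the
coefficients of the Cauchy kernel reduce to determinants with one column `w̄ - z̄` and basis vectors
otherwise (`det_section_eq`), and `η ∧ 𝒞ₙ^{0,q}` is a constant times `Φₙ^q 𝒟̄⁰η dV`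
(`charpentierDensity_eq`).

The formula then follows by integration by parts with the antiholomorphic Euler field
`E = ∑ⱼ (w̄ⱼ - z̄ⱼ) ∂/∂w̄ⱼ`. It satisfies `E A = 0`, `E r = r - A`, `E △ = △` and
`E (𝒟̄ᵐη) = (m + 1) 𝒟̄ᵐη + 𝒟̄ᵐ⁺¹η`, and the divergence theorem gives
`∫_𝔹 (E g + n g) dV = ½ ∫_∂𝔹 (1 - ζ z̄) g dσ` (`integral_ball_eulerDeriv_add`). Taking
`g = △⁻ⁿ A^(n-1-ℓ) r^ℓ 𝒟̄ᵐη`, one gets a recursion which expresses `(ℓ + m + 1) Φ^ℓ 𝒟̄ᵐη` through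
`Φ^(ℓ-1) 𝒟̄ᵐη`, `Φ^ℓ 𝒟̄ᵐ⁺¹η` and, only for `ℓ = 0`, the boundary term `½ 𝒮 𝒟̄ᵐη`
(`volOp_phi_recursion`). Solving it for `ℓ = q, q - 1, …, 0` and iterating in `m` gives the formula
in the ball of `ℂⁿ` (`charpentierOp_eq`). All volume integrals converge because
`△ ≥ (1 - |z|²) |w - z|²` while `𝒟̄ᵐη` vanishes at `w = z`.

The ameliorated formula is the one of dimension `s = n + d`, applied to the extended form at a point
of `ℂⁿ`. There `𝒟̄ᵐ` commutes with the extension (`dbarPow_extendForm`), so the integrals over the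
ball and the sphere of `ℂˢ` may be computed on slices parallel to `ℂᵈ`. The slices of the sphere give the
weight `(1 - |w|²)^(d-1)` (`integral_sphere_projFirst`); the slices of `Φ_s^ℓ` give, by a fractional
linear substitution in `t²`, an integral over `[0, 1]` which is a polynomial in
`X = (1 - |w|²)(1 - |z|²) / |1 - w z̄|²` (`integral_slice_phi`).
-/

noncomputable section

namespace BallForms

/-! ### Coefficients of exterior products -/

section Exterior

variable {n : ℕ}

theorem coeff_nil (x : Form n) : coeff [] x = ExteriorAlgebra.algebraMapInv x := rfl

theorem coeff_cons (c : Coord n) (l : List (Coord n)) (x : Form n) :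
    coeff (c :: l) x = coeff l (CliffordAlgebra.contractLeft (LinearMap.proj c) x) := rfl

theorem coeff_add (l : List (Coord n)) (x y : Form n) :
    coeff l (x + y) = coeff l x + coeff l y := by
  induction l generalizing x y with
  | nil => simp [coeff_nil]
  | cons c l ih => simp [coeff_cons, ih]

theorem coeff_smul (l : List (Coord n)) (a : ℂ) (x : Form n) :
    coeff l (a • x) = a * coeff l x := by
  induction l generalizing x with
  | nil => simp [coeff_nil]
  | cons c l ih => simp [coeff_cons, ih]

theorem coeff_zero (l : List (Coord n)) : coeff l (0 : Form n) = 0 := by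
  simpa using coeff_smul l 0 0

theorem coeff_sum {κ : Type*} (l : List (Coord n)) (S : Finset κ) (f : κ → Form n) :
    coeff l (∑ i ∈ S, f i) = ∑ i ∈ S, coeff l (f i) := by
  classical
  induction S using Finset.induction_on with
  | empty => simp [coeff_zero]
  | insert a S ha ih => simp [Finset.sum_insert ha, coeff_add, ih]

/-- The wedge product `v₀ ∧ … ∧ v_{N-1}` of a finite family of `1`-forms. -/
def wedge {N : ℕ} (v : Fin N → Cotangent n) : Form n :=
  (List.ofFn fun i => ExteriorAlgebra.ι ℂ (v i)).prod

theorem wedge_succ {N : ℕ} (v : Fin (N + 1) → Cotangent n) :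
    wedge v = ExteriorAlgebra.ι ℂ (v 0) * wedge (fun i => v i.succ) := by
  simp [wedge, List.ofFn_succ]

/-- The interior product is an antiderivation, so on a product of `1`-forms it is the alternating
sum over the factors. -/
theorem contractLeft_wedge {N : ℕ} (d : Module.Dual ℂ (Cotangent n))
    (v : Fin (N + 1) → Cotangent n) :
    CliffordAlgebra.contractLeft d (wedge v) =
      ∑ i : Fin (N + 1), ((-1 : ℂ) ^ (i : ℕ) * d (v i)) • wedge (fun j => v (i.succAbove j)) := by
  induction N with
  | zero =>
    rw [wedge_succ, CliffordAlgebra.contractLeft_ι_mul]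
    simp [wedge]
  | succ N ih =>
    rw [wedge_succ, CliffordAlgebra.contractLeft_ι_mul, ih, Fin.sum_univ_succ (n := N + 1),
      sub_eq_add_neg]
    congr 1
    · simp
    · rw [Finset.mul_sum, ← Finset.sum_neg_distrib]
      refine Finset.sum_congr rfl fun i _ => ?_
      rw [wedge_succ (fun j => v (i.succ.succAbove j))]
      simp [pow_succ]

/-- A coefficient of a product of `1`-forms is a determinant. -/
theorem coeff_wedge {N : ℕ} (c : Fin N → Coord n) (v : Fin N → Cotangent n) :
    coeff (List.ofFn c) (wedge v) = Matrix.det (Matrix.of fun i j => v i (c j)) := by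
  induction N with
  | zero => simp [coeff_nil, wedge]
  | succ N ih =>
    rw [List.ofFn_succ, coeff_cons, contractLeft_wedge, coeff_sum, Matrix.det_succ_column_zero]
    refine Finset.sum_congr rfl fun i _ => ?_
    rw [coeff_smul, ih]
    rfl

theorem contractLeft_mul_of_right_eq_zero (d : Module.Dual ℂ (Cotangent n)) (a b : Form n)
    (hb : CliffordAlgebra.contractLeft d b = 0) :
    CliffordAlgebra.contractLeft d (a * b) = CliffordAlgebra.contractLeft d a * b := by
  induction a using CliffordAlgebra.left_induction with
  | algebraMap r =>
    rw [CliffordAlgebra.contractLeft_algebraMap_mul, hb, mul_zero,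
      CliffordAlgebra.contractLeft_algebraMap, zero_mul]
  | add x y hx hy => rw [add_mul, map_add, hx, hy, map_add, add_mul]
  | ι_mul x m hx =>
    rw [mul_assoc, CliffordAlgebra.contractLeft_ι_mul, hx, CliffordAlgebra.contractLeft_ι_mul,
      sub_mul, smul_mul_assoc, mul_assoc]

theorem contractLeft_wedge_eq_zero {N : ℕ} (d : Module.Dual ℂ (Cotangent n))
    (v : Fin N → Cotangent n) (h : ∀ i, d (v i) = 0) :
    CliffordAlgebra.contractLeft d (wedge v) = 0 := by
  cases N with
  | zero => simp [wedge]
  | succ N => simp [contractLeft_wedge, h]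

theorem contractLeft_mul_eq_zero (d : Module.Dual ℂ (Cotangent n)) (a b : Form n)
    (ha : CliffordAlgebra.contractLeft d a = 0) (hb : CliffordAlgebra.contractLeft d b = 0) :
    CliffordAlgebra.contractLeft d (a * b) = 0 := by
  rw [contractLeft_mul_of_right_eq_zero d a b hb, ha, zero_mul]

/-- Coefficients of a product split when the first group of labels does not occur in the second
factor and exhausts the degree of the first one. -/
theorem coeff_append_wedge_mul {N : ℕ} (l l' : List (Coord n)) (hl : l.length = N)
    (v : Fin N → Cotangent n) (b : Form n)
    (hb : ∀ c ∈ l, CliffordAlgebra.contractLeft (LinearMap.proj c) b = 0) :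
    coeff (l ++ l') (wedge v * b) = coeff l (wedge v) * coeff l' b := by
  induction N generalizing l with
  | zero =>
    obtain rfl := List.length_eq_zero_iff.1 hl
    simp [wedge, coeff_nil]
  | succ N ih =>
    obtain ⟨c, l, rfl⟩ := List.exists_cons_of_length_eq_add_one hl
    rw [List.cons_append, coeff_cons, coeff_cons,
      contractLeft_mul_of_right_eq_zero _ _ _ (hb c (by simp)), contractLeft_wedge,
      Finset.sum_mul, coeff_sum, coeff_sum, Finset.sum_mul]
    refine Finset.sum_congr rfl fun i _ => ?_
    rw [smul_mul_assoc, coeff_smul, coeff_smul, ih l (by simpa using hl) _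
      (fun c' hc' => hb c' (by simp [hc']))]
    ring

theorem ι_mul_wedge_comm {N : ℕ} (a : Cotangent n) (v : Fin N → Cotangent n) :
    ExteriorAlgebra.ι ℂ a * wedge v = (-1 : ℂ) ^ N • (wedge v * ExteriorAlgebra.ι ℂ a) := by
  induction N with
  | zero => simp [wedge]
  | succ N ih =>
    rw [wedge_succ, ← mul_assoc, eq_neg_of_add_eq_zero_left
      (ExteriorAlgebra.ι_add_mul_swap a (v 0)), neg_mul, mul_assoc, ih]
    simp [pow_succ, mul_assoc]

theorem wedge_mul_comm {M N : ℕ} (u : Fin M → Cotangent n) (v : Fin N → Cotangent n) :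
    wedge u * wedge v = (-1 : ℂ) ^ (M * N) • (wedge v * wedge u) := by
  induction M with
  | zero => simp [wedge]
  | succ M ih =>
    rw [wedge_succ, mul_assoc, ih, mul_smul_comm, ← mul_assoc, ι_mul_wedge_comm, smul_mul_assoc,
      smul_smul, mul_assoc, ← pow_add]
    congr 2
    ring

theorem wedge_append {M N : ℕ} (u : Fin M → Cotangent n) (v : Fin N → Cotangent n) :
    wedge (Fin.append u v) = wedge u * wedge v := by
  rw [wedge, wedge, wedge, ← List.prod_append, ← List.ofFn_fin_append]
  congr 2
  funext i
  refine Fin.addCases (fun i => ?_) (fun i => ?_) i <;> simp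

theorem exists_list_eq_ofFn {α : Type*} {N : ℕ} (l : List α) (h : l.length = N) :
    ∃ c : Fin N → α, l = List.ofFn c := by
  subst h
  exact ⟨l.get, (List.ofFn_get l).symm⟩

/-- The enumeration of a finite set of `N` indices in increasing order. -/
theorem exists_sort_eq_ofFn {N : ℕ} (S : Finset (Fin n)) (h : S.card = N) :
    ∃ a : Fin N → Fin n,
      S.sort = List.ofFn a ∧ Function.Injective a ∧ ∀ k, k ∈ S ↔ ∃ i, a i = k := by
  obtain ⟨a, ha⟩ := exists_list_eq_ofFn S.sort ((Finset.length_sort _).trans h)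
  refine ⟨a, ha, ?_, fun k => ?_⟩
  · rw [← List.nodup_ofFn, ← ha]
    exact Finset.sort_nodup _ _
  · rw [← Finset.mem_sort (r := (· ≤ ·)), ha]
    simp [List.mem_ofFn]

theorem sort_univ_fin : (Finset.univ : Finset (Fin n)).sort = List.ofFn id := by
  rw [Fin.sort_univ, List.ofFn_id]

/-- The `1`-form `∑ₖ xₖ dw̄ₖ`. -/
def antiOneForm (x : Fin n → ℂ) : Cotangent n := ∑ k, x k • Pi.single (Coord.wbar k) 1

theorem antiOneForm_wbar (x : Fin n → ℂ) (k : Fin n) : antiOneForm x (.wbar k) = x k := by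
  simp [antiOneForm, Finset.sum_apply, Pi.single_apply, Coord.wbar.injEq]

theorem wedgeOver_eq_wedge {N : ℕ} {S : Finset (Fin n)} {a : Fin N → Fin n}
    (h : S.sort = List.ofFn a) (v : Fin n → Cotangent n) :
    wedgeOver S (fun j => ExteriorAlgebra.ι ℂ (v j)) = wedge (fun i => v (a i)) := by
  rw [wedgeOver, h, List.map_ofFn, wedge]
  rfl

/-- The monomial `dw̄^S`. -/
def antiMonomial (S : Finset (Fin n)) : Form n := wedgeOver S fun j => coordForm (.wbar j)

theorem antiMonomial_eq_wedge {N : ℕ} {S : Finset (Fin n)} {a : Fin N → Fin n}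
    (h : S.sort = List.ofFn a) :
    antiMonomial S = wedge (fun i => Pi.single (Coord.wbar (a i)) 1) :=
  wedgeOver_eq_wedge h _

/-- The coefficient of `dw̄₁ ∧ … ∧ dw̄ₙ`, the interior products being taken in this order. -/
def topCoeff (x : Form n) : ℂ := coeff (List.ofFn Coord.wbar) x

theorem topCoeff_wedge (v : Fin n → Cotangent n) :
    topCoeff (wedge v) = Matrix.det (Matrix.of fun i j => v i (.wbar j)) :=
  coeff_wedge _ _

theorem topCoeff_wedge_single (a : Fin n → Fin n) :
    topCoeff (wedge fun i => Pi.single (Coord.wbar (a i)) 1) =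
      Matrix.det (Matrix.of fun i j => if j = a i then (1 : ℂ) else 0) := by
  rw [topCoeff_wedge]
  congr
  ext i j
  simp [Pi.single_apply]

theorem topCoeff_wedge_single_eq_zero (a : Fin n → Fin n) (ha : ¬ Function.Injective a) :
    topCoeff (wedge fun i => Pi.single (Coord.wbar (a i)) 1) = 0 := by
  rw [topCoeff_wedge_single]
  simp only [Function.Injective, not_forall] at ha
  obtain ⟨i, j, hij, hne⟩ := ha
  exact Matrix.det_zero_of_row_eq hne (by ext k; simp [hij])

/-- The top coefficient of a permuted product of the `dw̄ⱼ` is a sign. Only its square enters, so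
that the sign need not be computed. -/
theorem topCoeff_wedge_single_mul_self (a : Fin n → Fin n) (ha : Function.Injective a) :
    topCoeff (wedge fun i => Pi.single (Coord.wbar (a i)) 1) *
      topCoeff (wedge fun i => Pi.single (Coord.wbar (a i)) 1) = 1 := by
  have hb : Function.Bijective a := Finite.injective_iff_bijective.1 ha
  have h : Matrix.of (fun i j => if j = a i then (1 : ℂ) else 0) =
      ((Equiv.ofBijective a hb).toPEquiv.toMatrix : Matrix (Fin n) (Fin n) ℂ) := by
    ext i j
    simp [PEquiv.toMatrix_apply, Equiv.toPEquiv_apply, eq_comm]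
  rw [topCoeff_wedge_single, h]
  change Matrix.det (Equiv.Perm.permMatrix ℂ _) * Matrix.det (Equiv.Perm.permMatrix ℂ _) = 1
  rw [Matrix.det_permutation, ← Int.cast_mul, Int.units_coe_mul_self, Int.cast_one]

/-- A product `dw̄^S ∧ dw̄^T` of top degree, as a product of `n` coordinate differentials. -/
theorem exists_antiMonomial_mul_eq_wedge (S T : Finset (Fin n)) (h : S.card + T.card = n) :
    ∃ a : Fin n → Fin n,
      antiMonomial S * antiMonomial T = wedge (fun i => Pi.single (Coord.wbar (a i)) 1) ∧
      (Function.Injective a ↔ Disjoint S T) := by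
  obtain ⟨a, ha, hai, ham⟩ := exists_sort_eq_ofFn S rfl
  obtain ⟨b, hb, hbi, hbm⟩ := exists_sort_eq_ofFn T rfl
  have key : ∀ N, S.card + T.card = N → ∃ c : Fin N → Fin n,
      antiMonomial S * antiMonomial T = wedge (fun i => Pi.single (Coord.wbar (c i)) 1) ∧
      (Function.Injective c ↔ Disjoint S T) := by
    rintro N rfl
    refine ⟨Fin.append a b, ?_, ?_⟩
    · rw [antiMonomial_eq_wedge ha, antiMonomial_eq_wedge hb, ← wedge_append]
      congr 1
      funext i
      refine Fin.addCases (fun i => ?_) (fun i => ?_) i <;> simp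
    · rw [Fin.append_injective_iff, Finset.disjoint_left]
      simp only [hai, hbi, true_and, hbm, ham]
      constructor
      · rintro h x ⟨i, rfl⟩ ⟨j, hj⟩
        exact h i j hj.symm
      · intro h i j hij
        exact h ⟨i, rfl⟩ ⟨j, hij.symm⟩
  exact key n h

theorem topCoeff_antiMonomial_mul_eq_zero (S T : Finset (Fin n)) (h : S.card + T.card = n)
    (hd : ¬ Disjoint S T) : topCoeff (antiMonomial S * antiMonomial T) = 0 := by
  obtain ⟨a, ha, hai⟩ := exists_antiMonomial_mul_eq_wedge S T h
  rw [ha, topCoeff_wedge_single_eq_zero _ (by rwa [hai])]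

theorem topCoeff_antiMonomial_mul_self (S T : Finset (Fin n)) (h : S.card + T.card = n)
    (hd : Disjoint S T) : topCoeff (antiMonomial S * antiMonomial T) *
      topCoeff (antiMonomial S * antiMonomial T) = 1 := by
  obtain ⟨a, ha, hai⟩ := exists_antiMonomial_mul_eq_wedge S T h
  rw [ha, topCoeff_wedge_single_mul_self _ (by rwa [hai])]

/-- Monomials of complementary degree are dual bases for the pairing by `topCoeff`. -/
theorem sum_topCoeff_mul_topCoeff {p : ℕ} (I I' : Finset (Fin n)) (hI : I.card = p)
    (hI' : I'.card = p) (hp : p ≤ n) :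
    ∑ T ∈ Finset.powersetCard (n - p) Finset.univ,
      topCoeff (antiMonomial I * antiMonomial T) * topCoeff (antiMonomial I' * antiMonomial T) =
    if I = I' then 1 else 0 := by
  have hc : (Iᶜ : Finset (Fin n)).card = n - p := by rw [Finset.card_compl, hI, Fintype.card_fin]
  rw [Finset.sum_eq_single Iᶜ]
  · split_ifs with h
    · subst h
      exact topCoeff_antiMonomial_mul_self _ _ (by omega) disjoint_compl_right
    · rw [topCoeff_antiMonomial_mul_eq_zero I' _ (by omega), mul_zero]
      rw [disjoint_compl_right_iff]
      intro h'
      exact h (Finset.eq_of_subset_of_card_le h' (by omega)).symm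
  · intro T hT hne
    rw [Finset.mem_powersetCard] at hT
    rw [topCoeff_antiMonomial_mul_eq_zero I T (by omega), zero_mul]
    intro hd
    exact hne (Finset.eq_of_subset_of_card_le (by
      rw [Finset.subset_compl_iff_disjoint_left]; exact hd) (by omega))
  · intro h
    exact absurd (Finset.mem_powersetCard.2 ⟨Finset.subset_univ _, hc⟩) h

theorem prod_map_orderedInsert (f : Fin n → Cotangent n) (k : Fin n) (l : List (Fin n))
    (hl : l.Pairwise (· < ·)) (hk : k ∉ l) :
    ((l.orderedInsert (· ≤ ·) k).map fun j => ExteriorAlgebra.ι ℂ (f j)).prod =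
      (-1 : ℂ) ^ (l.filter (· < k)).length •
        (ExteriorAlgebra.ι ℂ (f k) * (l.map fun j => ExteriorAlgebra.ι ℂ (f j)).prod) := by
  induction l with
  | nil => simp
  | cons a l ih =>
    rw [List.orderedInsert]
    rw [List.pairwise_cons] at hl
    simp only [List.mem_cons, not_or] at hk
    split_ifs with h
    · have h0 : ∀ b ∈ a :: l, ¬ b < k := by
        intro b hb
        rw [List.mem_cons] at hb
        rcases hb with rfl | hb
        · exact not_lt.2 h
        · exact not_lt.2 (h.trans (hl.1 b hb).le)
      rw [List.filter_eq_nil_iff.2 (by simpa using h0)]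
      simp
    · rw [List.map_cons, List.prod_cons, ih hl.2 hk.2,
        List.filter_cons_of_pos (by simpa using not_le.1 h), List.length_cons, List.map_cons,
        List.prod_cons, ← mul_assoc (ExteriorAlgebra.ι ℂ (f k)),
        eq_neg_of_add_eq_zero_left (ExteriorAlgebra.ι_add_mul_swap (f k) (f a))]
      simp [pow_succ, mul_assoc]

/-- Moving `dw̄_k` to its place in `dw̄^{J ∪ {k}}` gives the sign `(-1)^(μ(k,J) - 1)`. -/
theorem ι_mul_antiMonomial (k : Fin n) (J : Finset (Fin n)) (hk : k ∉ J) :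
    ExteriorAlgebra.ι ℂ (Pi.single (Coord.wbar k) 1) * antiMonomial J =
      (-1 : ℂ) ^ (J.filter (· < k)).card • antiMonomial (insert k J) := by
  have h1 : (insert k J).sort = J.sort.orderedInsert (· ≤ ·) k := by
    refine List.Perm.eq_of_pairwise' (Finset.pairwise_sort _ _)
      (List.Pairwise.orderedInsert _ _ (Finset.pairwise_sort _ _)) ?_
    refine List.Perm.trans ?_ (List.perm_orderedInsert _ _ _).symm
    rw [List.perm_ext_iff_of_nodup (Finset.sort_nodup _ _)]
    · simp
    · simpa [List.nodup_cons] using hk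
  have h2 : (J.sort.filter (· < k)).length = (J.filter (· < k)).card := by
    rw [← List.toFinset_card_of_nodup ((Finset.sort_nodup _ _).filter _), List.toFinset_filter,
      Finset.sort_toFinset]
    simp
  have h3 := prod_map_orderedInsert (fun j => Pi.single (Coord.wbar j) 1) k J.sort
    (Finset.sortedLT_sort _).pairwise (by simpa using hk)
  rw [← h1, h2] at h3
  rw [antiMonomial, antiMonomial]
  change _ = _ • ((insert k J).sort.map fun j =>
    ExteriorAlgebra.ι ℂ (Pi.single (Coord.wbar j) 1)).prod
  rw [h3, smul_smul, ← pow_add, Even.neg_one_pow ⟨_, rfl⟩, one_smul]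
  rfl

theorem topCoeff_ι_mul_eq_zero (k : Fin n) (J T : Finset (Fin n)) (hk : k ∈ J) :
    topCoeff (ExteriorAlgebra.ι ℂ (Pi.single (Coord.wbar k) 1) * antiMonomial J *
      antiMonomial T) = 0 := by
  obtain ⟨a, ha, hai, ham⟩ := exists_sort_eq_ofFn J rfl
  obtain ⟨i, rfl⟩ := (ham k).1 hk
  have := ExteriorAlgebra.ι_mul_prod_list (R := ℂ)
    (fun i => (Pi.single (Coord.wbar (a i)) 1 : Cotangent n)) i
  rw [antiMonomial_eq_wedge ha]
  rw [wedge, this, zero_mul]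
  exact coeff_zero _

/-- Expansion of `(∑ₖ xₖ dw̄ₖ) ∧ dw̄^J`. -/
theorem topCoeff_antiOneForm_mul (x : Fin n → ℂ) (J T : Finset (Fin n)) :
    topCoeff (ExteriorAlgebra.ι ℂ (antiOneForm x) * antiMonomial J * antiMonomial T) =
      ∑ k, if k ∈ J then 0 else x k * (-1) ^ (J.filter (· < k)).card *
        topCoeff (antiMonomial (insert k J) * antiMonomial T) := by
  rw [antiOneForm, map_sum, Finset.sum_mul, Finset.sum_mul, topCoeff, coeff_sum]
  refine Finset.sum_congr rfl fun k _ => ?_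
  rw [map_smul, smul_mul_assoc, smul_mul_assoc, coeff_smul]
  split_ifs with hk
  · rw [← topCoeff, topCoeff_ι_mul_eq_zero k J T hk, mul_zero]
  · rw [ι_mul_antiMonomial k J hk, smul_mul_assoc, coeff_smul, topCoeff, mul_assoc]

end Exterior

/-! ### The Cauchy kernel of Charpentier's section -/

section CauchyKernel

variable {n : ℕ}

theorem dotBar_eq_inner (w z : Cn n) : dotBar w z = inner ℂ z w := by
  simp [dotBar, PiLp.inner_apply]

theorem dotBar_self (w : Cn n) : dotBar w w = ((‖w‖ ^ 2 : ℝ) : ℂ) := by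
  rw [dotBar_eq_inner, inner_self_eq_norm_sq_to_K]
  norm_cast

theorem oneSubSq_eq (w : Cn n) : oneSubSq w = 1 - dotBar w w := by
  rw [dotBar_self, oneSubSq]
  push_cast
  rfl

theorem conj_dotBar (w z : Cn n) : conj (dotBar w z) = dotBar z w := by
  simp [dotBar, mul_comm]

theorem dotBar_single_left (j : Fin n) (a : ℂ) (z : Cn n) :
    dotBar (EuclideanSpace.single j a) z = a * conj (z j) := by
  rw [dotBar_eq_inner, EuclideanSpace.inner_single_right]

theorem dotBar_single_right (j : Fin n) (a : ℂ) (w : Cn n) :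
    dotBar w (EuclideanSpace.single j a) = w j * conj a := by
  rw [dotBar_eq_inner, EuclideanSpace.inner_single_left, mul_comm]

theorem dotBar_zero_left (z : Cn n) : dotBar 0 z = 0 := by simp [dotBar]

theorem dotBar_zero_right (w : Cn n) : dotBar w 0 = 0 := by simp [dotBar]

/-- Evaluation of a coordinate, as a real-linear map. -/
def coordL (i : Fin n) : Cn n →L[ℝ] ℂ := (EuclideanSpace.proj i : Cn n →L[ℂ] ℂ).restrictScalars ℝ

/-- Evaluation of the conjugate of a coordinate, as a real-linear map. -/
def conjCoordL (i : Fin n) : Cn n →L[ℝ] ℂ := (Complex.conjCLE : ℂ →L[ℝ] ℂ).comp (coordL i)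

theorem coordL_apply (i : Fin n) (w : Cn n) : coordL i w = w i := rfl

theorem conjCoordL_apply (i : Fin n) (w : Cn n) : conjCoordL i w = conj (w i) := rfl

theorem hasFDerivAt_dotBar (p : Cn n × Cn n) : ∃ L : Cn n × Cn n →L[ℝ] ℂ,
    HasFDerivAt (fun p : Cn n × Cn n => dotBar p.1 p.2) L p ∧
      ∀ v, L v = dotBar v.1 p.2 + dotBar p.1 v.2 := by
  refine ⟨_, (hasFDerivAt_snd (𝕜 := ℝ) (p := p)).inner ℂ
    (hasFDerivAt_fst (𝕜 := ℝ) (p := p)) |>.congr_of_eventuallyEq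
    (Filter.Eventually.of_forall fun p => dotBar_eq_inner _ _), fun v => ?_⟩
  simp [dotBar_eq_inner]

theorem hasFDerivAt_oneSubSq (p : Cn n × Cn n) : ∃ L : Cn n × Cn n →L[ℝ] ℂ,
    HasFDerivAt (fun p : Cn n × Cn n => oneSubSq p.1) L p ∧
      ∀ v, L v = -(dotBar v.1 p.1 + dotBar p.1 v.1) := by
  have h := (hasFDerivAt_fst (𝕜 := ℝ) (p := p))
  refine ⟨_, ((hasFDerivAt_const (1 : ℂ) p).sub (h.inner ℂ h)).congr_of_eventuallyEq
    (Filter.Eventually.of_forall fun p => ?_), fun v => ?_⟩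
  · simp [oneSubSq_eq, dotBar_eq_inner]
  · simp [dotBar_eq_inner]

theorem fderiv_charpentierSection (i : Fin n) (w z : Cn n) (v : Cn n × Cn n) :
    fderiv ℝ (charpentierSection i) (w, z) v =
      conj (v.1 i) * (1 - dotBar w z) - conj (w i) * (dotBar v.1 z + dotBar w v.2)
        - conj (v.2 i) * oneSubSq w + conj (z i) * (dotBar v.1 w + dotBar w v.1) := by
  obtain ⟨L, hL, hL'⟩ := hasFDerivAt_dotBar (w, z)
  obtain ⟨M, hM, hM'⟩ := hasFDerivAt_oneSubSq (w, z)
  have h1 : HasFDerivAt (fun p : Cn n × Cn n => conj (p.1 i))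
      ((conjCoordL i).comp (ContinuousLinearMap.fst ℝ (Cn n) (Cn n))) (w, z) :=
    ((conjCoordL i).comp (ContinuousLinearMap.fst ℝ (Cn n) (Cn n))).hasFDerivAt
  have h2 : HasFDerivAt (fun p : Cn n × Cn n => conj (p.2 i))
      ((conjCoordL i).comp (ContinuousLinearMap.snd ℝ (Cn n) (Cn n))) (w, z) :=
    ((conjCoordL i).comp (ContinuousLinearMap.snd ℝ (Cn n) (Cn n))).hasFDerivAt
  have h := (h1.mul ((hasFDerivAt_const (1 : ℂ) _).sub hL)).sub (h2.mul hM)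
  have h' : HasFDerivAt (charpentierSection i) _ (w, z) := h
  rw [h'.fderiv]
  simp [hL', hM', conjCoordL_apply]
  ring

theorem coordDeriv_charpentierSection_wbar (i j : Fin n) (w z : Cn n) :
    coordDeriv (charpentierSection i) (w, z) (.wbar j) =
      (if i = j then 1 - dotBar w z else 0) + w j * conj (z i) := by
  simp only [coordDeriv, fderiv_charpentierSection, dotBar_single_left, dotBar_single_right,
    dotBar_zero_right]
  have hI : Complex.I * Complex.I = -1 := Complex.I_mul_I
  split_ifs with h
  · subst h
    simp
    linear_combination (-(1 - dotBar w z) / 2 - w i * conj (z i) / 2) * hI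
  · simp [h]
    linear_combination (- conj (w i) * conj (z j) / 2 + conj (z i) * conj (w j) / 2
      - w j * conj (z i) / 2) * hI

theorem coordDeriv_charpentierSection_zbar (i j : Fin n) (w z : Cn n) :
    coordDeriv (charpentierSection i) (w, z) (.zbar j) =
      -(if i = j then oneSubSq w else 0) - w j * conj (w i) := by
  simp only [coordDeriv, fderiv_charpentierSection, dotBar_single_right,
    dotBar_zero_left, dotBar_zero_right]
  have hI : Complex.I * Complex.I = -1 := Complex.I_mul_I
  split_ifs with h
  · subst h
    simp
    linear_combination (oneSubSq w / 2 + w i * conj (w i) / 2) * hI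
  · simp [h]
    linear_combination (conj (w i) * w j / 2) * hI

theorem fderiv_sub_coord (i : Fin n) (p v : Cn n × Cn n) :
    fderiv ℝ (fun p : Cn n × Cn n => p.1 i - p.2 i) p v = v.1 i - v.2 i := by
  have h : HasFDerivAt (fun p : Cn n × Cn n => p.1 i - p.2 i)
      ((coordL i).comp (ContinuousLinearMap.fst ℝ (Cn n) (Cn n)) -
        (coordL i).comp (ContinuousLinearMap.snd ℝ (Cn n) (Cn n))) p :=
    ((coordL i).comp (ContinuousLinearMap.fst ℝ (Cn n) (Cn n)) -
        (coordL i).comp (ContinuousLinearMap.snd ℝ (Cn n) (Cn n))).hasFDerivAt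
  rw [h.fderiv]
  simp [coordL_apply]

theorem coordDeriv_sub_coord_wbar (i j : Fin n) (p : Cn n × Cn n) :
    coordDeriv (fun p : Cn n × Cn n => p.1 i - p.2 i) p (.wbar j) = 0 := by
  simp only [coordDeriv, fderiv_sub_coord]
  by_cases h : i = j <;> simp [h]

theorem coordDeriv_sub_coord_zbar (i j : Fin n) (p : Cn n × Cn n) :
    coordDeriv (fun p : Cn n × Cn n => p.1 i - p.2 i) p (.zbar j) = 0 := by
  simp only [coordDeriv, fderiv_sub_coord]
  by_cases h : i = j <;> simp [h]

theorem coordDeriv_sub_coord_w (i j : Fin n) (p : Cn n × Cn n) :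
    coordDeriv (fun p : Cn n × Cn n => p.1 i - p.2 i) p (.w j) = if i = j then 1 else 0 := by
  simp only [coordDeriv, fderiv_sub_coord]
  by_cases h : i = j <;> simp [h]
  norm_num

/-- The section satisfies `s(w,z) (w - z) = △(w,z)`. -/
theorem sum_charpentierSection_mul (w z : Cn n) :
    ∑ i, charpentierSection i (w, z) * (w i - z i) = ((triangle w z : ℝ) : ℂ) := by
  have h : ∀ a b : ℂ, ∑ i, (conj (w i) * a - conj (z i) * b) * (w i - z i) =
      (dotBar w w - dotBar z w) * a - (dotBar w z - dotBar z z) * b := by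
    intro a b
    simp only [dotBar, ← Finset.sum_sub_distrib, Finset.sum_mul]
    exact Finset.sum_congr rfl fun i _ => by ring
  have h' : ∑ i, charpentierSection i (w, z) * (w i - z i) = _ := h (1 - dotBar w z) (oneSubSq w)
  rw [h', oneSubSq_eq, triangle]
  push_cast
  rw [← Complex.conj_mul', map_sub, map_one, conj_dotBar, ← Complex.ofReal_pow,
    ← Complex.ofReal_pow, ← dotBar_self, ← dotBar_self]
  ring

/-- The index of a coordinate differential, forgetting its type. -/
def Coord.idx : Coord n → Fin n
  | .w j => j
  | .wbar j => j
  | .z j => j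
  | .zbar j => j

theorem sort_erase_univ {N : ℕ} (i : Fin (N + 1)) :
    (Finset.univ.erase i).sort = List.ofFn i.succAbove := by
  refine List.Perm.eq_of_pairwise' (Finset.pairwise_sort _ (· ≤ ·)) ?_ ?_
  · rw [List.pairwise_ofFn]
    intro a b hab
    exact (Fin.strictMono_succAbove i hab).le
  · rw [List.perm_ext_iff_of_nodup (Finset.sort_nodup _ _)
      (List.nodup_ofFn.2 Fin.succAbove_right_injective)]
    intro a
    simp [List.mem_ofFn, Fin.exists_succAbove_eq_iff]

theorem wedge_antiOneForm_mul {N : ℕ} (x : Fin (N + 1) → ℂ) (a : Fin N → Fin (N + 1)) :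
    topCoeff (ExteriorAlgebra.ι ℂ (antiOneForm x) *
        wedge fun i => Pi.single (Coord.wbar (a i)) 1) =
      Matrix.det (Matrix.of fun i j =>
        (Fin.cons x (fun k : Fin N => Pi.single (a k) 1) : Fin (N + 1) → Fin (N + 1) → ℂ) j i) := by
  have : ExteriorAlgebra.ι ℂ (antiOneForm x) * wedge (fun i => Pi.single (Coord.wbar (a i)) 1) =
      wedge (Fin.cons (antiOneForm x) fun i => Pi.single (Coord.wbar (a i)) 1) := by
    rw [wedge_succ]
    simp
  rw [this, topCoeff_wedge, ← Matrix.det_transpose]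
  congr 1
  ext i j
  refine Fin.cases ?_ (fun k => ?_) j
  · simp [antiOneForm_wbar]
  · simp [Pi.single_apply]

/-- The factor `ρ` for which `∂_c s ≡ ρ L ε_k` modulo `s`, where `L = (1 - |w|²) I + w̄ wᵀ` and `c`
is the field `∂/∂z̄_k` (`ρ = -1`) or `∂/∂w̄_k` (`ρ = A / r`, with `A = 1 - w z̄` and `r = 1 - |w|²`).
The value at `∂/∂w_k` and `∂/∂z_k` is arbitrary. -/
def sectionScale (A r : ℂ) : Coord n → ℂ
  | .zbar _ => -1
  | _ => A / r

/-- The left-hand side is the Laplace expansion of the determinant with columns `s` and `∂_c s`. All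
of these columns are images under `L = (1 - |w|²) I + w̄ wᵀ`: `s = L (w̄ - z̄)` and, up to factors
and modulo `s`, `∂_c s` is the image of a basis vector. So the determinant is `det L = (1 - |w|²)^N`
times the determinant with columns `w̄ - z̄` and basis vectors. -/
theorem det_section_eq {N : ℕ} (w z : Cn (N + 1)) (hr : oneSubSq w ≠ 0)
    (c : Fin N → Coord (N + 1)) (hc : ∀ j, (∃ k, c j = .zbar k) ∨ ∃ k, c j = .wbar k) :
    ∑ i : Fin (N + 1), (-1) ^ (i : ℕ) * charpentierSection i (w, z) *
        Matrix.det (Matrix.of fun (k j : Fin N) =>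
          coordDeriv (charpentierSection (i.succAbove k)) (w, z) (c j)) =
      oneSubSq w ^ N * (∏ j, sectionScale (1 - dotBar w z) (oneSubSq w) (c j)) *
        topCoeff (ExteriorAlgebra.ι ℂ (antiOneForm fun k => conj (w k) - conj (z k)) *
          wedge fun j => Pi.single (Coord.wbar (c j).idx) 1) := by
  set A := 1 - dotBar w z with hA
  set r := oneSubSq w with hr'
  set x : Fin (N + 1) → ℂ := fun k => conj (w k) - conj (z k) with hx
  set L : Matrix (Fin (N + 1)) (Fin (N + 1)) ℂ :=
    Matrix.of fun i k => (if i = k then r else 0) + conj (w i) * w k with hL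
  have hrw : r = 1 - ∑ k, w k * conj (w k) := oneSubSq_eq w
  have hLdet : L.det = r ^ N := by
    have h1 : L = r • (1 + Matrix.replicateCol Unit (fun i => conj (w i) / r) *
        Matrix.replicateRow Unit (fun k => w k)) := by
      ext i k
      simp [hL, Matrix.mul_apply, Matrix.one_apply, mul_add]
      field_simp
    rw [h1, Matrix.det_smul, Matrix.det_one_add_replicateCol_mul_replicateRow, Fintype.card_fin,
      pow_succ, mul_assoc]
    have h2 : (fun k => w k) ⬝ᵥ (fun i => conj (w i) / r) = (1 - r) / r := by
      rw [hrw, sub_sub_cancel, ← hrw, dotProduct, Finset.sum_div]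
      exact Finset.sum_congr rfl fun k _ => by ring
    rw [h2]
    field_simp
    ring
  have hLx : ∀ i, ∑ k, L i k * x k = charpentierSection i (w, z) := by
    intro i
    have h1 : ∑ k, L i k * x k = r * x i + conj (w i) * ∑ k, w k * x k := by
      simp only [hL, Matrix.of_apply, add_mul, ite_mul, zero_mul, Finset.sum_add_distrib,
        Finset.sum_ite_eq, Finset.mem_univ, if_true, Finset.mul_sum, mul_assoc]
    have h2 : ∑ k, w k * x k = A - r := by
      rw [hrw, hA, dotBar]
      simp only [hx, mul_sub, Finset.sum_sub_distrib]
      ring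
    rw [h1, h2, charpentierSection, ← hA, ← hr', hx]
    ring
  set M : Matrix (Fin (N + 1)) (Fin (N + 1)) ℂ := Matrix.of fun i j =>
    (Fin.cons (charpentierSection i (w, z))
      (fun k => coordDeriv (charpentierSection i) (w, z) (c k)) : Fin (N + 1) → ℂ) j with hM
  set V : Matrix (Fin (N + 1)) (Fin (N + 1)) ℂ := Matrix.of fun i j =>
    (Fin.cons x (fun k : Fin N => Pi.single (c k).idx 1) :
      Fin (N + 1) → Fin (N + 1) → ℂ) j i with hV
  set σ : Fin (N + 1) → ℂ := Fin.cons 1 (fun j => sectionScale A r (c j)) with hσ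
  have hM1 : M.det = (Matrix.of fun i j => σ j * (L * V) i j).det := by
    -- `μ j` is the multiple of `s` by which `∂_c s` differs from the image under `L`.
    set μ : Fin (N + 1) → ℂ := Fin.cons 0 fun j =>
      match c j with
      | .wbar k => -(w k / r)
      | _ => 0 with hμ
    rw [← Matrix.det_transpose M, ← Matrix.det_transpose (Matrix.of fun i j => σ j * (L * V) i j)]
    refine Matrix.det_eq_of_forall_row_eq_smul_add_const μ 0 (by simp [hμ]) fun j i => ?_
    rw [Matrix.transpose_apply, Matrix.transpose_apply, Matrix.transpose_apply]
    have h0 : (L * V) i 0 = charpentierSection i (w, z) := by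
      rw [← hLx i, Matrix.mul_apply]
      simp [hV]
    refine Fin.cases ?_ (fun j => ?_) j
    · simp [hμ, hσ, h0, hM]
    · have h1 : (L * V) i j.succ = L i (c j).idx := by
        rw [Matrix.mul_apply]
        simp [hV, Pi.single_apply]
      rw [Matrix.of_apply, Matrix.of_apply, h0, h1]
      rcases hc j with ⟨k, hk⟩ | ⟨k, hk⟩
      · simp [hσ, hμ, hk, sectionScale, hM, Coord.idx, hL, coordDeriv_charpentierSection_zbar]
        ring
      · simp only [hσ, hμ, hk, sectionScale, hM, Coord.idx, hL,
          coordDeriv_charpentierSection_wbar, Matrix.of_apply, Fin.cons_succ, Fin.cons_zero,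
          charpentierSection, ← hA, ← hr']
        split_ifs <;> field_simp <;> ring
  have hM2 : ∑ i : Fin (N + 1), (-1) ^ (i : ℕ) * charpentierSection i (w, z) *
        Matrix.det (Matrix.of fun (k j : Fin N) =>
          coordDeriv (charpentierSection (i.succAbove k)) (w, z) (c j)) = M.det := by
    rw [Matrix.det_succ_column_zero]
    rfl
  rw [hM2, hM1, Matrix.det_mul_row, Matrix.det_mul, hLdet, Fin.prod_univ_succ]
  rw [wedge_antiOneForm_mul]
  simp [hσ]
  ring

theorem prod_ofFn_map {α β : Type*} [CommMonoid β] {N : ℕ} (c : Fin N → α) (σ : α → β) :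
    ∏ j, σ (c j) = ((List.ofFn c).map σ).prod := by
  rw [List.map_ofFn, List.prod_ofFn]
  rfl

/-- The coefficient of `dz̄^Q ∧ dw̄^T ∧ dw₁ ∧ … ∧ dwₙ` in the Cauchy kernel. -/
theorem coeff_cauchyKernel {N : ℕ} (w z : Cn (N + 1)) (hr : oneSubSq w ≠ 0)
    (Q T : Finset (Fin (N + 1))) (hQT : Q.card + T.card = N) :
    coeff (monomialLabels ∅ Q T Finset.univ) (cauchyKernel (N + 1) w z) =
      (-oneSubSq w) ^ Q.card * (1 - dotBar w z) ^ T.card / ((triangle w z : ℝ) : ℂ) ^ (N + 1) *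
        topCoeff (ExteriorAlgebra.ι ℂ (antiOneForm fun k => conj (w k) - conj (z k)) *
          antiMonomial Q * antiMonomial T) := by
  set l : List (Coord (N + 1)) := Q.sort.map Coord.zbar ++ T.sort.map Coord.wbar with hl
  have hlen : l.length = N := by simp [hl, hQT]
  have hlab : monomialLabels ∅ Q T Finset.univ = l ++ List.ofFn Coord.w := by
    rw [monomialLabels, sort_univ_fin, List.map_ofFn, Finset.sort_empty]
    rfl
  obtain ⟨c, hc⟩ := exists_list_eq_ofFn l hlen
  have hmem : ∀ a ∈ l, (∃ k, a = .zbar k) ∨ ∃ k, a = .wbar k := by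
    intro a ha
    rw [hl, List.mem_append, List.mem_map, List.mem_map] at ha
    rcases ha with ⟨k, -, rfl⟩ | ⟨k, -, rfl⟩
    · exact Or.inl ⟨k, rfl⟩
    · exact Or.inr ⟨k, rfl⟩
  have hcj : ∀ j, (∃ k, c j = .zbar k) ∨ ∃ k, c j = .wbar k := fun j =>
    hmem _ (by rw [hc, List.mem_ofFn]; exact ⟨j, rfl⟩)
  have hσ : ∏ j, sectionScale (1 - dotBar w z) (oneSubSq w) (c j) =
      (-1) ^ Q.card * ((1 - dotBar w z) / oneSubSq w) ^ T.card := by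
    rw [prod_ofFn_map, ← hc, hl, List.map_append, List.prod_append, List.map_map, List.map_map]
    congr 1
    · rw [List.prod_eq_pow_card _ (-1), List.length_map, Finset.length_sort]
      intro y hy
      obtain ⟨k, -, rfl⟩ := List.mem_map.1 hy
      rfl
    · rw [List.prod_eq_pow_card _ ((1 - dotBar w z) / oneSubSq w), List.length_map,
        Finset.length_sort]
      intro y hy
      obtain ⟨k, -, rfl⟩ := List.mem_map.1 hy
      rfl
  have hmon : wedge (fun j => Pi.single (Coord.wbar (c j).idx) 1) =
      antiMonomial Q * antiMonomial T := by
    have h1 : wedge (fun j => Pi.single (Coord.wbar (c j).idx) 1) =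
        (l.map fun a => (coordForm (.wbar a.idx) : Form (N + 1))).prod := by
      rw [wedge, hc, List.map_ofFn]
      rfl
    rw [h1, hl, List.map_append, List.prod_append, List.map_map, List.map_map]
    rfl
  have hterm : ∀ i : Fin (N + 1), coeff (l ++ List.ofFn Coord.w)
      (wedgeOver (Finset.univ.erase i) (fun j => differential (charpentierSection j) (w, z)) *
        wedgeOver Finset.univ (fun j => differential (fun p => p.1 j - p.2 j) (w, z))) =
      Matrix.det (Matrix.of fun (k j : Fin N) =>
          coordDeriv (charpentierSection (i.succAbove k)) (w, z) (c j)) := by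
    intro i
    have h1 : wedgeOver Finset.univ (fun j => differential (fun p => p.1 j - p.2 j) (w, z)) =
        wedge fun j : Fin (N + 1) => coordDeriv (fun p => p.1 j - p.2 j) (w, z) :=
      wedgeOver_eq_wedge sort_univ_fin _
    have h2 : wedgeOver (Finset.univ.erase i)
        (fun j => differential (charpentierSection j) (w, z)) =
        wedge fun k => coordDeriv (charpentierSection (i.succAbove k)) (w, z) :=
      wedgeOver_eq_wedge (sort_erase_univ i) _
    rw [h1, h2, coeff_append_wedge_mul _ _ hlen, coeff_wedge, hc, coeff_wedge]
    · rw [show (Matrix.of fun i j : Fin (N + 1) =>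
        coordDeriv (fun p : Cn (N + 1) × Cn (N + 1) => p.1 i - p.2 i) (w, z) (.w j)) = 1 by
          ext i j
          simp [coordDeriv_sub_coord_w, Matrix.one_apply], Matrix.det_one, mul_one]
    · intro a ha
      refine contractLeft_wedge_eq_zero _ _ fun j => ?_
      rcases hmem a ha with ⟨k, rfl⟩ | ⟨k, rfl⟩
      · exact coordDeriv_sub_coord_zbar _ _ _
      · exact coordDeriv_sub_coord_wbar _ _ _
  rw [hlab, cauchyKernel, coeff_smul, coeff_sum, sum_charpentierSection_mul]
  simp only [coeff_smul, hterm]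
  rw [det_section_eq w z hr c hcj, hσ, hmon, ← mul_assoc (ExteriorAlgebra.ι ℂ _)]
  have hN : oneSubSq w ^ N = oneSubSq w ^ Q.card * oneSubSq w ^ T.card := by
    rw [← pow_add, hQT]
  rw [neg_pow (oneSubSq w), div_pow, hN]
  field_simp

theorem contractLeft_antiMonomial (c : Coord n) (hc : ∀ k, c ≠ .wbar k) (S : Finset (Fin n)) :
    CliffordAlgebra.contractLeft (LinearMap.proj c) (antiMonomial S) = 0 := by
  obtain ⟨a, ha, -, -⟩ := exists_sort_eq_ofFn S rfl
  rw [antiMonomial_eq_wedge ha]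
  refine contractLeft_wedge_eq_zero _ _ fun i => ?_
  simp [hc]

/-- The top coefficient of `dw̄^I ∧ dz̄^Q ∧ dw̄^T ∧ dw₁ ∧ … ∧ dwₙ`. When `|I| |Q|` is even, as it is
for `|I| = |Q| + 1`, moving `dz̄^Q` to the front produces no sign. -/
theorem coeff_antiMonomial_mul_monomial (I J Q T : Finset (Fin n)) (hIT : I.card + T.card = n)
    (hJQ : J.card = Q.card) (hev : Even (I.card * Q.card)) :
    coeff (monomialLabels ∅ J Finset.univ Finset.univ)
        (antiMonomial I * monomial ∅ Q T Finset.univ) =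
      if J = Q then topCoeff (antiMonomial I * antiMonomial T) else 0 := by
  obtain ⟨a, ha, hai, ham⟩ := exists_sort_eq_ofFn Q rfl
  obtain ⟨b, hb, hbi, hbm⟩ := exists_sort_eq_ofFn J hJQ
  obtain ⟨i, hi, -, -⟩ := exists_sort_eq_ofFn I rfl
  obtain ⟨c, hc, -⟩ := exists_antiMonomial_mul_eq_wedge I T hIT
  set Z : Form n := wedgeOver Q fun j => coordForm (.zbar j) with hZ
  set Ω : Form n := wedgeOver Finset.univ fun j => coordForm (.w j) with hΩ
  have hZ' : Z = wedge fun k => Pi.single (Coord.zbar (a k)) 1 := wedgeOver_eq_wedge ha _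
  have hΩ' : Ω = wedge fun k : Fin n => Pi.single (Coord.w k) 1 :=
    wedgeOver_eq_wedge sort_univ_fin _
  have h1 : antiMonomial I * monomial ∅ Q T Finset.univ =
      Z * ((antiMonomial I * antiMonomial T) * Ω) := by
    have : monomial ∅ Q T Finset.univ = Z * antiMonomial T * Ω := by
      simp [monomial, wedgeOver, Z, Ω, antiMonomial]
    rw [this, ← mul_assoc, ← mul_assoc, hZ', antiMonomial_eq_wedge hi, wedge_mul_comm,
      hev.neg_one_pow, one_smul]
    simp only [mul_assoc]
  have h2 : monomialLabels ∅ J Finset.univ Finset.univ =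
      List.ofFn (fun k => Coord.zbar (b k)) ++
        (List.ofFn (Coord.wbar (n := n)) ++ List.ofFn Coord.w) := by
    rw [monomialLabels, sort_univ_fin, hb, List.map_ofFn, List.map_ofFn, List.map_ofFn,
      Finset.sort_empty, List.map_nil, List.nil_append, List.append_assoc]
    rfl
  have hΩk : ∀ d : Coord n, (∀ k, d ≠ .w k) →
      CliffordAlgebra.contractLeft (LinearMap.proj d) Ω = 0 := by
    intro d hd
    rw [hΩ']
    refine contractLeft_wedge_eq_zero _ _ fun i => ?_
    simp [hd]
  have h3 : coeff (List.ofFn Coord.w) Ω = 1 := by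
    rw [hΩ', coeff_wedge, show (Matrix.of fun i j : Fin n =>
      (Pi.single (Coord.w i) 1 : Cotangent n) (.w j)) = 1 by
        ext i j
        simp [Pi.single_apply, Matrix.one_apply, eq_comm], Matrix.det_one]
  rw [h1, h2, hZ', coeff_append_wedge_mul _ _ (by simp), hc, coeff_append_wedge_mul _ _ (by simp),
    h3, mul_one, ← hc, coeff_wedge]
  · have h4 : (Matrix.of fun i j =>
        (Pi.single (Coord.zbar (a i)) 1 : Cotangent n) (.zbar (b j))).det =
        if J = Q then 1 else 0 := by
      split_ifs with h
      · subst h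
        have hab : a = b := List.ofFn_injective (ha.symm.trans hb)
        subst hab
        rw [show (Matrix.of fun i j =>
          (Pi.single (Coord.zbar (a i)) 1 : Cotangent n) (.zbar (a j))) = 1 by
            ext i j
            simp [Pi.single_apply, Matrix.one_apply, eq_comm, hai.eq_iff], Matrix.det_one]
      · have : ¬ J ⊆ Q := fun h' => h (Finset.eq_of_subset_of_card_le h' hJQ.ge)
        obtain ⟨k, hkJ, hkQ⟩ := Finset.not_subset.1 this
        obtain ⟨j, rfl⟩ := (hbm k).1 hkJ
        refine Matrix.det_eq_zero_of_column_eq_zero j fun i => ?_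
        have : b j ≠ a i := fun h' => hkQ ((ham _).2 ⟨i, h'.symm⟩)
        simp [Pi.single_apply, this]
    rw [h4, ← topCoeff]
    simp
  · intro d hd
    rw [List.mem_ofFn] at hd
    obtain ⟨k, rfl⟩ := hd
    exact hΩk _ (by simp)
  · intro d hd
    rw [List.mem_ofFn] at hd
    obtain ⟨k, rfl⟩ := hd
    refine contractLeft_mul_eq_zero _ _ _ (contractLeft_mul_eq_zero _ _ _ ?_ ?_) (hΩk _ (by simp))
    · exact contractLeft_antiMonomial _ (by simp) _
    · exact contractLeft_antiMonomial _ (by simp) _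

theorem dbarPow_zero_apply {q : ℕ} (η : Cn n → AntiForm n (q + 1)) (z w : Cn n)
    (J : MultiIndex n q) :
    dbarPow 0 η z w J = ∑ k, (conj (w k) - conj (z k)) * interiorProd η J k w := by
  simp [dbarPow, zbarPow, dbarIter]

/-- The constant in the explicit formula for `η ∧ 𝒞ₙ^{0,q}`. -/
def kernelConst (n q : ℕ) : ℂ := volumeConst n * (-1) ^ (q + 1)

theorem oneSubSq_ne_zero {w : Cn n} (hw : ‖w‖ < 1) : oneSubSq w ≠ 0 := by
  rw [oneSubSq, Ne, Complex.ofReal_eq_zero]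
  nlinarith [norm_nonneg w]

/-- Explicit formula for the kernel: `η ∧ 𝒞ₙ^{0,q} = const · Φₙ^q 𝒟̄⁰η dV`. -/
theorem charpentierDensity_eq {q : ℕ} (hq : q < n) (η : Cn n → AntiForm n (q + 1)) (z w : Cn n)
    (hw : ‖w‖ < 1) :
    charpentierDensity η z w = kernelConst n q • (phi n q w z • dbarPow 0 η z w) := by
  obtain ⟨N, rfl⟩ : ∃ N, n = N + 1 := ⟨n - 1, by omega⟩
  funext J
  set p := N + 1 - (q + 1) with hp
  have hr := oneSubSq_ne_zero hw
  have hkernel : charpentierKernel (N + 1) q w z =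
      ∑ Q ∈ Finset.powersetCard q Finset.univ, ∑ T ∈ Finset.powersetCard p Finset.univ,
        coeff (monomialLabels ∅ Q T Finset.univ) (cauchyKernel (N + 1) w z) •
          monomial ∅ Q T Finset.univ := by
    have h : ∀ n : ℕ, Finset.powersetCard n (Finset.univ : Finset (Fin n)) = {Finset.univ} := by
      intro n
      have := Finset.powersetCard_self (Finset.univ : Finset (Fin n))
      rwa [Finset.card_fin] at this
    have h' : N + 1 - q - 1 = p := by omega
    rw [charpentierKernel, bidegreePart, Finset.powersetCard_zero, Finset.sum_singleton, h, h']
    simp only [Finset.sum_singleton]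
  set C : ℂ := (-oneSubSq w) ^ q * (1 - dotBar w z) ^ (N - q) /
    ((triangle w z : ℝ) : ℂ) ^ (N + 1) with hC
  set x : Fin (N + 1) → ℂ := fun k => conj (w k) - conj (z k) with hx
  have hJ : J.1 ∈ Finset.powersetCard q (Finset.univ : Finset (Fin (N + 1))) :=
    Finset.mem_powersetCard.2 ⟨Finset.subset_univ _, J.2⟩
  have hmain : coeff (monomialLabels ∅ J.1 Finset.univ Finset.univ)
      ((η w).toForm * charpentierKernel (N + 1) q w z) =
      ∑ I : MultiIndex (N + 1) (q + 1), η w I * ∑ T ∈ Finset.powersetCard p Finset.univ,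
        C * topCoeff (ExteriorAlgebra.ι ℂ (antiOneForm x) * antiMonomial J.1 * antiMonomial T) *
          topCoeff (antiMonomial I.1 * antiMonomial T) := by
    rw [AntiForm.toForm, Finset.sum_mul, coeff_sum]
    refine Finset.sum_congr rfl fun I _ => ?_
    rw [smul_mul_assoc, coeff_smul, hkernel, Finset.mul_sum, coeff_sum]
    congr 1
    rw [Finset.sum_eq_single_of_mem J.1 hJ]
    · rw [Finset.mul_sum, coeff_sum]
      refine Finset.sum_congr rfl fun T hT => ?_
      have hT := (Finset.mem_powersetCard.1 hT).2
      rw [mul_smul_comm, coeff_smul]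
      change _ * coeff _ (antiMonomial I.1 * _) = _
      rw [coeff_antiMonomial_mul_monomial _ _ _ _ (by rw [I.2, hT]; omega) rfl
        (by rw [I.2, J.2, mul_comm]; exact Nat.even_mul_succ_self q), if_pos rfl,
        coeff_cauchyKernel w z hr _ _ (by rw [J.2, hT]; omega), J.2, hT, hC,
        show p = N - q by omega]
    · intro Q hQ hne
      have hQ := (Finset.mem_powersetCard.1 hQ).2
      rw [Finset.mul_sum, coeff_sum]
      refine Finset.sum_eq_zero fun T hT => ?_
      have hT := (Finset.mem_powersetCard.1 hT).2
      rw [mul_smul_comm, coeff_smul]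
      change _ * coeff _ (antiMonomial I.1 * _) = _
      rw [coeff_antiMonomial_mul_monomial _ _ _ _ (by rw [I.2, hT]; omega) (by rw [J.2, hQ])
        (by rw [I.2, hQ, mul_comm]; exact Nat.even_mul_succ_self q), if_neg hne.symm, mul_zero]
  have hsum : ∀ I : MultiIndex (N + 1) (q + 1), ∑ T ∈ Finset.powersetCard p Finset.univ,
        C * topCoeff (ExteriorAlgebra.ι ℂ (antiOneForm x) * antiMonomial J.1 * antiMonomial T) *
          topCoeff (antiMonomial I.1 * antiMonomial T) =
      C * ∑ k, if k ∈ J.1 then 0 else x k * (-1) ^ (J.1.filter (· < k)).card *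
        if insert k J.1 = I.1 then 1 else 0 := by
    intro I
    simp_rw [topCoeff_antiOneForm_mul, mul_assoc C, ← Finset.mul_sum, Finset.sum_mul]
    rw [Finset.sum_comm]
    congr 1
    refine Finset.sum_congr rfl fun k _ => ?_
    by_cases hk : k ∈ J.1
    · simp [hk]
    · simp only [hk, if_false]
      rw [← sum_topCoeff_mul_topCoeff (insert k J.1) I.1 (by
        rw [Finset.card_insert_of_notMem hk, J.2]) I.2 (by omega), Finset.mul_sum]
      exact Finset.sum_congr rfl fun T _ => by ring
  rw [charpentierDensity, fiberDensity, hmain, Pi.smul_apply, Pi.smul_apply, dbarPow_zero_apply]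
  simp_rw [hsum, Finset.mul_sum]
  rw [Finset.sum_comm, smul_eq_mul, smul_eq_mul, Finset.mul_sum, Finset.mul_sum]
  refine Finset.sum_congr rfl fun k _ => ?_
  by_cases hk : k ∈ J.1
  · simp [hk, interiorProd]
  · rw [Finset.sum_eq_single (J.insert k hk)]
    · have : insert k J.1 = (J.insert k hk).1 := rfl
      simp only [hk, if_false, this, if_true, interiorProd, dif_pos, not_false_eq_true, insertPos,
        kernelConst, phi, hC, hx]
      rw [Nat.add_sub_cancel, neg_pow (oneSubSq w), pow_succ, pow_succ]
      ring
    · intro I _ hne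
      have : insert k J.1 ≠ I.1 := fun h => hne (Subtype.ext h.symm)
      simp [this]
    · simp

end CauchyKernel

/-! ### The divergence theorem on the unit ball -/

section Divergence

open Filter Topology Set

variable {E : Type*} [NormedAddCommGroup E]

theorem uniqueDiffOn_closedBall [NormedSpace ℝ E] : UniqueDiffOn ℝ (closedBall (0 : E) 1) :=
  uniqueDiffOn_convex (convex_closedBall _ _)
    ⟨0, ball_subset_interior_closedBall (mem_ball_self one_pos)⟩

/-- Integration in polar coordinates. -/
theorem integral_eq_integral_polar [NormedSpace ℝ E] [MeasurableSpace E] [BorelSpace E]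
    [FiniteDimensional ℝ E] [Nontrivial E] (μ : Measure E) [μ.IsAddHaarMeasure] {F : E → ℂ}
    (hF : Integrable F μ) :
    ∫ x, F x ∂μ = ∫ r in Ioi (0 : ℝ), r ^ (Module.finrank ℝ E - 1) •
      ∫ ζ : sphere (0 : E) 1, F (r • (ζ : E)) ∂μ.toSphere := by
  have hmp := μ.measurePreserving_homeomorphUnitSphereProd
  have hemb := (homeomorphUnitSphereProd E).measurableEmbedding
  set G : sphere (0 : E) 1 × Ioi (0 : ℝ) → ℂ := fun p => F (p.2.1 • p.1.1) with hG
  have hGc : ∀ x : ({0}ᶜ : Set E), G (homeomorphUnitSphereProd E x) = F x := by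
    intro x
    have hx : ‖(x : E)‖ ≠ 0 := norm_ne_zero_iff.2 x.2
    simp [hG, smul_smul, hx]
  have h1 : ∫ x, F x ∂μ = ∫ x : ({0}ᶜ : Set E), F x ∂(μ.comap (↑)) := by
    rw [integral_subtype_comap (measurableSet_singleton _).compl F, restrict_compl_singleton]
  have hGint : Integrable G (μ.toSphere.prod (.volumeIoiPow (Module.finrank ℝ E - 1))) := by
    rw [← hmp.integrable_comp_emb hemb]
    have : G ∘ homeomorphUnitSphereProd E = F ∘ ((↑) : ({0}ᶜ : Set E) → E) := funext hGc
    rw [this, ← integrableOn_iff_comap_subtypeVal (measurableSet_singleton _).compl]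
    exact hF.integrableOn
  rw [h1]
  simp_rw [← hGc]
  rw [hmp.integral_comp hemb, integral_prod_symm _ hGint]
  simp only [Measure.volumeIoiPow, ENNReal.ofReal]
  rw [integral_withDensity_eq_integral_smul,
    integral_subtype_comap measurableSet_Ioi fun r : ℝ =>
      Real.toNNReal (r ^ (Module.finrank ℝ E - 1)) • ∫ ζ, F (r • (ζ : E)) ∂μ.toSphere]
  · refine setIntegral_congr_fun measurableSet_Ioi fun r hr => ?_
    rw [NNReal.smul_def, Real.coe_toNNReal _ (pow_nonneg hr.out.le _)]
  · exact (measurable_subtype_coe.pow_const _).real_toNNReal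

/-- A smooth cutoff function of `t`, equal to `1` for `t ≤ 1 - 2 / k` and to `0` for
`t ≥ 1 - 1 / k`. -/
def cutoff (k : ℕ) (t : ℝ) : ℝ := Real.smoothTransition (k * (1 - t) - 1)

theorem contDiff_cutoff (k : ℕ) : ContDiff ℝ ∞ (cutoff k) :=
  Real.smoothTransition.contDiff.comp (by fun_prop)

theorem cutoff_eq_zero {k : ℕ} {t : ℝ} (h : k * (1 - t) ≤ 1) : cutoff k t = 0 :=
  Real.smoothTransition.zero_of_nonpos (by linarith)

theorem cutoff_eq_one {k : ℕ} {t : ℝ} (h : 2 ≤ k * (1 - t)) : cutoff k t = 1 :=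
  Real.smoothTransition.one_of_one_le (by linarith)

theorem cutoff_antitone (k : ℕ) : Antitone (cutoff k) := fun s t h =>
  Real.smoothTransition.monotone (by
    have : (k : ℝ) * (1 - t) ≤ k * (1 - s) := by gcongr
    linarith)

theorem deriv_cutoff_nonpos (k : ℕ) (t : ℝ) : deriv (cutoff k) t ≤ 0 := by
  have h := (cutoff_antitone k).neg
  have h2 : 0 ≤ derivWithin (-cutoff k) univ t := (h.monotoneOn univ).derivWithin_nonneg
  rw [derivWithin_univ, deriv.neg] at h2
  linarith

theorem deriv_cutoff_eq_zero_of_lt {k : ℕ} {t : ℝ} (h : k * (1 - t) < 1) :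
    deriv (cutoff k) t = 0 := by
  have h1 : ∀ᶠ s in 𝓝 t, (k : ℝ) * (1 - s) < 1 :=
    (Continuous.tendsto (by fun_prop : Continuous fun s : ℝ => (k : ℝ) * (1 - s)) t).eventually
      (gt_mem_nhds h)
  have h2 : cutoff k =ᶠ[𝓝 t] fun _ => 0 := h1.mono fun s hs => cutoff_eq_zero hs.le
  rw [h2.deriv_eq, deriv_const]

theorem deriv_cutoff_eq_zero_of_gt {k : ℕ} {t : ℝ} (h : 2 < k * (1 - t)) :
    deriv (cutoff k) t = 0 := by
  have h1 : ∀ᶠ s in 𝓝 t, 2 < (k : ℝ) * (1 - s) :=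
    (Continuous.tendsto (by fun_prop : Continuous fun s : ℝ => (k : ℝ) * (1 - s)) t).eventually
      (lt_mem_nhds h)
  have h2 : cutoff k =ᶠ[𝓝 t] fun _ => 1 := h1.mono fun s hs => cutoff_eq_one hs.le
  rw [h2.deriv_eq, deriv_const]

theorem tendsto_cutoff {t : ℝ} (ht : t < 1) : Tendsto (fun k => cutoff k t) atTop (𝓝 1) := by
  refine tendsto_const_nhds.congr' ?_
  have h := (tendsto_natCast_atTop_atTop (R := ℝ)).atTop_mul_const (sub_pos.2 ht)
  filter_upwards [h.eventually_ge_atTop 2] with k hk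
  exact (cutoff_eq_one hk).symm

/-- The radial derivatives of the cutoff functions are an approximation of the Dirac mass at `1`. -/
theorem tendsto_integral_deriv_cutoff {p : ℝ → ℂ} (hp : ContinuousOn p (Icc 0 1)) :
    Tendsto (fun k : ℕ => ∫ r in Ioc (0 : ℝ) 1, (-(deriv (cutoff k) (r ^ 2) * (2 * r))) • p r)
      atTop (𝓝 (p 1)) := by
  have hd : ∀ k r, HasDerivAt (fun r => -cutoff k (r ^ 2)) (-(deriv (cutoff k) (r ^ 2) * (2 * r)))
      r := by
    intro k r
    have h1 : HasDerivAt (cutoff k) (deriv (cutoff k) (r ^ 2)) (r ^ 2) :=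
      ((contDiff_cutoff k).differentiable (by simp) _).hasDerivAt
    have h2 : HasDerivAt (fun r : ℝ => r ^ 2) (2 * r) r := by simpa using hasDerivAt_pow 2 r
    exact (HasDerivAt.comp (h₂ := cutoff k) (h := fun r : ℝ => r ^ 2) r h1 h2).neg
  have hc : ∀ k, Continuous fun r : ℝ => -(deriv (cutoff k) (r ^ 2) * (2 * r)) := by
    intro k
    have := (contDiff_cutoff k).continuous_deriv (by simp)
    fun_prop
  refine tendsto_setIntegral_peak_smul_of_integrableOn_of_tendsto (t := Ioc 0 1) (x₀ := 1)
    measurableSet_Ioc measurableSet_Ioc subset_rfl self_mem_nhdsWithin (by simp) ?_ ?_ ?_ ?_ ?_ ?_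
  · refine Eventually.of_forall fun k r hr => ?_
    have := deriv_cutoff_nonpos k (r ^ 2)
    nlinarith [hr.1]
  · intro u hu h1u
    obtain ⟨δ, hδ, hδu⟩ := Metric.isOpen_iff.1 hu 1 h1u
    rw [Metric.tendstoUniformlyOn_iff]
    intro ε hε
    have h := (tendsto_natCast_atTop_atTop (R := ℝ)).atTop_mul_const hδ
    filter_upwards [h.eventually_gt_atTop 2] with k hk r hr
    have hr1 : r ≤ 1 - δ := by
      by_contra hlt
      refine hr.2 (hδu ?_)
      rw [Metric.mem_ball, Real.dist_eq, abs_lt]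
      constructor <;> linarith [hr.1.2]
    have hk0 : (0 : ℝ) ≤ k := Nat.cast_nonneg k
    rw [deriv_cutoff_eq_zero_of_gt]
    · simpa using hε
    · have : δ ≤ 1 - r ^ 2 := by nlinarith [hr.1.1, hr.1.2]
      nlinarith
  · refine tendsto_const_nhds.congr' ?_
    filter_upwards [eventually_ge_atTop 2] with k hk
    rw [← intervalIntegral.integral_of_le zero_le_one,
      intervalIntegral.integral_eq_sub_of_hasDerivAt (fun r _ => hd k r)
        ((hc k).intervalIntegrable _ _)]
    have h2 : (2 : ℝ) ≤ k := by exact_mod_cast hk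
    rw [cutoff_eq_zero (by norm_num), cutoff_eq_one (by linarith)]
    norm_num
  · exact Eventually.of_forall fun k => (hc k).aestronglyMeasurable
  · exact (hp.integrableOn_compact isCompact_Icc).mono_set Ioc_subset_Icc_self
  · exact ((hp 1 (by simp)).tendsto).mono_left (nhdsWithin_mono _ Ioc_subset_Icc_self)

theorem continuousOn_fderivWithin_apply [NormedSpace ℝ E] {f : E → ℂ}
    (hf : ContDiffOn ℝ 1 f (closedBall 0 1)) (e : E) :
    ContinuousOn (fun x => fderivWithin ℝ f (closedBall 0 1) x e) (closedBall 0 1) :=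
  (hf.continuousOn_fderivWithin uniqueDiffOn_closedBall (by simp)).clm_apply continuousOn_const

theorem hasFDerivAt_cutoff_norm_sq [InnerProductSpace ℝ E] (k : ℕ) (x : E) :
    HasFDerivAt (fun x : E => cutoff k (‖x‖ ^ 2))
      (deriv (cutoff k) (‖x‖ ^ 2) • (2 • innerSL ℝ x)) x := by
  have h1 : HasDerivAt (cutoff k) (deriv (cutoff k) (‖x‖ ^ 2)) (‖x‖ ^ 2) :=
    ((contDiff_cutoff k).differentiable (by simp) _).hasDerivAt
  exact HasDerivAt.comp_hasFDerivAt (h₂ := cutoff k) x h1 (hasStrictFDerivAt_norm_sq x).hasFDerivAt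

variable [InnerProductSpace ℝ E] [FiniteDimensional ℝ E] [MeasurableSpace E] [BorelSpace E]

theorem integrable_of_continuousOn_closedBall {F : Type*} [NormedAddCommGroup F]
    {f g : E → F} (hf : ContinuousOn f (closedBall 0 1)) (μ : Measure E)
    [IsFiniteMeasureOnCompacts μ]
    (hfg : ∀ x ∈ ball (0 : E) 1, g x = f x) (hg : ∀ x ∉ ball (0 : E) 1, g x = 0) :
    Integrable g μ := by
  have h1 : IntegrableOn f (ball 0 1) μ :=
    (hf.integrableOn_compact (isCompact_closedBall _ _)).mono_set ball_subset_closedBall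
  have h2 : g = indicator (ball 0 1) f := by
    funext x
    by_cases hx : x ∈ ball (0 : E) 1
    · rw [indicator_of_mem hx, hfg x hx]
    · rw [indicator_of_notMem hx, hg x hx]
  rw [h2, integrable_indicator_iff measurableSet_ball]
  exact h1

/-- The divergence theorem on the unit ball with a radial cutoff. -/
theorem integral_cutoff_mul_fderivWithin {f : E → ℂ} (hf : ContDiffOn ℝ 1 f (closedBall 0 1))
    (e : E) (k : ℕ) :
    ∫ x in ball (0 : E) 1, cutoff k (‖x‖ ^ 2) • fderivWithin ℝ f (closedBall 0 1) x e =
      -∫ x in ball (0 : E) 1, (deriv (cutoff k) (‖x‖ ^ 2) * (2 * inner ℝ x e)) • f x := by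
  have hfd : ∀ x, fderiv ℝ (fun x : E => cutoff k (‖x‖ ^ 2)) x e =
      deriv (cutoff k) (‖x‖ ^ 2) * (2 * inner ℝ x e) := by
    intro x
    rw [(hasFDerivAt_cutoff_norm_sq k x).fderiv]
    simp
  have hin : ∀ x ∈ ball (0 : E) 1, fderiv ℝ f x = fderivWithin ℝ f (closedBall 0 1) x := by
    intro x hx
    rw [fderivWithin_of_mem_nhds (closedBall_mem_nhds_of_mem hx)]
  have hdiff : ∀ x ∈ ball (0 : E) 1, DifferentiableAt ℝ f x := fun x hx =>
    (hf.differentiableOn (by simp) x (ball_subset_closedBall hx)).differentiableAt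
      (closedBall_mem_nhds_of_mem hx)
  have hout : ∀ x ∉ ball (0 : E) 1, (k : ℝ) * (1 - ‖x‖ ^ 2) ≤ 0 := by
    intro x hx
    rw [mem_ball_zero_iff, not_lt] at hx
    have : (1 : ℝ) ≤ ‖x‖ ^ 2 := one_le_pow₀ hx
    exact mul_nonpos_of_nonneg_of_nonpos (Nat.cast_nonneg k) (by linarith)
  have hc0 : ∀ x ∉ ball (0 : E) 1, cutoff k (‖x‖ ^ 2) = 0 := fun x hx =>
    cutoff_eq_zero ((hout x hx).trans zero_le_one)
  have hc1 : ∀ x ∉ ball (0 : E) 1, deriv (cutoff k) (‖x‖ ^ 2) = 0 := fun x hx =>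
    deriv_cutoff_eq_zero_of_lt ((hout x hx).trans_lt one_pos)
  have hcont : Continuous fun x : E => cutoff k (‖x‖ ^ 2) :=
    (contDiff_cutoff k).continuous.comp (by fun_prop)
  have hcont' : Continuous fun x : E => deriv (cutoff k) (‖x‖ ^ 2) * (2 * inner ℝ x e) := by
    have h1 := ((contDiff_cutoff k).continuous_deriv (by simp)).comp
      (by fun_prop : Continuous fun x : E => ‖x‖ ^ 2)
    exact h1.mul (by fun_prop)
  have key := integral_smul_fderiv_eq_neg_fderiv_smul_of_integrable (μ := (volume : Measure E))
    (f := fun x : E => cutoff k (‖x‖ ^ 2)) (g := f) (v := e) ?_ ?_ ?_ ?_ ?_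
  · have e1 : ∫ x, cutoff k (‖x‖ ^ 2) • fderiv ℝ f x e =
        ∫ x in ball (0 : E) 1, cutoff k (‖x‖ ^ 2) • fderivWithin ℝ f (closedBall 0 1) x e := by
      rw [← setIntegral_eq_integral_of_forall_compl_eq_zero (s := ball (0 : E) 1)]
      · exact setIntegral_congr_fun measurableSet_ball fun x hx => by simp only [hin x hx]
      · intro x hx
        rw [hc0 x hx, zero_smul]
    rw [← e1, key, ← setIntegral_eq_integral_of_forall_compl_eq_zero (s := ball (0 : E) 1)]
    · simp only [hfd]
    · intro x hx
      rw [hfd, hc1 x hx, zero_mul, zero_smul]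
  · refine integrable_of_continuousOn_closedBall
      (f := fun x => (deriv (cutoff k) (‖x‖ ^ 2) * (2 * inner ℝ x e)) • f x)
      (hcont'.continuousOn.smul hf.continuousOn) _ (fun x _ => by rw [hfd]) fun x hx => ?_
    rw [hfd, hc1 x hx, zero_mul, zero_smul]
  · refine integrable_of_continuousOn_closedBall
      (f := fun x => cutoff k (‖x‖ ^ 2) • fderivWithin ℝ f (closedBall 0 1) x e)
      (hcont.continuousOn.smul (continuousOn_fderivWithin_apply hf e)) _
      (fun x hx => by rw [hin x hx]) fun x hx => ?_
    rw [hc0 x hx, zero_smul]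
  · refine integrable_of_continuousOn_closedBall
      (f := fun x => cutoff k (‖x‖ ^ 2) • f x)
      (hcont.continuousOn.smul hf.continuousOn) _ (fun x hx => rfl) fun x hx => ?_
    rw [hc0 x hx, zero_smul]
  · exact fun x _ => (hasFDerivAt_cutoff_norm_sq k x).differentiableAt
  · intro x hx
    refine hdiff x ?_
    have hsub : tsupport (fun x : E => cutoff k (‖x‖ ^ 2)) ⊆ {x | 1 ≤ k * (1 - ‖x‖ ^ 2)} := by
      refine closure_minimal (fun y hy => ?_) ?_
      · by_contra hlt
        exact hy (cutoff_eq_zero (not_le.1 hlt).le)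
      · exact isClosed_le continuous_const (by fun_prop)
    by_contra hnot
    have := hsub hx
    have h2 := hout x hnot
    simp only [mem_ofPred_eq] at this
    linarith

/-- The divergence theorem on the unit ball, for the surface measure `Measure.toSphere`: integrate
by parts against radial cutoff functions and let them tend to the indicator function of the ball. -/
theorem integral_ball_fderivWithin [Nontrivial E] {f : E → ℂ}
    (hf : ContDiffOn ℝ 1 f (closedBall 0 1)) (e : E) :
    ∫ x in ball (0 : E) 1, fderivWithin ℝ f (closedBall 0 1) x e =
      ∫ ζ : sphere (0 : E) 1, (inner ℝ (ζ : E) e : ℝ) • f ζ ∂(volume : Measure E).toSphere := by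
  set N := Module.finrank ℝ E - 1 with hN
  have hD := continuousOn_fderivWithin_apply hf e
  obtain ⟨CD, hCD⟩ := (isCompact_closedBall (0 : E) 1).exists_bound_of_continuousOn hD
  obtain ⟨Cf, hCf⟩ := (isCompact_closedBall (0 : E) 1).exists_bound_of_continuousOn hf.continuousOn
  set p : ℝ → ℂ := fun r => r ^ N •
    ∫ ζ : sphere (0 : E) 1, (inner ℝ (ζ : E) e : ℝ) • f (r • (ζ : E)) ∂(volume : Measure E).toSphere
    with hp
  have hmem : ∀ r ∈ Icc (0 : ℝ) 1, ∀ ζ : sphere (0 : E) 1, r • (ζ : E) ∈ closedBall (0 : E) 1 := by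
    intro r hr ζ
    rw [mem_closedBall_zero_iff, norm_smul, norm_eq_of_mem_sphere, mul_one, Real.norm_eq_abs,
      abs_of_nonneg hr.1]
    exact hr.2
  have hpc : ContinuousOn p (Icc 0 1) := by
    refine ContinuousOn.smul (f := fun r : ℝ => r ^ N) (by fun_prop) (continuousOn_of_dominated
      (bound := fun _ => ‖e‖ * Cf) ?_ ?_ (integrable_const _) ?_)
    · intro r hr
      refine Continuous.aestronglyMeasurable ?_
      exact (by fun_prop : Continuous fun ζ : sphere (0 : E) 1 => (inner ℝ (ζ : E) e : ℝ)).smul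
        (hf.continuousOn.comp_continuous (by fun_prop) (hmem r hr))
    · intro r hr
      refine Eventually.of_forall fun ζ => ?_
      rw [norm_smul]
      have h1 : ‖(inner ℝ (ζ : E) e : ℝ)‖ ≤ ‖e‖ := by
        simpa using norm_inner_le_norm (𝕜 := ℝ) (ζ : E) e
      exact mul_le_mul h1 (hCf _ (hmem r hr ζ)) (norm_nonneg _) (norm_nonneg _)
    · refine Eventually.of_forall fun ζ => ?_
      exact ContinuousOn.smul (f := fun _ : ℝ => (inner ℝ (ζ : E) e : ℝ)) continuousOn_const
        (hf.continuousOn.comp (by fun_prop) fun r hr => hmem r hr ζ)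
  have hR : ∀ k : ℕ, -∫ x in ball (0 : E) 1, (deriv (cutoff k) (‖x‖ ^ 2) * (2 * inner ℝ x e)) • f x
      = ∫ r in Ioc (0 : ℝ) 1, (-(deriv (cutoff k) (r ^ 2) * (2 * r))) • p r := by
    intro k
    set G : E → ℂ := indicator (ball (0 : E) 1)
      fun x => (deriv (cutoff k) (‖x‖ ^ 2) * (2 * inner ℝ x e)) • f x with hG
    have hcont' : Continuous fun x : E => deriv (cutoff k) (‖x‖ ^ 2) * (2 * inner ℝ x e) := by
      have h1 := ((contDiff_cutoff k).continuous_deriv (by simp)).comp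
        (by fun_prop : Continuous fun x : E => ‖x‖ ^ 2)
      exact h1.mul (by fun_prop)
    have hGint : Integrable G := integrable_of_continuousOn_closedBall
      (hcont'.continuousOn.smul hf.continuousOn) _ (fun x hx => indicator_of_mem hx _)
      fun x hx => indicator_of_notMem hx _
    rw [← integral_indicator measurableSet_ball, integral_eq_integral_polar _ hGint,
      ← integral_neg, setIntegral_eq_of_subset_of_forall_sdiff_eq_zero measurableSet_Ioi
        (fun r hr => hr.1 : Ioc (0 : ℝ) 1 ⊆ Ioi 0)]
    · refine setIntegral_congr_fun measurableSet_Ioc fun r hr => ?_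
      have hGr : ∀ ζ : sphere (0 : E) 1, G (r • (ζ : E)) =
          (deriv (cutoff k) (r ^ 2) * (2 * r)) • ((inner ℝ (ζ : E) e : ℝ) • f (r • (ζ : E))) := by
        intro ζ
        have hn : ‖r • (ζ : E)‖ = r := by
          rw [norm_smul, norm_eq_of_mem_sphere, mul_one, Real.norm_eq_abs, abs_of_pos hr.1]
        rcases hr.2.lt_or_eq with h1 | h1
        · rw [hG, indicator_of_mem (by rwa [mem_ball_zero_iff, hn]), hn, real_inner_smul_left,
            smul_smul]
          congr 1
          ring
        · rw [hG, indicator_of_notMem (by rw [mem_ball_zero_iff, hn, h1]; exact lt_irrefl _), h1,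
            deriv_cutoff_eq_zero_of_lt (by norm_num), zero_mul, zero_smul]
      simp_rw [hGr]
      rw [integral_smul, smul_comm, ← neg_smul]
    · intro r hr
      have hr1 : 1 < r := by
        by_contra h
        exact hr.2 ⟨hr.1, not_lt.1 h⟩
      have hGr : ∀ ζ : sphere (0 : E) 1, G (r • (ζ : E)) = 0 := by
        intro ζ
        refine indicator_of_notMem ?_ _
        rw [mem_ball_zero_iff, norm_smul, norm_eq_of_mem_sphere, mul_one, Real.norm_eq_abs, not_lt]
        exact hr1.le.trans (le_abs_self r)
      simp [hGr]
  have hL : Tendsto (fun k : ℕ => ∫ x in ball (0 : E) 1,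
      cutoff k (‖x‖ ^ 2) • fderivWithin ℝ f (closedBall 0 1) x e) atTop
      (𝓝 (∫ x in ball (0 : E) 1, fderivWithin ℝ f (closedBall 0 1) x e)) := by
    refine tendsto_integral_of_dominated_convergence (fun _ => CD) ?_
      (integrableOn_const measure_ball_lt_top.ne) ?_ ?_
    · intro k
      have hcont : Continuous fun x : E => cutoff k (‖x‖ ^ 2) :=
        (contDiff_cutoff k).continuous.comp (by fun_prop)
      exact ((hcont.continuousOn.smul hD).mono ball_subset_closedBall).aestronglyMeasurable
        measurableSet_ball
    · intro k
      refine (ae_restrict_mem measurableSet_ball).mono fun x hx => ?_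
      rw [cutoff, norm_smul, Real.norm_eq_abs, abs_of_nonneg (Real.smoothTransition.nonneg _)]
      exact (mul_le_of_le_one_left (norm_nonneg _) (Real.smoothTransition.le_one _)).trans
        (hCD x (ball_subset_closedBall hx))
    · refine (ae_restrict_mem measurableSet_ball).mono fun x hx => ?_
      have hx1 : ‖x‖ ^ 2 < 1 := by
        rw [mem_ball_zero_iff] at hx
        nlinarith [norm_nonneg x]
      simpa using (tendsto_cutoff hx1).smul_const (fderivWithin ℝ f (closedBall 0 1) x e)
  have hlim := tendsto_integral_deriv_cutoff hpc
  simp_rw [← hR, ← integral_cutoff_mul_fderivWithin hf e] at hlim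
  rw [tendsto_nhds_unique hL hlim, hp]
  simp

end Divergence

/-! ### The antiholomorphic Euler field -/

section AntiholomorphicEuler

open Filter Topology Set

variable {n : ℕ}

/-- The divergence theorem on the unit ball of `ℂⁿ` for the vector field `∂/∂w̄ⱼ`. -/
theorem integral_ball_dbarDeriv (hn : 0 < n) (j : Fin n) {f : Cn n → ℂ}
    (hf : ContDiffOn ℝ 1 f (closedBall 0 1)) :
    ∫ w in ball (0 : Cn n) 1, dbarDeriv j f w =
      (1 / 2) * ∫ ζ : sphere (0 : Cn n) 1, (ζ : Cn n) j * f ζ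
        ∂(volume : Measure (Cn n)).toSphere := by
  have : Nonempty (Fin n) := ⟨⟨0, hn⟩⟩
  have : Nontrivial (Cn n) := inferInstance
  have hint : ∀ e : Cn n, IntegrableOn (fun w => fderivWithin ℝ f (closedBall 0 1) w e)
      (ball (0 : Cn n) 1) := fun e =>
    ((continuousOn_fderivWithin_apply hf e).integrableOn_compact
      (isCompact_closedBall _ _)).mono_set ball_subset_closedBall
  have hS : ∀ e : Cn n, Integrable (fun ζ : sphere (0 : Cn n) 1 =>
      (inner ℝ (ζ : Cn n) e : ℝ) • f ζ) (volume : Measure (Cn n)).toSphere := by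
    intro e
    have hc : Continuous fun ζ : sphere (0 : Cn n) 1 => (inner ℝ (ζ : Cn n) e : ℝ) • f ζ :=
      Continuous.smul (f := fun ζ : sphere (0 : Cn n) 1 => (inner ℝ (ζ : Cn n) e : ℝ)) (by fun_prop)
        (hf.continuousOn.comp_continuous (by fun_prop) fun ζ => sphere_subset_closedBall ζ.2)
    rw [← integrableOn_univ]
    exact hc.continuousOn.integrableOn_compact isCompact_univ
  simp only [dbarDeriv]
  rw [integral_const_mul, integral_add (hint _) ((hint _).const_mul _), integral_const_mul,
    integral_ball_fderivWithin hf, integral_ball_fderivWithin hf, ← integral_const_mul,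
    ← integral_add (hS _) ((hS _).const_mul _)]
  congr 1
  refine integral_congr_ae (Eventually.of_forall fun ζ => ?_)
  have h1 : (inner ℝ (ζ : Cn n) (EuclideanSpace.single j 1) : ℝ) = ((ζ : Cn n) j).re := by
    simp [PiLp.inner_apply, Complex.inner, apply_ite]
  have h2 : (inner ℝ (ζ : Cn n) (EuclideanSpace.single j Complex.I) : ℝ) = ((ζ : Cn n) j).im := by
    simp [PiLp.inner_apply, Complex.inner, apply_ite]
  simp only [h1, h2, Complex.real_smul]
  conv_rhs => rw [← Complex.re_add_im ((ζ : Cn n) j)]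
  ring

/-- The derivation `∑ⱼ (w̄ⱼ - z̄ⱼ) ∂/∂w̄ⱼ` on functions on the closed ball: the antiholomorphic
Euler field centred at `z`. -/
def eulerDeriv (z : Cn n) (f : Cn n → ℂ) (w : Cn n) : ℂ :=
  ∑ j, (conj (w j) - conj (z j)) * dbarDeriv j f w

theorem dbarDeriv_mul (j : Fin n) {f g : Cn n → ℂ} {w : Cn n} (hw : w ∈ closedBall (0 : Cn n) 1)
    (hf : DifferentiableWithinAt ℝ f (closedBall 0 1) w)
    (hg : DifferentiableWithinAt ℝ g (closedBall 0 1) w) :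
    dbarDeriv j (fun w => f w * g w) w = f w * dbarDeriv j g w + g w * dbarDeriv j f w := by
  simp only [dbarDeriv, fderivWithin_fun_mul (uniqueDiffOn_closedBall w hw) hf hg]
  simp
  ring

theorem dbarDeriv_add (j : Fin n) {f g : Cn n → ℂ} {w : Cn n} (hw : w ∈ closedBall (0 : Cn n) 1)
    (hf : DifferentiableWithinAt ℝ f (closedBall 0 1) w)
    (hg : DifferentiableWithinAt ℝ g (closedBall 0 1) w) :
    dbarDeriv j (fun w => f w + g w) w = dbarDeriv j f w + dbarDeriv j g w := by
  simp only [dbarDeriv, fderivWithin_fun_add (uniqueDiffOn_closedBall w hw) hf hg]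
  simp
  ring

theorem dbarDeriv_const (j : Fin n) (c : ℂ) (w : Cn n) :
    dbarDeriv j (fun _ => c) w = 0 := by
  simp [dbarDeriv]

theorem dbarDeriv_of_clm (j : Fin n) (L : Cn n →L[ℝ] ℂ) {w : Cn n}
    (hw : w ∈ closedBall (0 : Cn n) 1) :
    dbarDeriv j (fun w => L w) w = (1 / 2) * (L (EuclideanSpace.single j 1)
      + Complex.I * L (EuclideanSpace.single j Complex.I)) := by
  simp only [dbarDeriv]
  rw [(L.hasFDerivWithinAt).fderivWithin (uniqueDiffOn_closedBall w hw)]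

/-- `f` is differentiable at `w`, relative to the closed ball, and `eulerDeriv z f w = f'`. -/
def HasEulerDeriv (z : Cn n) (f : Cn n → ℂ) (f' : ℂ) (w : Cn n) : Prop :=
  DifferentiableWithinAt ℝ f (closedBall 0 1) w ∧ eulerDeriv z f w = f'

namespace HasEulerDeriv

variable {z w : Cn n} {f g : Cn n → ℂ} {f' g' : ℂ}

theorem congr_deriv (hf : HasEulerDeriv z f f' w) (h : f' = g') : HasEulerDeriv z f g' w := h ▸ hf

theorem mul (hw : w ∈ closedBall (0 : Cn n) 1) (hf : HasEulerDeriv z f f' w)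
    (hg : HasEulerDeriv z g g' w) :
    HasEulerDeriv z (fun w => f w * g w) (f w * g' + g w * f') w := by
  refine ⟨hf.1.mul hg.1, ?_⟩
  rw [← hf.2, ← hg.2, eulerDeriv, eulerDeriv, eulerDeriv, Finset.mul_sum, Finset.mul_sum,
    ← Finset.sum_add_distrib]
  refine Finset.sum_congr rfl fun j _ => ?_
  rw [dbarDeriv_mul j hw hf.1 hg.1]
  ring

theorem add (hw : w ∈ closedBall (0 : Cn n) 1) (hf : HasEulerDeriv z f f' w)
    (hg : HasEulerDeriv z g g' w) : HasEulerDeriv z (fun w => f w + g w) (f' + g') w := by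
  refine ⟨hf.1.add hg.1, ?_⟩
  rw [← hf.2, ← hg.2, eulerDeriv, eulerDeriv, eulerDeriv, ← Finset.sum_add_distrib]
  refine Finset.sum_congr rfl fun j _ => ?_
  rw [dbarDeriv_add j hw hf.1 hg.1]
  ring

theorem const (c : ℂ) : HasEulerDeriv z (fun _ => c) 0 w :=
  ⟨differentiableWithinAt_const _, by simp [eulerDeriv, dbarDeriv_const]⟩

theorem const_mul (hw : w ∈ closedBall (0 : Cn n) 1) (hf : HasEulerDeriv z f f' w) (c : ℂ) :
    HasEulerDeriv z (fun w => c * f w) (c * f') w :=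
  ((const c).mul hw hf).congr_deriv (by ring)

theorem sub (hw : w ∈ closedBall (0 : Cn n) 1) (hf : HasEulerDeriv z f f' w)
    (hg : HasEulerDeriv z g g' w) : HasEulerDeriv z (fun w => f w - g w) (f' - g') w := by
  have := hf.add hw (hg.const_mul hw (-1))
  simpa [sub_eq_add_neg] using this

theorem sum {κ : Type*} (hw : w ∈ closedBall (0 : Cn n) 1) (S : Finset κ) {F : κ → Cn n → ℂ}
    {F' : κ → ℂ} (hF : ∀ i ∈ S, HasEulerDeriv z (F i) (F' i) w) :
    HasEulerDeriv z (fun w => ∑ i ∈ S, F i w) (∑ i ∈ S, F' i) w := by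
  classical
  induction S using Finset.induction_on with
  | empty => simpa using const 0
  | insert a S ha ih =>
    simp only [Finset.sum_insert ha]
    exact (hF a (by simp)).add hw (ih fun i hi => hF i (by simp [hi]))

theorem pow (hw : w ∈ closedBall (0 : Cn n) 1) (hf : HasEulerDeriv z f f' w) (k : ℕ) :
    HasEulerDeriv z (fun w => f w ^ k) (k * f w ^ (k - 1) * f') w := by
  induction k with
  | zero => simpa using const 1
  | succ k ih =>
    have h := ih.mul hw hf
    simp only [← pow_succ] at h
    refine h.congr_deriv ?_
    rcases k with _ | k
    · simp
    · simp only [Nat.add_sub_cancel]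
      push_cast
      ring

theorem inv (hw : w ∈ closedBall (0 : Cn n) 1) (hf : HasEulerDeriv z f f' w) (h0 : f w ≠ 0) :
    HasEulerDeriv z (fun w => (f w)⁻¹) (-f' / f w ^ 2) w := by
  have hd : DifferentiableWithinAt ℝ (fun w => (f w)⁻¹) (closedBall 0 1) w := hf.1.inv h0
  refine ⟨hd, ?_⟩
  rw [← hf.2, eulerDeriv, eulerDeriv, ← Finset.sum_neg_distrib, Finset.sum_div]
  refine Finset.sum_congr rfl fun j _ => ?_
  have h2 : HasFDerivWithinAt (fun w => (f w)⁻¹) _ (closedBall 0 1) w :=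
    ((hasDerivAt_inv h0).hasFDerivAt.restrictScalars ℝ).comp_hasFDerivWithinAt w
      hf.1.hasFDerivWithinAt
  simp only [dbarDeriv, h2.fderivWithin (uniqueDiffOn_closedBall w hw)]
  simp
  field_simp
  ring

theorem coord (hw : w ∈ closedBall (0 : Cn n) 1) (k : Fin n) :
    HasEulerDeriv z (fun w => w k) 0 w := by
  refine ⟨(coordL k).differentiableWithinAt, ?_⟩
  refine Finset.sum_eq_zero fun j _ => ?_
  rw [show (fun w : Cn n => w k) = fun w => coordL k w from rfl, dbarDeriv_of_clm j _ hw]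
  by_cases h : k = j <;> simp [coordL_apply, h]

theorem conj_coord_sub (hw : w ∈ closedBall (0 : Cn n) 1) (k : Fin n) (c : ℂ) :
    HasEulerDeriv z (fun w => conj (w k) - c) (conj (w k) - conj (z k)) w := by
  have h : HasEulerDeriv z (fun w => conj (w k)) (conj (w k) - conj (z k)) w := by
    refine ⟨(conjCoordL k).differentiableWithinAt, ?_⟩
    rw [eulerDeriv, Finset.sum_eq_single k]
    · rw [show (fun w : Cn n => conj (w k)) = fun w => conjCoordL k w from rfl,
        dbarDeriv_of_clm k _ hw]
      simp [conjCoordL_apply]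
      ring
    · intro j _ hj
      rw [show (fun w : Cn n => conj (w k)) = fun w => conjCoordL k w from rfl,
        dbarDeriv_of_clm j _ hw]
      simp [conjCoordL_apply, hj.symm]
    · simp
  simpa using h.sub hw (const c)

theorem conj_coord (hw : w ∈ closedBall (0 : Cn n) 1) (k : Fin n) :
    HasEulerDeriv z (fun w => conj (w k)) (conj (w k) - conj (z k)) w := by
  simpa using conj_coord_sub hw k 0

theorem one_sub_dotBar (hw : w ∈ closedBall (0 : Cn n) 1) :
    HasEulerDeriv z (fun w => 1 - dotBar w z) 0 w := by
  have h := (const (z := z) 1).sub hw (sum hw Finset.univ fun j _ =>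
    (coord (z := z) hw j).mul hw (const (conj (z j))))
  simpa [dotBar] using h

theorem one_sub_dotBar' (hw : w ∈ closedBall (0 : Cn n) 1) :
    HasEulerDeriv z (fun w => 1 - dotBar z w) (dotBar z z - dotBar z w) w := by
  have h := (const (z := z) 1).sub hw (sum hw Finset.univ fun j _ =>
    (conj_coord (z := z) hw j).const_mul hw (z j))
  refine h.congr_deriv ?_
  simp [dotBar, mul_sub]

theorem one_sub_normSq (hw : w ∈ closedBall (0 : Cn n) 1) :
    HasEulerDeriv z oneSubSq (oneSubSq w - (1 - dotBar w z)) w := by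
  have h := (const (z := z) 1).sub hw (sum hw Finset.univ fun j _ =>
    (coord (z := z) hw j).mul hw (conj_coord (z := z) hw j))
  have he : (oneSubSq : Cn n → ℂ) = fun w => 1 - ∑ j, w j * conj (w j) :=
    funext fun w => oneSubSq_eq w
  rw [he]
  refine h.congr_deriv ?_
  simp [dotBar, mul_sub]

end HasEulerDeriv

theorem triangle_eq (w z : Cn n) : ((triangle w z : ℝ) : ℂ) =
    (1 - dotBar w z) * (1 - dotBar z w) - oneSubSq w * oneSubSq z := by
  rw [triangle, oneSubSq, oneSubSq]
  push_cast
  rw [← Complex.mul_conj', map_sub, map_one, conj_dotBar]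

/-- The Euler field centred at `z` reproduces `△(·,z)`. -/
theorem HasEulerDeriv.triangle {z w : Cn n} (hw : w ∈ closedBall (0 : Cn n) 1) :
    HasEulerDeriv z (fun w => ((triangle w z : ℝ) : ℂ)) ((BallForms.triangle w z : ℝ) : ℂ) w := by
  have h := ((one_sub_dotBar (z := z) hw).mul hw (one_sub_dotBar' (z := z) hw)).sub hw
    ((HasEulerDeriv.one_sub_normSq (z := z) hw).mul hw (const (BallForms.oneSubSq z)))
  simp only [← triangle_eq] at h
  refine h.congr_deriv ?_
  rw [triangle_eq, oneSubSq_eq z]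
  ring

theorem contDiff_conj_coord (j : Fin n) : ContDiff ℝ ∞ fun w : Cn n => conj (w j) :=
  (conjCoordL j).contDiff

theorem contDiff_coord (j : Fin n) : ContDiff ℝ ∞ fun w : Cn n => w j := (coordL j).contDiff

theorem dbarDeriv_conj_coord_sub (j : Fin n) (c : ℂ) {w : Cn n}
    (hw : w ∈ closedBall (0 : Cn n) 1) : dbarDeriv j (fun w => conj (w j) - c) w = 1 := by
  simp only [sub_eq_add_neg]
  rw [dbarDeriv_add j hw (f := fun w : Cn n => conj (w j))
    ((conjCoordL j).differentiableWithinAt) (differentiableWithinAt_const _),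
    dbarDeriv_const, show (fun w : Cn n => conj (w j)) = fun w => conjCoordL j w from rfl,
    dbarDeriv_of_clm j _ hw]
  simp [conjCoordL_apply]
  norm_num

theorem continuousOn_dbarDeriv (j : Fin n) {f : Cn n → ℂ} (hf : ContDiffOn ℝ 1 f (closedBall 0 1)) :
    ContinuousOn (dbarDeriv j f) (closedBall 0 1) := by
  have h1 := continuousOn_fderivWithin_apply hf (EuclideanSpace.single j 1)
  have h2 := continuousOn_fderivWithin_apply hf (EuclideanSpace.single j Complex.I)
  exact continuousOn_const.mul (h1.add (continuousOn_const.mul h2))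

theorem integrable_sphere {f : Cn n → ℂ} (hf : ContinuousOn f (sphere 0 1)) :
    Integrable (fun ζ : sphere (0 : Cn n) 1 => f ζ) (volume : Measure (Cn n)).toSphere := by
  have hc : Continuous fun ζ : sphere (0 : Cn n) 1 => f ζ :=
    hf.comp_continuous (by fun_prop) fun ζ => ζ.2
  rw [← integrableOn_univ]
  exact hc.continuousOn.integrableOn_compact isCompact_univ

theorem continuous_dotBar_left (z : Cn n) : Continuous fun w : Cn n => dotBar w z := by
  simp only [dotBar_eq_inner]
  fun_prop

/-- The divergence theorem for the antiholomorphic Euler field centred at `z`. -/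
theorem integral_ball_eulerDeriv_add (hn : 0 < n) (z : Cn n) {g : Cn n → ℂ}
    (hg : ContDiffOn ℝ 1 g (closedBall 0 1)) :
    ∫ w in ball (0 : Cn n) 1, (eulerDeriv z g w + n * g w) =
      (1 / 2) * ∫ ζ : sphere (0 : Cn n) 1, (1 - dotBar (ζ : Cn n) z) * g ζ
        ∂(volume : Measure (Cn n)).toSphere := by
  have hX : ∀ j, ContDiffOn ℝ 1 (fun w : Cn n => (conj (w j) - conj (z j)) * g w)
      (closedBall 0 1) := fun j =>
    ((((contDiff_conj_coord j).of_le (by simp)).sub contDiff_const).contDiffOn).mul hg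
  have h1 : ∀ w ∈ ball (0 : Cn n) 1, eulerDeriv z g w + n * g w =
      ∑ j, dbarDeriv j (fun w : Cn n => (conj (w j) - conj (z j)) * g w) w := by
    intro w hw
    have hw := ball_subset_closedBall hw
    have : ∀ j, dbarDeriv j (fun w : Cn n => (conj (w j) - conj (z j)) * g w) w =
        (conj (w j) - conj (z j)) * dbarDeriv j g w + g w := by
      intro j
      rw [dbarDeriv_mul j hw (((contDiff_conj_coord j).sub
        contDiff_const).contDiffOn.differentiableOn (by simp) w hw)
        (hg.differentiableOn (by simp) w hw), dbarDeriv_conj_coord_sub j _ hw, mul_one]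
    simp_rw [this, Finset.sum_add_distrib]
    simp [eulerDeriv]
  rw [setIntegral_congr_fun measurableSet_ball h1, integral_finsetSum]
  · simp_rw [fun j => integral_ball_dbarDeriv hn j (hX j), ← Finset.mul_sum]
    rw [← integral_finsetSum]
    · congr 1
      refine integral_congr_ae (Eventually.of_forall fun ζ => ?_)
      have h2 : dotBar (ζ : Cn n) ζ = 1 := by
        rw [dotBar_self, norm_eq_of_mem_sphere]
        simp
      simp only
      rw [← h2, dotBar, dotBar, ← Finset.sum_sub_distrib, Finset.sum_mul]
      exact Finset.sum_congr rfl fun j _ => by ring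
    · intro j _
      exact integrable_sphere ((contDiff_coord j).continuous.continuousOn.mul
        ((hX j).continuousOn.mono sphere_subset_closedBall))
  · intro j _
    exact ((continuousOn_dbarDeriv j (hX j)).integrableOn_compact
      (isCompact_closedBall _ _)).mono_set ball_subset_closedBall

end AntiholomorphicEuler

/-! ### Integration by parts against the kernels `Φₙ^ℓ` -/

section Kernel

open Filter Topology Set

variable {n : ℕ}

theorem norm_dotBar_le (w z : Cn n) : ‖dotBar w z‖ ≤ ‖w‖ * ‖z‖ := by
  rw [dotBar_eq_inner, mul_comm]
  exact norm_inner_le_norm z w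

theorem one_sub_dotBar_ne_zero {w z : Cn n} (hw : ‖w‖ ≤ 1) (hz : ‖z‖ < 1) :
    1 - dotBar w z ≠ 0 := by
  intro h
  have h1 : ‖dotBar w z‖ < 1 := (norm_dotBar_le w z).trans_lt (by nlinarith [norm_nonneg z])
  rw [← sub_eq_zero.1 h, norm_one] at h1
  exact lt_irrefl _ h1

/-- `△(w,z)` is comparable with `|w - z|²` when `z` stays away from the sphere. -/
theorem mul_norm_sub_sq_le_triangle (w z : Cn n) :
    (1 - ‖z‖ ^ 2) * ‖w - z‖ ^ 2 ≤ triangle w z := by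
  have h1 : ((triangle w z : ℝ) : ℂ) =
      dotBar (w - z) (w - z) - dotBar (w - z) (w - z) * dotBar z z +
        dotBar (w - z) z * conj (dotBar (w - z) z) := by
    rw [triangle_eq, oneSubSq_eq, oneSubSq_eq]
    simp only [dotBar_eq_inner, inner_sub_left, inner_sub_right, map_sub, inner_conj_symm]
    ring
  rw [dotBar_self, dotBar_self, Complex.mul_conj'] at h1
  have h2 : triangle w z = ‖w - z‖ ^ 2 - ‖w - z‖ ^ 2 * ‖z‖ ^ 2 + ‖dotBar (w - z) z‖ ^ 2 := by
    exact_mod_cast h1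
  rw [h2]
  nlinarith [sq_nonneg ‖dotBar (w - z) z‖]

theorem triangle_nonneg {z : Cn n} (hz : ‖z‖ < 1) (w : Cn n) : 0 ≤ triangle w z := by
  refine le_trans ?_ (mul_norm_sub_sq_le_triangle w z)
  have : 0 ≤ 1 - ‖z‖ ^ 2 := by nlinarith [norm_nonneg z]
  positivity

theorem triangle_pos {w z : Cn n} (hz : ‖z‖ < 1) (hwz : w ≠ z) : 0 < triangle w z := by
  refine lt_of_lt_of_le ?_ (mul_norm_sub_sq_le_triangle w z)
  have h1 : 0 < 1 - ‖z‖ ^ 2 := by nlinarith [norm_nonneg z]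
  have h2 : 0 < ‖w - z‖ := norm_pos_iff.2 (sub_ne_zero.2 hwz)
  positivity

theorem continuous_triangle (z : Cn n) : Continuous fun w : Cn n => triangle w z := by
  unfold triangle
  have := continuous_dotBar_left z
  fun_prop

theorem continuous_oneSubSq : Continuous (oneSubSq : Cn n → ℂ) := by
  unfold oneSubSq
  fun_prop

/-- The function `|w - z|^(1 - 2n)` is locally integrable in `ℂⁿ`. -/
theorem integrableOn_norm_sub_mul_inv (hn : 0 < n) {z : Cn n} (hz : ‖z‖ < 1) :
    IntegrableOn (fun w : Cn n => ‖w - z‖ * (‖w - z‖ ^ (2 * n))⁻¹) (ball 0 1) := by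
  have : Nonempty (Fin n) := ⟨⟨0, hn⟩⟩
  have : Nontrivial (Cn n) := inferInstance
  have hdim : Module.finrank ℝ (Cn n) - 1 + 1 = 2 * n := by
    rw [show Module.finrank ℝ (Cn n) = 2 * n by simp [finrank_real_of_complex]]
    omega
  have h1 : IntegrableOn (fun w : Cn n => ‖w‖ * (‖w‖ ^ (2 * n))⁻¹) (ball 0 2) := by
    rw [integrableOn_fun_norm_addHaar volume (f := fun y => y * (y ^ (2 * n))⁻¹)]
    have h2 : IntegrableOn (fun _ : ℝ => (1 : ℝ)) (Ioo 0 2) :=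
      integrableOn_const (by simp)
    refine h2.congr_fun (fun y hy => ?_) measurableSet_Ioo
    have : y ≠ 0 := hy.1.ne'
    simp only [smul_eq_mul]
    rw [← mul_assoc, ← pow_succ, hdim]
    field_simp
  rw [← integrable_indicator_iff measurableSet_ball] at h1
  have h2 := h1.comp_sub_right z
  have h3 : IntegrableOn (fun w : Cn n => ‖w - z‖ * (‖w - z‖ ^ (2 * n))⁻¹) (ball z 2) := by
    rw [← integrable_indicator_iff measurableSet_ball]
    refine h2.congr (Eventually.of_forall fun w => ?_)
    simp only [indicator, mem_ball, dist_eq_norm, sub_zero]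
  refine h3.mono_set fun w hw => ?_
  rw [mem_ball_zero_iff] at hw
  rw [mem_ball, dist_eq_norm]
  exact (norm_sub_le w z).trans_lt (by linarith)

/-- The bound for the quotient by `△ⁿ` of a quantity vanishing on the diagonal. -/
theorem norm_div_triangle_pow_le {z : Cn n} (hz : ‖z‖ < 1) {a : ℂ} {C : ℝ} {w : Cn n}
    (ha : ‖a‖ ≤ C * ‖w - z‖) (hC : 0 ≤ C) :
    ‖a / ((triangle w z : ℝ) : ℂ) ^ n‖ ≤
      C / (1 - ‖z‖ ^ 2) ^ n * (‖w - z‖ * (‖w - z‖ ^ (2 * n))⁻¹) := by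
  have h1 : 0 < 1 - ‖z‖ ^ 2 := by nlinarith [norm_nonneg z]
  rcases eq_or_ne w z with rfl | hwz
  · have ha0 : a = 0 := by simpa using ha
    simp [ha0]
  have h2 : 0 < ‖w - z‖ := norm_pos_iff.2 (sub_ne_zero.2 hwz)
  have hT := mul_norm_sub_sq_le_triangle w z
  rw [norm_div, norm_pow, Complex.norm_real, Real.norm_of_nonneg (triangle_nonneg hz w)]
  calc ‖a‖ / triangle w z ^ n ≤ C * ‖w - z‖ / ((1 - ‖z‖ ^ 2) * ‖w - z‖ ^ 2) ^ n := by
        gcongr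
    _ = _ := by
        rw [mul_pow, ← pow_mul]
        field_simp

theorem integrableOn_div_triangle_pow (hn : 0 < n) {z : Cn n} (hz : ‖z‖ < 1) {G : Cn n → ℂ}
    (hG : ContinuousOn G (closedBall 0 1)) {C : ℝ} (hC : 0 ≤ C)
    (hb : ∀ w ∈ closedBall (0 : Cn n) 1, ‖G w‖ ≤ C * ‖w - z‖) :
    IntegrableOn (fun w => G w / ((triangle w z : ℝ) : ℂ) ^ n) (ball 0 1) := by
  refine Integrable.mono'
    ((integrableOn_norm_sub_mul_inv hn hz).const_mul (C / (1 - ‖z‖ ^ 2) ^ n)) ?_ ?_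
  · have h1 : AEStronglyMeasurable G (volume.restrict (ball 0 1)) :=
      (hG.mono ball_subset_closedBall).aestronglyMeasurable measurableSet_ball
    have h2 : Measurable fun w : Cn n => (((triangle w z : ℝ) : ℂ) ^ n)⁻¹ := by
      have := continuous_triangle z
      have h3 : Continuous fun w : Cn n => ((triangle w z : ℝ) : ℂ) ^ n := by fun_prop
      exact h3.measurable.inv
    simp only [div_eq_mul_inv]
    exact h1.mul h2.aestronglyMeasurable
  · exact (ae_restrict_mem measurableSet_ball).mono fun w hw =>
      norm_div_triangle_pow_le hz (hb w (ball_subset_closedBall hw)) hC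

theorem norm_conj_coord_sub_le (w z : Cn n) (j : Fin n) : ‖conj (w j) - conj (z j)‖ ≤ ‖w - z‖ := by
  rw [← map_sub, Complex.norm_conj]
  exact PiLp.norm_apply_le (w - z) j

theorem continuousOn_eulerDeriv (z : Cn n) {f : Cn n → ℂ}
    (hf : ContDiffOn ℝ 1 f (closedBall 0 1)) : ContinuousOn (eulerDeriv z f) (closedBall 0 1) :=
  continuousOn_finsetSum _ fun j _ =>
    ((contDiff_conj_coord j).continuous.sub continuous_const).continuousOn.mul
      (continuousOn_dbarDeriv j hf)

theorem exists_norm_sum_conj_coord_sub_le (z : Cn n) (f : Fin n → Cn n → ℂ)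
    (hf : ∀ j, ContinuousOn (f j) (closedBall 0 1)) :
    ∃ C : ℝ, 0 ≤ C ∧ ∀ w ∈ closedBall (0 : Cn n) 1,
      ‖∑ j, (conj (w j) - conj (z j)) * f j w‖ ≤ C * ‖w - z‖ := by
  choose C hC using fun j => (isCompact_closedBall (0 : Cn n) 1).exists_bound_of_continuousOn (hf j)
  refine ⟨∑ j, |C j|, Finset.sum_nonneg fun j _ => abs_nonneg _, fun w hw => ?_⟩
  rw [Finset.sum_mul]
  refine (norm_sum_le _ _).trans (Finset.sum_le_sum fun j _ => ?_)
  rw [norm_mul, mul_comm]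
  exact mul_le_mul ((hC j w hw).trans (le_abs_self _)) (norm_conj_coord_sub_le w z j)
    (norm_nonneg _) (abs_nonneg _)

theorem contDiff_dotBar_left (z : Cn n) : ContDiff ℝ ∞ fun w : Cn n => dotBar w z := by
  simp only [dotBar]
  exact ContDiff.sum fun j _ => (contDiff_coord j).mul contDiff_const

theorem contDiff_dotBar_right (z : Cn n) : ContDiff ℝ ∞ fun w : Cn n => dotBar z w := by
  simp only [dotBar]
  exact ContDiff.sum fun j _ => contDiff_const.mul (contDiff_conj_coord j)

theorem contDiff_oneSubSq : ContDiff ℝ ∞ (oneSubSq : Cn n → ℂ) := by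
  have he : (oneSubSq : Cn n → ℂ) = fun w => 1 - ∑ j, w j * conj (w j) :=
    funext fun w => oneSubSq_eq w
  rw [he]
  exact contDiff_const.sub (ContDiff.sum fun j _ => (contDiff_coord j).mul (contDiff_conj_coord j))

theorem contDiff_triangle (z : Cn n) : ContDiff ℝ ∞ fun w : Cn n => ((triangle w z : ℝ) : ℂ) := by
  simp only [triangle_eq]
  exact ((contDiff_const.sub (contDiff_dotBar_left z)).mul
    (contDiff_const.sub (contDiff_dotBar_right z))).sub (contDiff_oneSubSq.mul contDiff_const)

theorem norm_div_add_pow_le {T ε : ℝ} (hT : 0 < T) (hε : 0 ≤ ε) (a : ℂ) :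
    ‖a / ((T : ℂ) + (ε : ℂ)) ^ n‖ ≤ ‖a / (T : ℂ) ^ n‖ := by
  rw [norm_div, norm_div, norm_pow, norm_pow, ← Complex.ofReal_add, Complex.norm_real,
    Complex.norm_real, Real.norm_of_nonneg hT.le, Real.norm_of_nonneg (by linarith)]
  gcongr
  linarith

theorem tendsto_div_add_pow {T : ℝ} (hT : 0 < T) (a : ℂ) (N : ℕ) :
    Tendsto (fun k : ℕ => a / ((T : ℂ) + ((1 / ((k : ℝ) + 1) : ℝ) : ℂ)) ^ N) atTop
      (𝓝 (a / (T : ℂ) ^ N)) := by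
  have h1 : Tendsto (fun k : ℕ => ((1 / ((k : ℝ) + 1) : ℝ) : ℂ)) atTop (𝓝 ((0 : ℝ) : ℂ)) :=
    (Complex.continuous_ofReal.tendsto 0).comp tendsto_one_div_add_atTop_nhds_zero_nat
  have h2 : Tendsto (fun k : ℕ => ((T : ℂ) + ((1 / ((k : ℝ) + 1) : ℝ) : ℂ)) ^ N) atTop
      (𝓝 (((T : ℂ) + ((0 : ℝ) : ℂ)) ^ N)) := (tendsto_const_nhds.add h1).pow N
  rw [Complex.ofReal_zero, add_zero] at h2
  exact tendsto_const_nhds.div h2 (pow_ne_zero _ (Complex.ofReal_ne_zero.2 hT.ne'))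

/-- The Euler field has divergence `n` and multiplies `△⁻ⁿ` by `-n`, so only the derivative of `H`
remains in the divergence theorem for `H △⁻ⁿ`. The singularity at `z` is removed by replacing `△`
with `△ + ε`. -/
theorem integral_eulerDeriv_div_triangle (hn : 0 < n) {z : Cn n} (hz : ‖z‖ < 1) {H : Cn n → ℂ}
    (hH : ContDiffOn ℝ 1 H (closedBall 0 1)) {C : ℝ} (hC : 0 ≤ C)
    (hb : ∀ w ∈ closedBall (0 : Cn n) 1, ‖H w‖ ≤ C * ‖w - z‖) :
    ∫ w in ball (0 : Cn n) 1, eulerDeriv z H w / ((triangle w z : ℝ) : ℂ) ^ n =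
      (1 / 2) * ∫ ζ : sphere (0 : Cn n) 1,
        (1 - dotBar (ζ : Cn n) z) * H ζ / ((triangle (ζ : Cn n) z : ℝ) : ℂ) ^ n
        ∂(volume : Measure (Cn n)).toSphere := by
  have : Nonempty (Fin n) := ⟨⟨0, hn⟩⟩
  have : Nontrivial (Cn n) := inferInstance
  set ε : ℕ → ℝ := fun k => 1 / ((k : ℝ) + 1) with hε
  have hε0 : ∀ k, 0 < ε k := fun k => Nat.one_div_pos_of_nat
  have hT0 : ∀ k w, ((triangle w z : ℝ) : ℂ) + ((ε k : ℝ) : ℂ) ≠ 0 := by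
    intro k w
    rw [← Complex.ofReal_add, Complex.ofReal_ne_zero]
    have := triangle_nonneg hz w
    linarith [hε0 k]
  set g : ℕ → Cn n → ℂ := fun k w =>
    H w * ((((triangle w z : ℝ) : ℂ) + ((ε k : ℝ) : ℂ)) ^ n)⁻¹ with hg
  have hgd : ∀ k, ContDiffOn ℝ 1 (g k) (closedBall 0 1) := by
    intro k
    refine hH.mul (ContDiff.contDiffOn ?_)
    exact ((((contDiff_triangle z).of_le (by simp)).add contDiff_const).pow n).inv
      fun w => pow_ne_zero _ (hT0 k w)
  have hge : ∀ k, ∀ w ∈ ball (0 : Cn n) 1, eulerDeriv z (g k) w + n * g k w =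
      eulerDeriv z H w / (((triangle w z : ℝ) : ℂ) + ((ε k : ℝ) : ℂ)) ^ n +
        n * (((ε k : ℝ) : ℂ) * (H w / (((triangle w z : ℝ) : ℂ) + ((ε k : ℝ) : ℂ)) ^ (n + 1))) := by
    intro k w hw
    have hw := ball_subset_closedBall hw
    have h1 : HasEulerDeriv z H (eulerDeriv z H w) w := ⟨hH.differentiableOn (by simp) w hw, rfl⟩
    have h2 := (((HasEulerDeriv.triangle (z := z) hw).add hw
      (HasEulerDeriv.const ((ε k : ℝ) : ℂ))).pow hw n).inv hw (pow_ne_zero _ (hT0 k w))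
    rw [(h1.mul hw h2).2, hg]
    have h0 := hT0 k w
    obtain ⟨m, rfl⟩ : ∃ m, n = m + 1 := ⟨n - 1, by omega⟩
    simp only [Nat.add_sub_cancel]
    field_simp
    ring
  have hlim : Tendsto (fun k => ∫ w in ball (0 : Cn n) 1, (eulerDeriv z (g k) w + n * g k w)) atTop
      (𝓝 (∫ w in ball (0 : Cn n) 1, eulerDeriv z H w / ((triangle w z : ℝ) : ℂ) ^ n)) := by
    obtain ⟨C', hC', hb'⟩ := exists_norm_sum_conj_coord_sub_le z (fun j => dbarDeriv j H)
      fun j => continuousOn_dbarDeriv j hH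
    have hi1 := integrableOn_div_triangle_pow hn hz (continuousOn_eulerDeriv z hH) hC' hb'
    have hi2 := integrableOn_div_triangle_pow hn hz hH.continuousOn hC hb
    refine tendsto_integral_of_dominated_convergence _ (fun k => ?_)
      (hi1.norm.add (hi2.norm.const_mul n)) (fun k => ?_) ?_
    · exact (((continuousOn_eulerDeriv z (hgd k)).add
        (continuousOn_const.mul (hgd k).continuousOn)).mono
          ball_subset_closedBall).aestronglyMeasurable measurableSet_ball
    · filter_upwards [ae_restrict_mem measurableSet_ball,
        ae_restrict_of_ae (compl_mem_ae_iff.2 (measure_singleton z))] with w hw hwz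
      have hT := triangle_pos hz hwz
      have hTε : 0 < triangle w z + ε k := add_pos hT (hε0 k)
      rw [hge k w hw]
      refine (norm_add_le _ _).trans (add_le_add (norm_div_add_pow_le hT (hε0 k).le _) ?_)
      rw [norm_mul, Complex.norm_natCast]
      refine mul_le_mul_of_nonneg_left ?_ (Nat.cast_nonneg n)
      refine le_trans ?_ (norm_div_add_pow_le hT (hε0 k).le _)
      rw [norm_mul, norm_div, norm_div, norm_pow, norm_pow, ← Complex.ofReal_add,
        Complex.norm_real, Complex.norm_real, Real.norm_of_nonneg hTε.le,
        Real.norm_of_nonneg (hε0 k).le, pow_succ, ← mul_div_assoc, mul_comm (_ ^ n),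
        mul_div_mul_comm]
      refine mul_le_of_le_one_left (by positivity) ?_
      rw [div_le_one hTε]
      linarith
    · filter_upwards [ae_restrict_mem measurableSet_ball,
        ae_restrict_of_ae (compl_mem_ae_iff.2 (measure_singleton z))] with w hw hwz
      have hT := triangle_pos hz hwz
      have h1 : Tendsto (fun k : ℕ => ((ε k : ℝ) : ℂ)) atTop (𝓝 ((0 : ℝ) : ℂ)) :=
        (Complex.continuous_ofReal.tendsto 0).comp tendsto_one_div_add_atTop_nhds_zero_nat
      have h2 := (tendsto_div_add_pow hT (eulerDeriv z H w) n).add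
        ((h1.mul (tendsto_div_add_pow hT (H w) (n + 1))).const_mul (n : ℂ))
      simp only [Complex.ofReal_zero, zero_mul, mul_zero, add_zero] at h2
      refine h2.congr fun k => ?_
      rw [hge k w hw]
  have hlim' : Tendsto (fun k => ∫ ζ : sphere (0 : Cn n) 1, (1 - dotBar (ζ : Cn n) z) * g k ζ
        ∂(volume : Measure (Cn n)).toSphere) atTop
      (𝓝 (∫ ζ : sphere (0 : Cn n) 1,
        (1 - dotBar (ζ : Cn n) z) * H ζ / ((triangle (ζ : Cn n) z : ℝ) : ℂ) ^ n
        ∂(volume : Measure (Cn n)).toSphere)) := by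
    have hA : Continuous fun w : Cn n => 1 - dotBar w z :=
      continuous_const.sub (continuous_dotBar_left z)
    have hTs : ∀ ζ : sphere (0 : Cn n) 1, 0 < triangle (ζ : Cn n) z := by
      intro ζ
      refine triangle_pos hz fun h => ?_
      have := norm_eq_of_mem_sphere ζ
      rw [h] at this
      exact hz.ne this
    refine tendsto_integral_of_dominated_convergence
      (fun ζ => ‖(1 - dotBar (ζ : Cn n) z) * H ζ / ((triangle (ζ : Cn n) z : ℝ) : ℂ) ^ n‖)
      (fun k => ?_) ?_ (fun k => ?_) ?_
    · exact (integrable_sphere (hA.continuousOn.mul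
        ((hgd k).continuousOn.mono sphere_subset_closedBall))).1
    · refine Integrable.norm (integrable_sphere (f := fun w : Cn n =>
        (1 - dotBar w z) * H w / ((triangle w z : ℝ) : ℂ) ^ n) ?_)
      refine (hA.continuousOn.mul (hH.continuousOn.mono sphere_subset_closedBall)).div
        ((contDiff_triangle z).continuous.pow n).continuousOn fun w hw => ?_
      exact pow_ne_zero _ (Complex.ofReal_ne_zero.2 (hTs ⟨w, hw⟩).ne')
    · refine Eventually.of_forall fun ζ => ?_
      simp only [hg]
      rw [← div_eq_mul_inv, ← mul_div_assoc]
      exact norm_div_add_pow_le (hTs ζ) (hε0 k).le _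
    · refine Eventually.of_forall fun ζ => ?_
      have h2 := tendsto_div_add_pow (hTs ζ) ((1 - dotBar (ζ : Cn n) z) * H ζ) n
      refine h2.congr fun k => ?_
      simp only [hg]
      rw [← div_eq_mul_inv, ← mul_div_assoc]
  simp_rw [fun k => integral_ball_eulerDeriv_add hn z (hgd k)] at hlim
  exact tendsto_nhds_unique hlim (hlim'.const_mul _)

/-- Integration by parts against the kernels `Φₙ^ℓ`. The boundary term contains the factor
`(1 - |ζ|²)^ℓ`, so it survives only for `ℓ = 0`; then it is the Cauchy integral because
`△(ζ,z) = |1 - ζ z̄|²` on the sphere. For `ℓ = 0` the index `ℓ - 1` is truncated, but that term has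
the factor `ℓ`. -/
theorem integral_phi_mul_eulerDeriv {z : Cn n} (hz : ‖z‖ < 1) {ℓ : ℕ}
    (hℓ : ℓ < n) {F : Cn n → ℂ} (hF : ContDiffOn ℝ 1 F (closedBall 0 1)) {C : ℝ} (hC : 0 ≤ C)
    (hb : ∀ w ∈ closedBall (0 : Cn n) 1, ‖F w‖ ≤ C * ‖w - z‖) :
    ∫ w in ball (0 : Cn n) 1, (phi n ℓ w z * eulerDeriv z F w + ℓ * (phi n ℓ w z * F w) -
        ℓ * (phi n (ℓ - 1) w z * F w)) =
      if ℓ = 0 then (1 / 2) * ∫ ζ : sphere (0 : Cn n) 1, szego n ζ z * F ζ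
        ∂(volume : Measure (Cn n)).toSphere else 0 := by
  have hn : 0 < n := by omega
  set K : Cn n → ℂ := fun w => (1 - dotBar w z) ^ (n - 1 - ℓ) * oneSubSq w ^ ℓ with hK
  have hKd : ContDiff ℝ ∞ K := ((contDiff_const.sub (contDiff_dotBar_left z)).pow _).mul
    (contDiff_oneSubSq.pow _)
  obtain ⟨CK, hCK⟩ := (isCompact_closedBall (0 : Cn n) 1).exists_bound_of_continuousOn
    hKd.continuous.continuousOn
  have hb' : ∀ w ∈ closedBall (0 : Cn n) 1, ‖K w * F w‖ ≤ |CK| * C * ‖w - z‖ := by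
    intro w hw
    rw [norm_mul, mul_assoc]
    exact mul_le_mul ((hCK w hw).trans (le_abs_self _)) (hb w hw) (norm_nonneg _) (abs_nonneg _)
  have key := integral_eulerDeriv_div_triangle hn hz (H := fun w => K w * F w)
    (((hKd.of_le (by simp)).contDiffOn).mul hF) (by positivity) hb'
  have hleft : ∀ w ∈ ball (0 : Cn n) 1,
      eulerDeriv z (fun w => K w * F w) w / ((triangle w z : ℝ) : ℂ) ^ n =
      phi n ℓ w z * eulerDeriv z F w + ℓ * (phi n ℓ w z * F w) -
        ℓ * (phi n (ℓ - 1) w z * F w) := by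
    intro w hw
    have hw := ball_subset_closedBall hw
    have h1 : HasEulerDeriv z F (eulerDeriv z F w) w := ⟨hF.differentiableOn (by simp) w hw, rfl⟩
    have h2 := (((HasEulerDeriv.one_sub_dotBar (z := z) hw).pow hw (n - 1 - ℓ)).mul hw
      ((HasEulerDeriv.one_sub_normSq (z := z) hw).pow hw ℓ)).mul hw h1
    rw [h2.2]
    simp only [phi]
    rcases ℓ with _ | ℓ
    · simp
      ring
    · have h3 : n - 1 - (ℓ + 1 - 1) = n - 1 - (ℓ + 1) + 1 := by omega
      rw [h3]
      simp only [Nat.add_sub_cancel]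
      push_cast
      ring
  rw [setIntegral_congr_fun measurableSet_ball hleft] at key
  rw [key]
  have hr : ∀ ζ : sphere (0 : Cn n) 1, oneSubSq (ζ : Cn n) = 0 := by
    intro ζ
    simp [oneSubSq, norm_eq_of_mem_sphere]
  split_ifs with h
  · subst h
    congr 1
    refine integral_congr_ae (Eventually.of_forall fun ζ => ?_)
    have h1 : 1 - dotBar (ζ : Cn n) z ≠ 0 :=
      one_sub_dotBar_ne_zero (norm_eq_of_mem_sphere ζ).le hz
    simp only [hK, szego, triangle_eq, hr]
    obtain ⟨m, rfl⟩ : ∃ m, n = m + 1 := ⟨n - 1, by omega⟩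
    have h2 : 1 - dotBar z (ζ : Cn (m + 1)) ≠ 0 := by
      rw [← conj_dotBar, ← map_one (starRingEnd ℂ), ← map_sub]
      exact (map_ne_zero _).2 h1
    simp
    field_simp
    rw [mul_pow]
    ring
  · simp [hK, hr, h]

end Kernel

/-! ### The recursion for the operators applied to `𝒟̄ᵐ` -/

section Iterated

open Filter Topology Set

variable {n : ℕ}

theorem contDiffOn_dbarDeriv (j : Fin n) {f : Cn n → ℂ} (hf : ContDiffOn ℝ ∞ f (closedBall 0 1)) :
    ContDiffOn ℝ ∞ (dbarDeriv j f) (closedBall 0 1) := by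
  have h := hf.fderivWithin uniqueDiffOn_closedBall (m := ∞) (by simp)
  exact contDiffOn_const.mul ((h.clm_apply contDiffOn_const).add
    (contDiffOn_const.mul (h.clm_apply contDiffOn_const)))

theorem contDiffOn_dbarIter {f : Cn n → ℂ} (hf : ContDiffOn ℝ ∞ f (closedBall 0 1))
    (l : List (Fin n)) : ContDiffOn ℝ ∞ (dbarIter f l) (closedBall 0 1) := by
  induction l with
  | nil => exact hf
  | cons j l ih => exact contDiffOn_dbarDeriv j ih

theorem contDiff_conj_coord_sub (z : Cn n) (j : Fin n) :
    ContDiff ℝ ∞ fun w : Cn n => conj (w j) - conj (z j) :=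
  (contDiff_conj_coord j).sub contDiff_const

theorem contDiffOn_zbarPow {f : Cn n → ℂ} (hf : ContDiffOn ℝ ∞ f (closedBall 0 1)) (m : ℕ)
    (z : Cn n) : ContDiffOn ℝ ∞ (zbarPow m z f) (closedBall 0 1) :=
  ContDiffOn.sum fun α _ => (contDiff_prod fun i _ =>
    contDiff_conj_coord_sub z (α i)).contDiffOn.mul (contDiffOn_dbarIter hf _)

theorem contDiffOn_interiorProd {q : ℕ} {η : Cn n → AntiForm n (q + 1)}
    (hη : ContDiffOn ℝ ∞ η (closedBall 0 1)) (J : MultiIndex n q) (k : Fin n) :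
    ContDiffOn ℝ ∞ (interiorProd η J k) (closedBall 0 1) := by
  by_cases hk : k ∈ J.1
  · have : interiorProd η J k = fun _ => 0 := by
      funext w
      simp [interiorProd, hk]
    rw [this]
    exact contDiffOn_const
  · have : interiorProd η J k = fun w => (-1) ^ insertPos k J.1 * η w (J.insert k hk) := by
      funext w
      simp [interiorProd, hk]
    rw [this]
    exact contDiffOn_const.mul (contDiffOn_pi.1 hη _)

theorem contDiffOn_dbarPow {q : ℕ} {η : Cn n → AntiForm n (q + 1)}
    (hη : ContDiffOn ℝ ∞ η (closedBall 0 1)) (m : ℕ) (z : Cn n) (J : MultiIndex n q) :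
    ContDiffOn ℝ ∞ (fun w => dbarPow m η z w J) (closedBall 0 1) :=
  ContDiffOn.sum fun k _ => (contDiff_conj_coord_sub z k).contDiffOn.mul
    (contDiffOn_zbarPow (contDiffOn_interiorProd hη J k) m z)

/-- The coefficients of `𝒟̄ᵐη` vanish on the diagonal; this makes the volume integrals converge. -/
theorem exists_norm_dbarPow_le {q : ℕ} {η : Cn n → AntiForm n (q + 1)}
    (hη : ContDiffOn ℝ ∞ η (closedBall 0 1)) (m : ℕ) (z : Cn n) (J : MultiIndex n q) :
    ∃ C : ℝ, 0 ≤ C ∧ ∀ w ∈ closedBall (0 : Cn n) 1, ‖dbarPow m η z w J‖ ≤ C * ‖w - z‖ :=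
  exists_norm_sum_conj_coord_sub_le z (fun k => zbarPow m z (interiorProd η J k)) fun k =>
    (contDiffOn_zbarPow (contDiffOn_interiorProd hη J k) m z).continuousOn

theorem HasEulerDeriv.prod_conj_coord_sub {z w : Cn n} (hw : w ∈ closedBall (0 : Cn n) 1) {m : ℕ}
    (α : Fin m → Fin n) :
    HasEulerDeriv z (fun w => ∏ i, (conj (w (α i)) - conj (z (α i))))
      (m * ∏ i, (conj (w (α i)) - conj (z (α i)))) w := by
  induction m with
  | zero => simpa using const 1
  | succ m ih =>
    simp only [Fin.prod_univ_succ]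
    refine ((conj_coord_sub hw (α 0) (conj (z (α 0)))).mul hw
      (ih fun i => α i.succ)).congr_deriv ?_
    push_cast
    ring

/-- The Euler derivative of `𝒵̄ᵐf` acts either on the monomials of degree `m` in `w̄ - z̄` or on the
derivatives of `f`. -/
theorem HasEulerDeriv.zbarPow {z w : Cn n} (hw : w ∈ closedBall (0 : Cn n) 1) {f : Cn n → ℂ}
    (hf : ContDiffOn ℝ ∞ f (closedBall 0 1)) (m : ℕ) :
    HasEulerDeriv z (BallForms.zbarPow m z f)
      (m * BallForms.zbarPow m z f w + BallForms.zbarPow (m + 1) z f w) w := by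
  have h1 : ∀ α : Fin m → Fin n, HasEulerDeriv z (dbarIter f (List.ofFn α))
      (∑ j, (conj (w j) - conj (z j)) * dbarIter f (j :: List.ofFn α) w) w := fun α =>
    ⟨(contDiffOn_dbarIter hf _).differentiableOn (by simp) w hw, rfl⟩
  refine (sum hw Finset.univ fun α _ =>
    (prod_conj_coord_sub hw α).mul hw (h1 α)).congr_deriv ?_
  rw [Finset.sum_add_distrib, add_comm]
  congr 1
  · rw [BallForms.zbarPow, Finset.mul_sum]
    exact Finset.sum_congr rfl fun α _ => by ring
  · rw [BallForms.zbarPow, ← (Fin.consEquiv fun _ : Fin (m + 1) => Fin n).sum_comp,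
      Fintype.sum_prod_type, Finset.sum_comm]
    refine Finset.sum_congr rfl fun α _ => ?_
    rw [Finset.mul_sum]
    refine Finset.sum_congr rfl fun j _ => ?_
    simp [Fin.consEquiv, Fin.prod_univ_succ, List.ofFn_succ]
    ring

theorem eulerDeriv_dbarPow {q : ℕ} {η : Cn n → AntiForm n (q + 1)}
    (hη : ContDiffOn ℝ ∞ η (closedBall 0 1)) (m : ℕ) (z : Cn n) (J : MultiIndex n q) {w : Cn n}
    (hw : w ∈ closedBall (0 : Cn n) 1) :
    eulerDeriv z (fun w => dbarPow m η z w J) w =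
      (m + 1) * dbarPow m η z w J + dbarPow (m + 1) η z w J := by
  have h := HasEulerDeriv.sum (z := z) hw Finset.univ fun k _ =>
    (HasEulerDeriv.conj_coord_sub hw k (conj (z k))).mul hw
      (HasEulerDeriv.zbarPow hw (contDiffOn_interiorProd hη J k) m)
  refine h.2.trans ?_
  simp only [dbarPow]
  rw [Finset.mul_sum, ← Finset.sum_add_distrib]
  exact Finset.sum_congr rfl fun k _ => by ring

theorem integrableOn_phi_mul {z : Cn n} (hz : ‖z‖ < 1) {ℓ : ℕ} (hn : 0 < n)
    {F : Cn n → ℂ} (hF : ContinuousOn F (closedBall 0 1)) {C : ℝ} (hC : 0 ≤ C)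
    (hb : ∀ w ∈ closedBall (0 : Cn n) 1, ‖F w‖ ≤ C * ‖w - z‖) :
    IntegrableOn (fun w => phi n ℓ w z * F w) (ball 0 1) := by
  set K : Cn n → ℂ := fun w => (1 - dotBar w z) ^ (n - 1 - ℓ) * oneSubSq w ^ ℓ with hK
  have hKd : Continuous K := ((continuous_const.sub (continuous_dotBar_left z)).pow _).mul
    (continuous_oneSubSq.pow _)
  obtain ⟨CK, hCK⟩ := (isCompact_closedBall (0 : Cn n) 1).exists_bound_of_continuousOn
    hKd.continuousOn
  have hb' : ∀ w ∈ closedBall (0 : Cn n) 1, ‖K w * F w‖ ≤ |CK| * C * ‖w - z‖ := by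
    intro w hw
    rw [norm_mul, mul_assoc]
    exact mul_le_mul ((hCK w hw).trans (le_abs_self _)) (hb w hw) (norm_nonneg _) (abs_nonneg _)
  refine (integrableOn_div_triangle_pow hn hz (hKd.continuousOn.mul hF) (by positivity)
    hb').congr_fun (fun w _ => ?_) measurableSet_ball
  simp only [phi, hK, Pi.mul_apply]
  ring

theorem integrableOn_phi_smul_dbarPow {q : ℕ} (hn : 0 < n) {η : Cn n → AntiForm n (q + 1)}
    (hη : ContDiffOn ℝ ∞ η (closedBall 0 1)) (m ℓ : ℕ) {z : Cn n} (hz : ‖z‖ < 1) :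
    IntegrableOn (fun w => phi n ℓ w z • dbarPow m η z w) (ball 0 1) := by
  refine Integrable.of_eval fun J => ?_
  obtain ⟨C, hC, hb⟩ := exists_norm_dbarPow_le hη m z J
  exact integrableOn_phi_mul hz hn (contDiffOn_dbarPow hη m z J).continuousOn hC hb

theorem contDiffOn_szego {z : Cn n} (hz : ‖z‖ < 1) (s : ℕ) :
    ContDiffOn ℝ ∞ (fun w => 1 / (1 - dotBar z w) ^ s) (closedBall (0 : Cn n) 1) := by
  have h : ContDiff ℝ ∞ fun w : Cn n => (1 - dotBar z w) ^ s :=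
    (contDiff_const.sub (contDiff_dotBar_right z)).pow s
  simp only [one_div]
  refine h.contDiffOn.inv fun w hw => pow_ne_zero _ ?_
  rw [mem_closedBall_zero_iff] at hw
  rw [← conj_dotBar, ← map_one (starRingEnd ℂ), ← map_sub]
  exact (map_ne_zero _).2 (one_sub_dotBar_ne_zero hw hz)

theorem integrable_szego_smul_dbarPow {q : ℕ} {η : Cn n → AntiForm n (q + 1)}
    (hη : ContDiffOn ℝ ∞ η (closedBall 0 1)) (m : ℕ) {z : Cn n} (hz : ‖z‖ < 1) :
    Integrable (fun ζ : sphere (0 : Cn n) 1 => szego n ζ z • dbarPow m η z ζ)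
      (volume : Measure (Cn n)).toSphere := by
  refine Integrable.of_eval fun J => ?_
  exact integrable_sphere (f := fun w : Cn n => szego n w z * dbarPow m η z w J)
    (((contDiffOn_szego hz n).continuousOn.mul
      (contDiffOn_dbarPow hη m z J).continuousOn).mono sphere_subset_closedBall)

/-- Integration by parts with `F = 𝒟̄ᵐη`, whose Euler derivative is `(m + 1) 𝒟̄ᵐη + 𝒟̄ᵐ⁺¹η`. -/
theorem volOp_phi_recursion {q : ℕ} {η : Cn n → AntiForm n (q + 1)}
    (hη : ContDiffOn ℝ ∞ η (closedBall 0 1)) (m : ℕ) {ℓ : ℕ} (hℓ : ℓ < n) {z : Cn n}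
    (hz : ‖z‖ < 1) :
    ((ℓ : ℂ) + m + 1) • volOp (fun w => phi n ℓ w z) (dbarPow m η z) =
      (if ℓ = 0 then (1 / 2 : ℂ) else 0) • bdryOp (dbarPow m η z) z +
      (ℓ : ℂ) • volOp (fun w => phi n (ℓ - 1) w z) (dbarPow m η z) -
      volOp (fun w => phi n ℓ w z) (dbarPow (m + 1) η z) := by
  have hn : 0 < n := by omega
  funext J
  obtain ⟨C, hC, hb⟩ := exists_norm_dbarPow_le hη m z J
  have hi := fun m ℓ => integrableOn_phi_smul_dbarPow hn hη m ℓ hz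
  have hv : ∀ m ℓ, volOp (fun w => phi n ℓ w z) (dbarPow m η z) J =
      ∫ w in ball (0 : Cn n) 1, phi n ℓ w z * dbarPow m η z w J := fun m ℓ =>
    eval_integral (fun J => (hi m ℓ).eval J) J
  have hs : bdryOp (dbarPow m η z) z J = ∫ ζ : sphere (0 : Cn n) 1,
      szego n ζ z * dbarPow m η z ζ J ∂(volume : Measure (Cn n)).toSphere :=
    eval_integral (fun J => (integrable_szego_smul_dbarPow hη m hz).eval J) J
  have key := integral_phi_mul_eulerDeriv hz hℓ
    ((contDiffOn_dbarPow hη m z J).of_le (by simp)) hC hb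
  have hi' : ∀ m ℓ, IntegrableOn (fun w => phi n ℓ w z * dbarPow m η z w J) (ball (0 : Cn n) 1) :=
    fun m ℓ => (hi m ℓ).eval J
  have hcongr : ∀ w ∈ ball (0 : Cn n) 1,
      phi n ℓ w z * eulerDeriv z (fun w => dbarPow m η z w J) w +
        ℓ * (phi n ℓ w z * dbarPow m η z w J) - ℓ * (phi n (ℓ - 1) w z * dbarPow m η z w J) =
      ((ℓ : ℂ) + m + 1) * (phi n ℓ w z * dbarPow m η z w J) +
        phi n ℓ w z * dbarPow (m + 1) η z w J - ℓ * (phi n (ℓ - 1) w z * dbarPow m η z w J) := by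
    intro w hw
    rw [eulerDeriv_dbarPow hη m z J (ball_subset_closedBall hw)]
    ring
  have hadd : IntegrableOn (fun w => ((ℓ : ℂ) + m + 1) * (phi n ℓ w z * dbarPow m η z w J) +
      phi n ℓ w z * dbarPow (m + 1) η z w J) (ball (0 : Cn n) 1) :=
    ((hi' m ℓ).const_mul _).add (hi' (m + 1) ℓ)
  rw [setIntegral_congr_fun measurableSet_ball hcongr,
    integral_sub hadd ((hi' m (ℓ - 1)).const_mul _),
    integral_add ((hi' m ℓ).const_mul _) (hi' (m + 1) ℓ), integral_const_mul,
    integral_const_mul] at key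
  simp only [Pi.smul_apply, Pi.add_apply, Pi.sub_apply, smul_eq_mul, hv, hs]
  rw [ite_mul, zero_mul, ← key]
  ring

end Iterated

/-! ### Solution of the recursion -/

section Coefficients

/-- The coefficient of the boundary term when `Φ^ℓ 𝒟̄ᵐ` is expressed through the operators with
`𝒟̄ᵐ⁺¹`. -/
def bdryCoeff (m : ℕ) : ℕ → ℂ
  | 0 => 1 / (2 * (m + 1))
  | ℓ + 1 => ((ℓ : ℂ) + 1) / (ℓ + m + 2) * bdryCoeff m ℓ

/-- The coefficient of `Φ^j 𝒟̄ᵐ⁺¹` in the expansion of `Φ^ℓ 𝒟̄ᵐ`. -/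
def volCoeff (m : ℕ) : ℕ → ℕ → ℂ
  | 0, j => if j = 0 then -(1 / ((m : ℂ) + 1)) else 0
  | ℓ + 1, j => ((ℓ : ℂ) + 1) / (ℓ + m + 2) * volCoeff m ℓ j +
      if j = ℓ + 1 then -(1 / ((ℓ : ℂ) + m + 2)) else 0

/-- The coefficients `c_ℓ^{(m)}` of the volume terms, starting from `C Φ^q 𝒟̄⁰`. -/
def volSeq (C : ℂ) (q : ℕ) : ℕ → ℕ → ℂ
  | 0, ℓ => if ℓ = q then C else 0
  | m + 1, j => ∑ ℓ ∈ Finset.range (q + 1), volSeq C q m ℓ * volCoeff m ℓ j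

/-- The coefficients `c_k` of the boundary terms. -/
def bdrySeq (C : ℂ) (q m : ℕ) : ℂ :=
  ∑ ℓ ∈ Finset.range (q + 1), volSeq C q m ℓ * bdryCoeff m ℓ

variable {V : Type*} [AddCommGroup V] [Module ℂ V] {q : ℕ} {P : ℕ → ℕ → V} {S : ℕ → V}

/-- The recursion, solved for fixed `m` by induction on `ℓ`. -/
theorem eq_bdryCoeff_add_volCoeff
    (h : ∀ ℓ ≤ q, ∀ m : ℕ, ((ℓ : ℂ) + m + 1) • P ℓ m =
      (if ℓ = 0 then (1 / 2 : ℂ) else 0) • S m + (ℓ : ℂ) • P (ℓ - 1) m - P ℓ (m + 1))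
    (m : ℕ) {ℓ : ℕ} (hℓ : ℓ ≤ q) :
    P ℓ m = bdryCoeff m ℓ • S m +
      ∑ j ∈ Finset.range (q + 1), volCoeff m ℓ j • P j (m + 1) := by
  have hdiv : ∀ (a : ℂ) (x y : V), a ≠ 0 → a • x = y → x = (1 / a) • y := by
    rintro a x y ha rfl
    rw [smul_smul, one_div, inv_mul_cancel₀ ha, one_smul]
  have hne : ∀ k : ℕ, (k : ℂ) + m + 1 ≠ 0 := fun k => by
    exact_mod_cast Nat.succ_ne_zero (k + m)
  induction ℓ with
  | zero =>
    have h1 := hdiv _ _ _ (hne 0) (h 0 hℓ m)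
    rw [h1, Finset.sum_eq_single 0]
    · simp only [bdryCoeff, volCoeff, if_true, Nat.cast_zero, zero_smul, add_zero, zero_add,
        smul_sub, smul_smul]
      have h2 : (m : ℂ) + 1 ≠ 0 := by simpa using hne 0
      rw [sub_eq_add_neg, ← neg_smul]
      congr 2
      field_simp
    · intro j _ hj
      simp [volCoeff, hj]
    · simp
  | succ ℓ ih =>
    have h1 := hdiv _ _ _ (hne (ℓ + 1)) (h (ℓ + 1) hℓ m)
    rw [h1, if_neg (Nat.succ_ne_zero ℓ), zero_smul, zero_add, Nat.add_sub_cancel, ih (by omega)]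
    simp only [bdryCoeff, volCoeff, add_smul, Finset.sum_add_distrib, ite_smul, zero_smul,
      Finset.sum_ite_eq', Finset.mem_range, Nat.lt_succ_iff.2 hℓ, if_true, smul_sub, smul_add,
      smul_smul, Finset.smul_sum]
    have h2 : (ℓ : ℂ) + m + 2 ≠ 0 := by
      have := hne (ℓ + 1)
      push_cast at this
      convert this using 1
      ring
    have h3 : ((ℓ + 1 : ℕ) : ℂ) + m + 1 = ℓ + m + 2 := by
      push_cast
      ring
    rw [h3, add_sub_assoc, sub_eq_add_neg, ← neg_smul]
    push_cast
    simp only [one_div_mul_eq_div, add_assoc, ← mul_assoc]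

/-- Iteration in `m`. Here `P ℓ m` stands for `Φ^ℓ 𝒟̄ᵐη` and `S m` for `𝒮 𝒟̄ᵐη`. -/
theorem eq_sum_bdrySeq_add_sum_volSeq
    (h : ∀ ℓ ≤ q, ∀ m : ℕ, ((ℓ : ℂ) + m + 1) • P ℓ m =
      (if ℓ = 0 then (1 / 2 : ℂ) else 0) • S m + (ℓ : ℂ) • P (ℓ - 1) m - P ℓ (m + 1))
    (C : ℂ) (m : ℕ) :
    C • P q 0 = ∑ k ∈ Finset.range m, bdrySeq C q k • S k +
      ∑ ℓ ∈ Finset.range (q + 1), volSeq C q m ℓ • P ℓ m := by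
  induction m with
  | zero => simp [volSeq]
  | succ m ih =>
    rw [ih, Finset.sum_range_succ (fun k => bdrySeq C q k • S k), add_assoc]
    congr 1
    have h1 : ∀ ℓ ∈ Finset.range (q + 1), volSeq C q m ℓ • P ℓ m =
        (volSeq C q m ℓ * bdryCoeff m ℓ) • S m +
        ∑ j ∈ Finset.range (q + 1), (volSeq C q m ℓ * volCoeff m ℓ j) • P j (m + 1) := by
      intro ℓ hℓ
      rw [eq_bdryCoeff_add_volCoeff h m (Nat.lt_succ_iff.1 (Finset.mem_range.1 hℓ)), smul_add,
        smul_smul, Finset.smul_sum]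
      simp only [smul_smul]
    rw [Finset.sum_congr rfl h1, Finset.sum_add_distrib, Finset.sum_comm, ← Finset.sum_smul]
    simp only [← Finset.sum_smul]
    rfl

end Coefficients

/-- The formula for `𝒞ₙ^{0,q}η`. -/
theorem charpentierOp_eq {n q : ℕ} (hq : q < n) (m : ℕ) {η : Cn n → AntiForm n (q + 1)}
    (hη : ContDiffOn ℝ ∞ η (closedBall 0 1)) {z : Cn n} (hz : z ∈ ball (0 : Cn n) 1) :
    IntegrableOn (charpentierDensity η z) (ball 0 1) ∧
        charpentierOp η z =
          ∑ k ∈ Finset.range m, bdrySeq (kernelConst n q) q k • bdryOp (dbarPow k η z) z +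
          ∑ ℓ ∈ Finset.range (q + 1), volSeq (kernelConst n q) q m ℓ •
            volOp (fun w => phi n ℓ w z) (dbarPow m η z) := by
  rw [mem_ball_zero_iff] at hz
  have hd : ∀ w ∈ ball (0 : Cn n) 1, charpentierDensity η z w =
      kernelConst n q • (phi n q w z • dbarPow 0 η z w) := fun w hw =>
    charpentierDensity_eq hq η z w (mem_ball_zero_iff.1 hw)
  have hi := integrableOn_phi_smul_dbarPow (by omega) hη 0 q hz
  have hi' : IntegrableOn (fun w => kernelConst n q • (phi n q w z • dbarPow 0 η z w))
      (ball 0 1) := hi.smul (kernelConst n q)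
  refine ⟨hi'.congr_fun (fun w hw => (hd w hw).symm) measurableSet_ball, ?_⟩
  have h1 : charpentierOp η z = kernelConst n q • volOp (fun w => phi n q w z) (dbarPow 0 η z) := by
    rw [charpentierOp, setIntegral_congr_fun measurableSet_ball hd, integral_smul]
    rfl
  rw [h1]
  exact eq_sum_bdrySeq_add_sum_volSeq (P := fun ℓ m => volOp (fun w => phi n ℓ w z) (dbarPow m η z))
    (S := fun m => bdryOp (dbarPow m η z) z)
    (fun ℓ hℓ m => volOp_phi_recursion hη m (by omega) hz) _ m

/-! ### Forms that are constant in the extra variables -/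

section Projection

variable {n d : ℕ}

/-- `projFirst` as a continuous linear map. -/
def projFirstL (h : n ≤ n + d) : Cn (n + d) →L[ℝ] Cn n :=
  LinearMap.toContinuousLinearMap
    { toFun := projFirst h
      map_add' := fun _ _ => rfl
      map_smul' := fun _ _ => rfl }

theorem projFirst_apply (h : n ≤ n + d) (w : Cn (n + d)) (i : Fin n) :
    projFirst h w i = w (Fin.castAdd d i) := rfl

theorem embFirst_castAdd (z : Cn n) (i : Fin n) : embFirst (n + d) z (Fin.castAdd d i) = z i := by
  simp [embFirst]

theorem embFirst_natAdd (z : Cn n) (i : Fin d) : embFirst (n + d) z (Fin.natAdd n i) = 0 := by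
  simp [embFirst]

theorem projFirst_single_castAdd (h : n ≤ n + d) (i : Fin n) (c : ℂ) :
    projFirst h (EuclideanSpace.single (Fin.castAdd d i) c) = EuclideanSpace.single i c := by
  ext k
  rw [projFirst_apply]
  by_cases hk : k = i <;> simp [hk]

theorem projFirst_single_natAdd (h : n ≤ n + d) (i : Fin d) (c : ℂ) :
    projFirst h (EuclideanSpace.single (Fin.natAdd n i) c) = 0 := by
  ext k
  rw [projFirst_apply]
  have : Fin.castAdd d k ≠ Fin.natAdd n i := by
    intro h'
    have := congrArg Fin.val h'
    simp at this
    omega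
  simp [this]

theorem norm_sq_eq_add (h : n ≤ n + d) (w : Cn (n + d)) :
    ‖w‖ ^ 2 = ‖projFirst h w‖ ^ 2 + ∑ i : Fin d, ‖w (Fin.natAdd n i)‖ ^ 2 := by
  rw [EuclideanSpace.norm_sq_eq, EuclideanSpace.norm_sq_eq, Fin.sum_univ_add]
  rfl

theorem norm_projFirst_le (h : n ≤ n + d) (w : Cn (n + d)) : ‖projFirst h w‖ ≤ ‖w‖ := by
  refine (sq_le_sq₀ (norm_nonneg _) (norm_nonneg _)).1 ?_
  rw [norm_sq_eq_add h w]
  exact le_add_of_nonneg_right (Finset.sum_nonneg fun _ _ => sq_nonneg _)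

theorem projFirst_mem_closedBall (h : n ≤ n + d) {w : Cn (n + d)} (hw : w ∈ closedBall 0 1) :
    projFirst h w ∈ closedBall (0 : Cn n) 1 := by
  rw [mem_closedBall_zero_iff] at *
  exact (norm_projFirst_le h w).trans hw

theorem norm_embFirst (z : Cn n) : ‖embFirst (n + d) z‖ = ‖z‖ := by
  have h1 : ‖embFirst (n + d) z‖ ^ 2 = ‖z‖ ^ 2 := by
    rw [EuclideanSpace.norm_sq_eq, EuclideanSpace.norm_sq_eq, Fin.sum_univ_add]
    simp [embFirst_castAdd, embFirst_natAdd]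
  exact (pow_left_inj₀ (norm_nonneg _) (norm_nonneg _) two_ne_zero).1 h1

theorem dotBar_embFirst_right (h : n ≤ n + d) (w : Cn (n + d)) (z : Cn n) :
    dotBar w (embFirst (n + d) z) = dotBar (projFirst h w) z := by
  rw [dotBar, dotBar, Fin.sum_univ_add]
  simp [embFirst_castAdd, embFirst_natAdd, projFirst_apply]

theorem dotBar_embFirst_left (h : n ≤ n + d) (w : Cn (n + d)) (z : Cn n) :
    dotBar (embFirst (n + d) z) w = dotBar z (projFirst h w) := by
  rw [dotBar, dotBar, Fin.sum_univ_add]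
  simp [embFirst_castAdd, embFirst_natAdd, projFirst_apply]

theorem fderivWithin_comp_projFirst (h : n ≤ n + d) {f : Cn n → ℂ} {w : Cn (n + d)}
    (hw : w ∈ closedBall 0 1)
    (hf : DifferentiableWithinAt ℝ f (closedBall 0 1) (projFirst h w)) (e : Cn (n + d)) :
    fderivWithin ℝ (fun w => f (projFirst h w)) (closedBall 0 1) w e =
      fderivWithin ℝ f (closedBall 0 1) (projFirst h w) (projFirst h e) := by
  have h1 : HasFDerivWithinAt (fun w => f (projFirst h w))
      ((fderivWithin ℝ f (closedBall 0 1) (projFirst h w)).comp (projFirstL h))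
      (closedBall 0 1) w :=
    HasFDerivWithinAt.comp (g := f) (f := projFirst h) w hf.hasFDerivWithinAt
      (projFirstL h).hasFDerivWithinAt fun _ hx => projFirst_mem_closedBall h hx
  rw [h1.fderivWithin (uniqueDiffOn_closedBall w hw)]
  rfl

theorem eulerDeriv_comp_projFirst (h : n ≤ n + d) (z : Cn n) {f : Cn n → ℂ} {w : Cn (n + d)}
    (hw : w ∈ closedBall 0 1)
    (hf : DifferentiableWithinAt ℝ f (closedBall 0 1) (projFirst h w)) :
    eulerDeriv (embFirst (n + d) z) (fun w => f (projFirst h w)) w =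
      eulerDeriv z f (projFirst h w) := by
  simp only [eulerDeriv, dbarDeriv, fderivWithin_comp_projFirst h hw hf, Fin.sum_univ_add,
    projFirst_single_castAdd, projFirst_single_natAdd, embFirst_castAdd, projFirst_apply]
  simp

theorem dbarDeriv_congr (j : Fin n) {f g : Cn n → ℂ}
    (hfg : ∀ w ∈ closedBall (0 : Cn n) 1, f w = g w)
    {w : Cn n} (hw : w ∈ closedBall (0 : Cn n) 1) : dbarDeriv j f w = dbarDeriv j g w := by
  rw [dbarDeriv, dbarDeriv, fderivWithin_congr hfg (hfg w hw)]

/-- `𝒵̄ᵐ⁺¹` through the Euler derivative of `𝒵̄ᵐ`, without multi-indices. -/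
theorem zbarPow_succ (m : ℕ) (z : Cn n) {f : Cn n → ℂ} (hf : ContDiffOn ℝ ∞ f (closedBall 0 1))
    {w : Cn n} (hw : w ∈ closedBall (0 : Cn n) 1) :
    zbarPow (m + 1) z f w = eulerDeriv z (zbarPow m z f) w - m * zbarPow m z f w := by
  rw [(HasEulerDeriv.zbarPow hw hf m).2]
  ring

theorem contDiffOn_comp_projFirst (h : n ≤ n + d) {F : Type*} [NormedAddCommGroup F]
    [NormedSpace ℝ F] {f : Cn n → F} (hf : ContDiffOn ℝ ∞ f (closedBall 0 1)) :
    ContDiffOn ℝ ∞ (fun w => f (projFirst h w)) (closedBall 0 1) :=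
  hf.comp (projFirstL h).contDiff.contDiffOn fun _ hw => projFirst_mem_closedBall h hw

theorem zbarPow_comp_projFirst (h : n ≤ n + d) (m : ℕ) (z : Cn n) {f : Cn n → ℂ}
    (hf : ContDiffOn ℝ ∞ f (closedBall 0 1)) {w : Cn (n + d)} (hw : w ∈ closedBall 0 1) :
    zbarPow m (embFirst (n + d) z) (fun w => f (projFirst h w)) w =
      zbarPow m z f (projFirst h w) := by
  induction m generalizing w with
  | zero => simp [zbarPow, dbarIter]
  | succ m ih =>
    have hP := projFirst_mem_closedBall h hw
    have h1 : eulerDeriv (embFirst (n + d) z)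
        (zbarPow m (embFirst (n + d) z) fun w => f (projFirst h w)) w =
        eulerDeriv (embFirst (n + d) z) (fun w => zbarPow m z f (projFirst h w)) w :=
      Finset.sum_congr rfl fun j _ => by rw [dbarDeriv_congr j (fun w hw => ih hw) hw]
    rw [zbarPow_succ m _ (contDiffOn_comp_projFirst h hf) hw, zbarPow_succ m _ hf hP, h1, ih hw,
      eulerDeriv_comp_projFirst h z hw
        ((contDiffOn_zbarPow hf m z).differentiableOn (by simp) _ hP)]

theorem zbarPow_zero_fun (m : ℕ) (z w : Cn n) : zbarPow m z (fun _ => 0) w = 0 := by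
  have h1 : ∀ l : List (Fin n), dbarIter (fun _ => 0) l = fun _ => 0 := by
    intro l
    induction l with
    | nil => rfl
    | cons j l ih =>
      funext w
      rw [dbarIter, ih, dbarDeriv_const]
  simp [zbarPow, h1]

theorem MultiIndex.cast_injective {p : ℕ} (h : n ≤ n + d) :
    Function.Injective (MultiIndex.cast h : MultiIndex n p → MultiIndex (n + d) p) := by
  intro I J hIJ
  exact Subtype.ext (Finset.map_injective _ (congrArg Subtype.val hIJ))

theorem extendForm_cast {p : ℕ} (h : n ≤ n + d) (η : Cn n → AntiForm n p) (w : Cn (n + d))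
    (I : MultiIndex n p) : extendForm h η w (I.cast h) = η (projFirst h w) I := by
  rw [extendForm, Finset.sum_eq_single I]
  · simp
  · intro J _ hJ
    rw [if_neg fun h' => hJ (MultiIndex.cast_injective h h')]
  · simp

theorem extendForm_eq_zero {p : ℕ} (h : n ≤ n + d) (η : Cn n → AntiForm n p) (w : Cn (n + d))
    {I : MultiIndex (n + d) p} {i : Fin d} (hi : Fin.natAdd n i ∈ I.1) :
    extendForm h η w I = 0 := by
  refine Finset.sum_eq_zero fun J _ => if_neg ?_
  rintro rfl
  obtain ⟨k, -, hk⟩ := Finset.mem_map.1 hi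
  have := congrArg Fin.val hk
  simp at this
  omega

theorem contDiffOn_extendForm {p : ℕ} (h : n ≤ n + d) {η : Cn n → AntiForm n p}
    (hη : ContDiffOn ℝ ∞ η (closedBall 0 1)) :
    ContDiffOn ℝ ∞ (extendForm h η) (closedBall 0 1) := by
  refine contDiffOn_pi.2 fun I => ContDiffOn.sum fun J _ => ?_
  split_ifs
  · exact contDiffOn_pi.1 (contDiffOn_comp_projFirst h hη) J
  · exact contDiffOn_const

theorem interiorProd_extendForm_castAdd {q : ℕ} (h : n ≤ n + d) (η : Cn n → AntiForm n (q + 1))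
    (J : MultiIndex n q) (i : Fin n) :
    interiorProd (extendForm h η) (J.cast h) (Fin.castAdd d i) =
      fun w => interiorProd η J i (projFirst h w) := by
  have hmem : Fin.castAdd d i ∈ (J.cast h).1 ↔ i ∈ J.1 :=
    Finset.mem_map' (Fin.castLEEmb h) (a := i) (s := J.1)
  funext w
  by_cases hi : i ∈ J.1
  · simp [interiorProd, hi, hmem]
  · have hi' : Fin.castAdd d i ∉ (J.cast h).1 := fun h' => hi (hmem.1 h')
    have hpos : insertPos (Fin.castAdd d i) (J.cast h).1 = insertPos i J.1 := by
      rw [insertPos, insertPos, MultiIndex.cast, Finset.filter_map, Finset.card_map]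
      rfl
    have hins : (J.cast h).insert (Fin.castAdd d i) hi' = (J.insert i hi).cast h :=
      Subtype.ext (Finset.map_insert (Fin.castLEEmb h) i J.1).symm
    simp only [interiorProd, dif_pos hi, dif_pos hi', hpos, hins, extendForm_cast]

theorem interiorProd_extendForm_natAdd {q : ℕ} (h : n ≤ n + d) (η : Cn n → AntiForm n (q + 1))
    (J : MultiIndex n q) (i : Fin d) :
    interiorProd (extendForm h η) (J.cast h) (Fin.natAdd n i) = fun _ => 0 := by
  funext w
  rw [interiorProd]
  split_ifs with hi
  · rfl
  · rw [extendForm_eq_zero h η w (i := i) (by simp [MultiIndex.insert]), mul_zero]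

/-- `𝒟̄ᵐ` commutes with the extension of forms, when the parameter lies in the subspace `ℂⁿ`. -/
theorem dbarPow_extendForm {q : ℕ} (h : n ≤ n + d) {η : Cn n → AntiForm n (q + 1)}
    (hη : ContDiffOn ℝ ∞ η (closedBall 0 1)) (m : ℕ) (z : Cn n) {w : Cn (n + d)}
    (hw : w ∈ closedBall 0 1) (J : MultiIndex n q) :
    dbarPow m (extendForm h η) (embFirst (n + d) z) w (J.cast h) =
      dbarPow m η z (projFirst h w) J := by
  simp only [dbarPow, Fin.sum_univ_add, interiorProd_extendForm_castAdd,
    interiorProd_extendForm_natAdd, zbarPow_zero_fun, mul_zero, Finset.sum_const_zero, add_zero,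
    zbarPow_comp_projFirst h m z (contDiffOn_interiorProd hη J _) hw, embFirst_castAdd]
  rfl

end Projection

/-! ### Integration over slices of the ball and of the sphere -/

section Slices

open Set

variable {n d : ℕ}

/-- The measurable equivalence `ℂⁿ⁺ᵈ ≃ ℂⁿ × ℂᵈ`. -/
def splitEquiv (n d : ℕ) : Cn (n + d) ≃ᵐ Cn n × Cn d :=
  ((LinearIsometryEquiv.piLpCongrLeft 2 ℝ ℂ finSumFinEquiv.symm).trans
    (PiLp.sumPiLpEquivProdLpPiLp 2 fun _ : Fin n ⊕ Fin d => ℂ)).toMeasurableEquiv.trans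
    (MeasurableEquiv.toLp 2 (Cn n × Cn d)).symm

theorem measurePreserving_splitEquiv : MeasurePreserving (splitEquiv n d) :=
  (LinearIsometryEquiv.measurePreserving _).trans
    (WithLp.volume_preserving_symm_measurableEquiv_toLp_prod (Cn n) (Cn d))

theorem splitEquiv_fst (h : n ≤ n + d) (w : Cn (n + d)) : (splitEquiv n d w).1 = projFirst h w := by
  ext i
  simp [splitEquiv, projFirst_apply]

theorem splitEquiv_snd_apply (w : Cn (n + d)) (i : Fin d) :
    (splitEquiv n d w).2 i = w (Fin.natAdd n i) := by
  simp [splitEquiv]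

theorem norm_sq_eq_splitEquiv (w : Cn (n + d)) :
    ‖w‖ ^ 2 = ‖(splitEquiv n d w).1‖ ^ 2 + ‖(splitEquiv n d w).2‖ ^ 2 := by
  rw [splitEquiv_fst (Nat.le_add_right n d), norm_sq_eq_add (Nat.le_add_right n d),
    EuclideanSpace.norm_sq_eq (splitEquiv n d w).2]
  simp only [splitEquiv_snd_apply]

theorem projFirst_splitEquiv_symm (h : n ≤ n + d) (p : Cn n × Cn d) :
    projFirst h ((splitEquiv n d).symm p) = p.1 := by
  rw [← splitEquiv_fst h, MeasurableEquiv.apply_symm_apply]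

theorem norm_sq_splitEquiv_symm (p : Cn n × Cn d) :
    ‖(splitEquiv n d).symm p‖ ^ 2 = ‖p.1‖ ^ 2 + ‖p.2‖ ^ 2 := by
  rw [norm_sq_eq_splitEquiv, MeasurableEquiv.apply_symm_apply]

theorem splitEquiv_symm_mem_ball (w : Cn n) (u : Cn d) :
    (splitEquiv n d).symm (w, u) ∈ ball (0 : Cn (n + d)) 1 ↔
      w ∈ ball (0 : Cn n) 1 ∧ u ∈ ball (0 : Cn d) (√(1 - ‖w‖ ^ 2)) := by
  simp only [mem_ball_zero_iff]
  rw [Real.lt_sqrt (norm_nonneg _), ← sq_lt_one_iff₀ (norm_nonneg _), norm_sq_splitEquiv_symm,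
    ← sq_lt_one_iff₀ (norm_nonneg w)]
  constructor
  · intro h
    constructor <;> nlinarith [sq_nonneg ‖w‖, sq_nonneg ‖u‖]
  · rintro ⟨h1, h2⟩
    linarith

/-- Integration over the unit ball of `ℂⁿ⁺ᵈ` by slices parallel to `ℂᵈ`. -/
theorem integral_ball_eq_integral_slices {f : Cn (n + d) → ℂ} (hf : IntegrableOn f (ball 0 1)) :
    IntegrableOn (fun w : Cn n => ∫ u in ball (0 : Cn d) (√(1 - ‖w‖ ^ 2)),
        f ((splitEquiv n d).symm (w, u))) (ball 0 1) ∧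
      ∫ w in ball (0 : Cn (n + d)) 1, f w =
        ∫ w in ball (0 : Cn n) 1, ∫ u in ball (0 : Cn d) (√(1 - ‖w‖ ^ 2)),
          f ((splitEquiv n d).symm (w, u)) := by
  set F : Cn n × Cn d → ℂ := fun p => indicator (ball 0 1) f ((splitEquiv n d).symm p) with hF
  have hmp := (measurePreserving_splitEquiv (n := n) (d := d)).symm
  have hFi : Integrable F (volume.prod volume) :=
    hmp.integrable_comp_of_integrable (hf.integrable_indicator measurableSet_ball)
  have hslice : (fun w : Cn n => ∫ u, F (w, u)) = indicator (ball 0 1) fun w =>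
      ∫ u in ball (0 : Cn d) (√(1 - ‖w‖ ^ 2)), f ((splitEquiv n d).symm (w, u)) := by
    funext w
    by_cases hw : w ∈ ball (0 : Cn n) 1
    · rw [indicator_of_mem hw, ← integral_indicator measurableSet_ball]
      refine integral_congr_ae (.of_forall fun u => ?_)
      by_cases hu : u ∈ ball (0 : Cn d) (√(1 - ‖w‖ ^ 2))
      · simp only [hF, indicator_of_mem hu,
          indicator_of_mem ((splitEquiv_symm_mem_ball w u).2 ⟨hw, hu⟩)]
      · simp only [hF, indicator_of_notMem hu,
          indicator_of_notMem fun h => hu ((splitEquiv_symm_mem_ball w u).1 h).2]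
    · rw [indicator_of_notMem hw]
      refine integral_eq_zero_of_ae (.of_forall fun u => ?_)
      exact indicator_of_notMem (fun h => hw ((splitEquiv_symm_mem_ball w u).1 h).1) _
  have h1 := hFi.integral_prod_left
  rw [hslice] at h1
  refine ⟨(integrable_indicator_iff measurableSet_ball).1 h1, ?_⟩
  rw [← integral_indicator measurableSet_ball, ← hmp.integral_comp
    (splitEquiv n d).symm.measurableEmbedding, ← integral_indicator measurableSet_ball, ← hslice]
  exact integral_prod F hFi

theorem volume_real_ball (d : ℕ) {r : ℝ} (hr : 0 < r) :
    (volume : Measure (Cn d)).real (ball 0 (√r)) =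
      r ^ d * (volume : Measure (Cn d)).real (ball 0 1) := by
  rw [measureReal_def, Measure.addHaar_ball_of_pos _ _ (Real.sqrt_pos.2 hr), ENNReal.toReal_mul,
    ENNReal.toReal_ofReal (by positivity), measureReal_def, finrank_real_of_complex,
    finrank_euclideanSpace_fin, pow_mul, Real.sq_sqrt hr.le]

/-- Integration over the unit sphere of `ℂⁿ⁺ᵈ` of a function `f` of the first `n` variables: compare
the divergence theorem with Euler field centred at `0` for `f` on the ball of `ℂⁿ⁺ᵈ`, sliced over
the ball of `ℂⁿ`, with the one for `(1 - |w|²)^d f` on the ball of `ℂⁿ`, which has no boundary term. -/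
theorem integral_sphere_projFirst (hn : 0 < n) (hd : 0 < d) (h : n ≤ n + d) {f : Cn n → ℂ}
    (hf : ContDiffOn ℝ 1 f (closedBall 0 1)) :
    ∫ ζ : sphere (0 : Cn (n + d)) 1, f (projFirst h ζ) ∂(volume : Measure (Cn (n + d))).toSphere =
      (2 * d * (volume : Measure (Cn d)).real (ball 0 1) : ℝ) *
        ∫ w in ball (0 : Cn n) 1, oneSubSq w ^ (d - 1) * f w := by
  set V : ℝ := (volume : Measure (Cn d)).real (ball 0 1) with hV
  have hPf : ContDiffOn ℝ 1 (fun w => f (projFirst h w)) (closedBall 0 1) :=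
    hf.comp (projFirstL h).contDiff.contDiffOn fun _ hw => projFirst_mem_closedBall h hw
  have hemb : embFirst (n + d) (0 : Cn n) = 0 := by
    rw [← norm_eq_zero, norm_embFirst, norm_zero]
  have h1 := integral_ball_eulerDeriv_add (n := n + d) (by omega) 0 hPf
  have hc : ContinuousOn (fun w => eulerDeriv 0 f w + (n + d : ℕ) * f w) (closedBall 0 1) :=
    (continuousOn_eulerDeriv 0 hf).add (continuousOn_const.mul hf.continuousOn)
  have hint : ∀ {k : ℕ} {g : Cn k → ℂ}, ContinuousOn g (closedBall 0 1) →
      IntegrableOn g (ball 0 1) := fun hg =>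
    (hg.integrableOn_compact (isCompact_closedBall _ _)).mono_set ball_subset_closedBall
  have h2 : ∫ w in ball (0 : Cn (n + d)) 1, (eulerDeriv 0 (fun w => f (projFirst h w)) w +
      (n + d : ℕ) * f (projFirst h w)) = ∫ w in ball (0 : Cn (n + d)) 1,
        (eulerDeriv 0 f (projFirst h w) + (n + d : ℕ) * f (projFirst h w)) := by
    refine setIntegral_congr_fun measurableSet_ball fun w hw => ?_
    have hw := ball_subset_closedBall hw
    have := eulerDeriv_comp_projFirst h 0 hw
      (hf.differentiableOn (by simp) _ (projFirst_mem_closedBall h hw))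
    rw [hemb] at this
    simp only [this]
  have h3 : IntegrableOn (fun w : Cn (n + d) =>
      eulerDeriv 0 f (projFirst h w) + (n + d : ℕ) * f (projFirst h w)) (ball 0 1) :=
    hint (hc.comp (projFirstL h).continuous.continuousOn fun _ hw => projFirst_mem_closedBall h hw)
  rw [h2, (integral_ball_eq_integral_slices h3).2] at h1
  have h4 : ∀ w ∈ ball (0 : Cn n) 1, ∫ u in ball (0 : Cn d) (√(1 - ‖w‖ ^ 2)),
      (eulerDeriv 0 f (projFirst h ((splitEquiv n d).symm (w, u))) +
        (n + d : ℕ) * f (projFirst h ((splitEquiv n d).symm (w, u)))) =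
      V * (oneSubSq w ^ d * (eulerDeriv 0 f w + (n + d : ℕ) * f w)) := by
    intro w hw
    have hr : 0 < 1 - ‖w‖ ^ 2 := by
      rw [mem_ball_zero_iff] at hw
      nlinarith [norm_nonneg w]
    simp only [projFirst_splitEquiv_symm, setIntegral_const, volume_real_ball d hr, oneSubSq]
    rw [Complex.real_smul]
    push_cast
    ring
  rw [setIntegral_congr_fun measurableSet_ball h4, integral_const_mul] at h1
  have hr1 : ContDiff ℝ 1 fun w : Cn n => oneSubSq w ^ d :=
    (contDiff_oneSubSq.of_le (by simp)).pow d
  have h5 := integral_ball_eulerDeriv_add hn 0 (hr1.contDiffOn.mul hf)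
  have h6 : ∀ ζ : sphere (0 : Cn n) 1, (1 - dotBar (ζ : Cn n) 0) *
      (oneSubSq (ζ : Cn n) ^ d * f ζ) = 0 := by
    intro ζ
    have : oneSubSq (ζ : Cn n) = 0 := by
      simp [oneSubSq]
    rw [this, zero_pow hd.ne', zero_mul, mul_zero]
  simp only [h6, integral_zero, mul_zero] at h5
  have h7 : ∀ w ∈ ball (0 : Cn n) 1, eulerDeriv 0 (fun w => oneSubSq w ^ d * f w) w +
      n * (oneSubSq w ^ d * f w) =
      oneSubSq w ^ d * (eulerDeriv 0 f w + (n + d : ℕ) * f w) -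
        d * (oneSubSq w ^ (d - 1) * f w) := by
    intro w hw
    have hw := ball_subset_closedBall hw
    have he := ((HasEulerDeriv.one_sub_normSq (z := 0) hw).pow hw d).mul hw
      ⟨hf.differentiableOn (by simp) w hw, rfl⟩
    rw [he.2]
    obtain ⟨k, rfl⟩ : ∃ k, d = k + 1 := ⟨d - 1, by omega⟩
    simp [dotBar]
    ring
  have h8 : IntegrableOn (fun w => oneSubSq w ^ d * (eulerDeriv 0 f w + (n + d : ℕ) * f w))
      (ball (0 : Cn n) 1) := hint (hr1.continuous.continuousOn.mul hc)
  have h9 : IntegrableOn (fun w => oneSubSq w ^ (d - 1) * f w) (ball (0 : Cn n) 1) :=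
    hint ((continuous_oneSubSq.pow _).continuousOn.mul hf.continuousOn)
  rw [setIntegral_congr_fun measurableSet_ball h7, integral_sub h8 (h9.const_mul _),
    integral_const_mul, sub_eq_zero] at h5
  rw [h5] at h1
  have h10 : ∀ ζ : sphere (0 : Cn (n + d)) 1, (1 - dotBar (ζ : Cn (n + d)) 0) *
      f (projFirst h ζ) = f (projFirst h ζ) := by
    intro ζ
    simp [dotBar]
  simp only [h10] at h1
  push_cast
  linear_combination (-2) * h1

end Slices

/-! ### Slices of the kernels `Φ^ℓ` -/

section PhiSlice

open Set

/-- The substitution `y = M t² / (r (T + p t²))`, `M = T + r p`, which maps `[0, √r]` to `[0, 1]`. In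
the integral of `Φ` over a slice, `r = 1 - |w|²`, `p = 1 - |z|²`, `T = △(w,z)` and `M = |1 - w z̄|²`. -/
theorem integral_slice_substitution {r p T : ℝ} (hr : 0 < r) (hp : 0 ≤ p) (hT : 0 < T) {d : ℕ}
    (hd : 0 < d) (ℓ N : ℕ) :
    ∫ t in (0 : ℝ)..√r, t ^ (2 * d - 1) * ((r - t ^ 2) ^ ℓ / (T + p * t ^ 2) ^ (d + ℓ + N + 1)) =
      r ^ (d + ℓ) / (2 * (T + r * p) ^ d * T ^ (ℓ + N + 1)) *
        ∫ y in (0 : ℝ)..1, y ^ (d - 1) * (1 - y) ^ ℓ * (1 - r * p / (T + r * p) * y) ^ N := by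
  obtain ⟨d, rfl⟩ : ∃ k, d = k + 1 := ⟨d - 1, by omega⟩
  have hM : 0 < T + r * p := by positivity
  set M := T + r * p with hMdef
  have hD : ∀ t : ℝ, 0 < T + p * t ^ 2 := fun t => by positivity
  have hder : ∀ t : ℝ, HasDerivAt (fun t => M * t ^ 2 / (r * (T + p * t ^ 2)))
      (2 * M * T * t / (r * (T + p * t ^ 2) ^ 2)) t := by
    intro t
    have h1 : HasDerivAt (fun t : ℝ => M * t ^ 2) (M * (2 * t)) t := by
      simpa using (hasDerivAt_pow 2 t).const_mul M
    have h2 : HasDerivAt (fun t : ℝ => r * (T + p * t ^ 2)) (r * (p * (2 * t))) t := by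
      simpa using (((hasDerivAt_pow 2 t).const_mul p).const_add T).const_mul r
    have := (hD t).ne'
    refine (h1.div h2 (by positivity)).congr_deriv ?_
    field_simp
    ring
  have hcont : Continuous fun t : ℝ => 2 * M * T * t / (r * (T + p * t ^ 2) ^ 2) :=
    Continuous.div (by fun_prop) (by fun_prop) fun t => by
      have := hD t
      positivity
  have hsub := intervalIntegral.integral_comp_mul_deriv (a := 0) (b := √r)
    (g := fun y => y ^ d * (1 - y) ^ ℓ * (1 - r * p / M * y) ^ N)
    (fun t _ => hder t) hcont.continuousOn (by fun_prop)
  have h1 : M * √r ^ 2 / (r * (T + p * √r ^ 2)) = 1 := by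
    rw [Real.sq_sqrt hr.le, hMdef]
    have : T + r * p ≠ 0 := hM.ne'
    have : T + p * r ≠ 0 := by rwa [mul_comm p r]
    field_simp
  have h0 : M * (0 : ℝ) ^ 2 / (r * (T + p * 0 ^ 2)) = 0 := by simp
  rw [h1, h0] at hsub
  rw [Nat.add_sub_cancel, ← hsub, ← intervalIntegral.integral_const_mul]
  refine intervalIntegral.integral_congr fun t _ => ?_
  have hDt := (hD t).ne'
  have e1 : 1 - M * t ^ 2 / (r * (T + p * t ^ 2)) = T * (r - t ^ 2) / (r * (T + p * t ^ 2)) := by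
    field_simp
    rw [hMdef]
    ring
  have e2 : 1 - r * p / M * (M * t ^ 2 / (r * (T + p * t ^ 2))) = T / (T + p * t ^ 2) := by
    field_simp
    ring
  have e3 : t ^ (2 * (d + 1) - 1) = (t ^ 2) ^ d * t := by
    rw [← pow_mul, ← pow_succ]
    rfl
  simp only [Function.comp_apply]
  rw [e1, e2, e3]
  simp only [div_pow, mul_pow]
  field_simp
  ring

/-- The coefficients `a_{ℓ,j}` of the ameliorated kernels, for `s = n + d`: the expansion in `X` of
`d vol(𝔹_d) ∫₀¹ y^(d-1) (1 - y)^ℓ (1 - X y)^(n-1-ℓ) dy`. -/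
def amelCoeff (n d ℓ j : ℕ) : ℂ :=
  ((d * (volume : Measure (Cn d)).real (ball 0 1) * (n - 1 - ℓ).choose j * (-1) ^ j *
    ∫ y in (0 : ℝ)..1, y ^ (d - 1) * (1 - y) ^ ℓ * y ^ j : ℝ) : ℂ)

theorem integral_mul_one_sub_mul_pow (d ℓ N : ℕ) (X : ℝ) :
    ∫ y in (0 : ℝ)..1, y ^ (d - 1) * (1 - y) ^ ℓ * (1 - X * y) ^ N =
      ∑ j ∈ Finset.range (N + 1), N.choose j * (-1) ^ j *
        (∫ y in (0 : ℝ)..1, y ^ (d - 1) * (1 - y) ^ ℓ * y ^ j) * X ^ j := by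
  have h1 : ∀ y : ℝ, y ^ (d - 1) * (1 - y) ^ ℓ * (1 - X * y) ^ N =
      ∑ j ∈ Finset.range (N + 1), N.choose j * (-1) ^ j * X ^ j *
        (y ^ (d - 1) * (1 - y) ^ ℓ * y ^ j) := by
    intro y
    rw [show 1 - X * y = -(X * y) + 1 by ring, add_pow, Finset.mul_sum]
    refine Finset.sum_congr rfl fun j _ => ?_
    rw [one_pow, neg_pow, mul_pow]
    ring
  simp only [h1]
  rw [intervalIntegral.integral_finsetSum fun j _ =>
    (by fun_prop : Continuous _).intervalIntegrable 0 1]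
  refine Finset.sum_congr rfl fun j _ => ?_
  rw [intervalIntegral.integral_const_mul]
  ring

theorem integral_ball_fun_norm {d : ℕ} (hd : 0 < d) {R : ℝ} (hR : 0 ≤ R) (f : ℝ → ℝ) :
    ∫ u in ball (0 : Cn d) R, f ‖u‖ =
      2 * d * (volume : Measure (Cn d)).real (ball 0 1) *
        ∫ t in (0 : ℝ)..R, t ^ (2 * d - 1) * f t := by
  have : Nonempty (Fin d) := ⟨⟨0, hd⟩⟩
  have : Nontrivial (Cn d) := inferInstance
  have hdim : Module.finrank ℝ (Cn d) = 2 * d := by simp [finrank_real_of_complex]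
  have h1 : (indicator (ball (0 : Cn d) R) fun u => f ‖u‖) =
      fun u => indicator (Iio R) f ‖u‖ := by
    funext u
    simp [indicator]
  have h2 : (fun y : ℝ => y ^ (2 * d - 1) • indicator (Iio R) f y) =
      indicator (Iio R) fun y => y ^ (2 * d - 1) * f y := by
    funext y
    by_cases hy : y < R <;> simp [hy]
  rw [← integral_indicator measurableSet_ball, h1, integral_fun_norm_addHaar, hdim, h2,
    setIntegral_indicator measurableSet_Iio, Ioi_inter_Iio, intervalIntegral.integral_of_le hR,
    integral_Ioc_eq_integral_Ioo]
  simp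
  ring

variable {n d : ℕ}

/-- Integration of the kernel `Φ` of `ℂⁿ⁺ᵈ` over the slices parallel to `ℂᵈ`. -/
theorem integral_slice_phi (hd : 0 < d) {ℓ : ℕ} (hℓ : ℓ < n) {z w : Cn n} (hz : ‖z‖ < 1)
    (hw : ‖w‖ < 1) (hwz : w ≠ z) :
    ∫ u in ball (0 : Cn d) (√(1 - ‖w‖ ^ 2)),
        phi (n + d) ℓ ((splitEquiv n d).symm (w, u)) (embFirst (n + d) z) =
      phiAmel n (n + d) ℓ (amelCoeff n d ℓ) w z := by
  have hr : 0 < 1 - ‖w‖ ^ 2 := by nlinarith [norm_nonneg w]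
  have hp : 0 < 1 - ‖z‖ ^ 2 := by nlinarith [norm_nonneg z]
  have hT := triangle_pos hz hwz
  have hA := one_sub_dotBar_ne_zero hw.le hz
  have hA' : 1 - dotBar z w ≠ 0 := one_sub_dotBar_ne_zero hz.le hw
  set r : ℝ := 1 - ‖w‖ ^ 2 with hrdef
  set p : ℝ := 1 - ‖z‖ ^ 2 with hpdef
  set T : ℝ := triangle w z with hTdef
  have hM : ‖1 - dotBar w z‖ ^ 2 = T + r * p := by
    rw [hTdef, triangle]
    ring
  have hMc : ((T + r * p : ℝ) : ℂ) = (1 - dotBar w z) * (1 - dotBar z w) := by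
    rw [← hM, Complex.ofReal_pow, ← Complex.mul_conj', map_sub, map_one, conj_dotBar]
  have hle : n ≤ n + d := Nat.le_add_right n d
  obtain ⟨N, hN⟩ : ∃ N, n = ℓ + N + 1 := ⟨n - ℓ - 1, by omega⟩
  have h1 : ∀ u : Cn d, phi (n + d) ℓ ((splitEquiv n d).symm (w, u)) (embFirst (n + d) z) =
      (1 - dotBar w z) ^ (d + N) *
        (((r - ‖u‖ ^ 2) ^ ℓ / (T + p * ‖u‖ ^ 2) ^ (d + ℓ + N + 1) : ℝ) : ℂ) := by
    intro u
    rw [phi, triangle, oneSubSq, dotBar_embFirst_right hle, projFirst_splitEquiv_symm,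
      norm_sq_splitEquiv_symm, norm_embFirst, hM, show n + d - 1 - ℓ = d + N by omega,
      show n + d = d + ℓ + N + 1 by omega]
    push_cast
    rw [mul_div_assoc]
    congr 3
    · simp only [hrdef]
      push_cast
      ring
    · simp only [hrdef, hpdef]
      push_cast
      ring
  simp only [h1]
  rw [integral_const_mul, integral_complex_ofReal,
    integral_ball_fun_norm hd (Real.sqrt_nonneg r)
      fun t => (r - t ^ 2) ^ ℓ / (T + p * t ^ 2) ^ (d + ℓ + N + 1),
    integral_slice_substitution hr hp.le hT hd, integral_mul_one_sub_mul_pow, phiAmel, phi,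
    show n - ℓ = N + 1 by omega, show n - 1 - ℓ = N by omega, show n + d - n = d by omega, hM]
  have hsum : ∑ j ∈ Finset.range (N + 1), amelCoeff n d ℓ j *
      (oneSubSq w * oneSubSq z / ((T + r * p : ℝ) : ℂ)) ^ j =
      d * ((volume : Measure (Cn d)).real (ball 0 1) : ℂ) *
      ((∑ j ∈ Finset.range (N + 1), N.choose j * (-1) ^ j *
        (∫ y in (0 : ℝ)..1, y ^ (d - 1) * (1 - y) ^ ℓ * y ^ j) * (r * p / (T + r * p)) ^ j : ℝ) :
          ℂ) := by
    rw [Complex.ofReal_sum, Finset.mul_sum]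
    refine Finset.sum_congr rfl fun j _ => ?_
    rw [amelCoeff, show n - 1 - ℓ = N by omega, oneSubSq, oneSubSq, ← hrdef, ← hpdef]
    push_cast
    ring
  rw [hsum]
  generalize (∑ j ∈ Finset.range (N + 1), (N.choose j : ℝ) * (-1) ^ j *
        (∫ y in (0 : ℝ)..1, y ^ (d - 1) * (1 - y) ^ ℓ * y ^ j) * (r * p / (T + r * p)) ^ j) = S
  have hTc : (T : ℂ) ≠ 0 := by exact_mod_cast hT.ne'
  have hTn : (T : ℂ) ^ n = T ^ (ℓ + N + 1) := congrArg _ hN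
  rw [oneSubSq, ← hrdef, ← hTdef, hTn]
  have hMc' : (T : ℂ) + r * p = (1 - dotBar w z) * (1 - dotBar z w) := by
    rw [← hMc]
    push_cast
    ring
  push_cast
  rw [hMc', mul_pow, pow_add, pow_add, div_pow]
  field_simp

end PhiSlice

/-! ### The ameliorated operators -/

section Amelioration

variable {n d q : ℕ}

/-- Integration over slices turns `Φ^ℓ` in dimension `n + d` into the ameliorated kernel. The slice
through `z`, where the ameliorated kernel is singular, is a null set. -/
theorem slice_phi_smul_dbarPow (hd : 0 < d) (h : n ≤ n + d) {η : Cn n → AntiForm n (q + 1)}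
    (hη : ContDiffOn ℝ ∞ η (closedBall 0 1)) (m : ℕ) {ℓ : ℕ} (hℓ : ℓ < n) {z : Cn n} (hz : ‖z‖ < 1)
    (J : MultiIndex n q) :
    IntegrableOn (fun w => phiAmel n (n + d) ℓ (amelCoeff n d ℓ) w z * dbarPow m η z w J)
        (ball 0 1) ∧
      ∫ w in ball (0 : Cn (n + d)) 1, phi (n + d) ℓ w (embFirst (n + d) z) *
          dbarPow m (extendForm h η) (embFirst (n + d) z) w (J.cast h) =
        ∫ w in ball (0 : Cn n) 1, phiAmel n (n + d) ℓ (amelCoeff n d ℓ) w z *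
          dbarPow m η z w J := by
  have : Nonempty (Fin n) := ⟨⟨0, by omega⟩⟩
  have : Nontrivial (Cn n) := inferInstance
  have hz' : ‖embFirst (n + d) z‖ < 1 := by rwa [norm_embFirst]
  have hcongr : ∀ w ∈ ball (0 : Cn (n + d)) 1, phi (n + d) ℓ w (embFirst (n + d) z) *
      dbarPow m (extendForm h η) (embFirst (n + d) z) w (J.cast h) =
      phi (n + d) ℓ w (embFirst (n + d) z) * dbarPow m η z (projFirst h w) J := fun w hw => by
    rw [dbarPow_extendForm h hη m z (ball_subset_closedBall hw)]
  have hi : IntegrableOn (fun w => phi (n + d) ℓ w (embFirst (n + d) z) *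
      dbarPow m (extendForm h η) (embFirst (n + d) z) w (J.cast h)) (ball 0 1) :=
    (integrableOn_phi_smul_dbarPow (by omega) (contDiffOn_extendForm h hη) m ℓ hz').eval
      (J.cast h)
  have hslices := integral_ball_eq_integral_slices (hi.congr_fun hcongr measurableSet_ball)
  have hz0 : ∀ᵐ w : Cn n, w ≠ z := by simp [ae_iff]
  have hae : (fun w : Cn n => ∫ u in ball (0 : Cn d) (√(1 - ‖w‖ ^ 2)),
      phi (n + d) ℓ ((splitEquiv n d).symm (w, u)) (embFirst (n + d) z) *
        dbarPow m η z (projFirst h ((splitEquiv n d).symm (w, u))) J)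
      =ᵐ[volume.restrict (ball 0 1)]
        fun w => phiAmel n (n + d) ℓ (amelCoeff n d ℓ) w z * dbarPow m η z w J := by
    filter_upwards [ae_restrict_mem measurableSet_ball, ae_restrict_of_ae hz0] with w hw hwz
    simp only [projFirst_splitEquiv_symm]
    rw [integral_mul_const, integral_slice_phi hd hℓ hz (mem_ball_zero_iff.1 hw) hwz]
  refine ⟨hslices.1.congr hae, ?_⟩
  rw [setIntegral_congr_fun measurableSet_ball hcongr, hslices.2, integral_congr_ae hae]

theorem integrableOn_szegoAmel_smul_dbarPow {η : Cn n → AntiForm n (q + 1)}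
    (hη : ContDiffOn ℝ ∞ η (closedBall 0 1)) (s k : ℕ) {z : Cn n} (hz : ‖z‖ < 1) :
    IntegrableOn (fun w => szegoAmel n s w z • dbarPow k η z w) (ball 0 1) := by
  refine Integrable.of_eval fun J => ?_
  have hc : ContinuousOn (fun w => oneSubSq w ^ (s - n - 1) * (1 / (1 - dotBar z w) ^ s) *
      dbarPow k η z w J) (closedBall (0 : Cn n) 1) :=
    ((continuous_oneSubSq.pow _).continuousOn.mul (contDiffOn_szego hz s).continuousOn).mul
      (contDiffOn_dbarPow hη k z J).continuousOn
  refine IntegrableOn.congr_fun ((hc.integrableOn_compact (isCompact_closedBall _ _)).mono_set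
    ball_subset_closedBall) (fun w _ => ?_) measurableSet_ball
  simp [szegoAmel, div_eq_mul_inv]

/-- Integration over slices of the sphere turns `𝒮` in dimension `n + d` into a multiple of the
operator `𝒮_{n,n+d}`. -/
theorem bdryOp_extendForm (hn : 0 < n) (hd : 0 < d) (h : n ≤ n + d)
    {η : Cn n → AntiForm n (q + 1)} (hη : ContDiffOn ℝ ∞ η (closedBall 0 1)) (k : ℕ) {z : Cn n}
    (hz : ‖z‖ < 1) (J : MultiIndex n q) :
    bdryOp (dbarPow k (extendForm h η) (embFirst (n + d) z)) (embFirst (n + d) z) (J.cast h) =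
      (2 * d * (volume : Measure (Cn d)).real (ball 0 1) : ℝ) *
        volOp (fun w => szegoAmel n (n + d) w z) (dbarPow k η z) J := by
  have hz' : ‖embFirst (n + d) z‖ < 1 := by rwa [norm_embFirst]
  have h1 : bdryOp (dbarPow k (extendForm h η) (embFirst (n + d) z)) (embFirst (n + d) z)
      (J.cast h) = ∫ ζ : sphere (0 : Cn (n + d)) 1, szego (n + d) ζ (embFirst (n + d) z) *
        dbarPow k (extendForm h η) (embFirst (n + d) z) ζ (J.cast h)
        ∂(volume : Measure (Cn (n + d))).toSphere :=
    eval_integral (fun I =>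
      (integrable_szego_smul_dbarPow (contDiffOn_extendForm h hη) k hz').eval I) (J.cast h)
  have h2 : volOp (fun w => szegoAmel n (n + d) w z) (dbarPow k η z) J =
      ∫ w in ball (0 : Cn n) 1, szegoAmel n (n + d) w z * dbarPow k η z w J :=
    eval_integral (fun I => (integrableOn_szegoAmel_smul_dbarPow hη (n + d) k hz).eval I) J
  have h3 := integral_sphere_projFirst hn hd h
    (((contDiffOn_szego hz (n + d)).mul (contDiffOn_dbarPow hη k z J)).of_le (by simp))
  rw [h1, h2]
  have h4 : ∀ w : Cn n, szegoAmel n (n + d) w z * dbarPow k η z w J =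
      oneSubSq w ^ (d - 1) * (1 / (1 - dotBar z w) ^ (n + d) * dbarPow k η z w J) := by
    intro w
    rw [szegoAmel, show n + d - n - 1 = d - 1 by omega]
    ring
  simp only [h4]
  rw [← h3]
  refine integral_congr_ae (.of_forall fun ζ => ?_)
  simp only
  rw [szego, dotBar_embFirst_left h,
    dbarPow_extendForm h hη k z (sphere_subset_closedBall ζ.2)]

/-- The formula for `𝒞_{n,n+d}^{0,q}η`. -/
theorem amelOp_eq (hq : q < n) (hd : 0 < d) (h : n ≤ n + d) (m : ℕ)
    {η : Cn n → AntiForm n (q + 1)} (hη : ContDiffOn ℝ ∞ η (closedBall 0 1)) {z : Cn n}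
    (hz : z ∈ ball (0 : Cn n) 1) :
    amelOp h η z =
      ∑ k ∈ Finset.range m, (bdrySeq (kernelConst (n + d) q) q k *
          (2 * d * (volume : Measure (Cn d)).real (ball 0 1) : ℝ)) •
        volOp (fun w => szegoAmel n (n + d) w z) (dbarPow k η z) +
      ∑ ℓ ∈ Finset.range (q + 1), volSeq (kernelConst (n + d) q) q m ℓ •
        volOp (fun w => phiAmel n (n + d) ℓ (amelCoeff n d ℓ) w z) (dbarPow m η z) := by
  have hz1 : ‖z‖ < 1 := mem_ball_zero_iff.1 hz
  have hz' : embFirst (n + d) z ∈ ball (0 : Cn (n + d)) 1 := by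
    rwa [mem_ball_zero_iff, norm_embFirst]
  have hE := contDiffOn_extendForm h hη
  funext J
  rw [amelOp, restrictForm, (charpentierOp_eq (by omega) m hE hz').2]
  simp only [Pi.add_apply, Finset.sum_apply, Pi.smul_apply, smul_eq_mul]
  congr 1
  · refine Finset.sum_congr rfl fun k _ => ?_
    rw [bdryOp_extendForm (by omega) hd h hη k hz1]
    ring
  · refine Finset.sum_congr rfl fun ℓ hℓ => ?_
    have hℓ : ℓ < n := by
      have := Finset.mem_range.1 hℓ
      omega
    congr 1
    have h1 : volOp (fun w => phi (n + d) ℓ w (embFirst (n + d) z))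
        (dbarPow m (extendForm h η) (embFirst (n + d) z)) (J.cast h) =
        ∫ w in ball (0 : Cn (n + d)) 1, phi (n + d) ℓ w (embFirst (n + d) z) *
          dbarPow m (extendForm h η) (embFirst (n + d) z) w (J.cast h) :=
      eval_integral (fun I =>
        (integrableOn_phi_smul_dbarPow (by omega) hE m ℓ (mem_ball_zero_iff.1 hz')).eval I) _
    have h2 : volOp (fun w => phiAmel n (n + d) ℓ (amelCoeff n d ℓ) w z) (dbarPow m η z) J =
        ∫ w in ball (0 : Cn n) 1, phiAmel n (n + d) ℓ (amelCoeff n d ℓ) w z *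
          dbarPow m η z w J :=
      eval_integral (fun I => (slice_phi_smul_dbarPow hd h hη m hℓ hz1 I).1) J
    rw [h1, h2, (slice_phi_smul_dbarPow hd h hη m hℓ hz1 J).2]

end Amelioration

end BallForms

end

open BallForms in
theorem lemma4p3 (n : ℕ) :
    (∀ q : ℕ, q < n → ∃ c : ℕ → ℂ, ∀ m : ℕ, ∃ b : ℕ → ℂ,
      ∀ η : Cn n → AntiForm n (q + 1), ContDiffOn ℝ ∞ η (closedBall 0 1) →
      ∀ z ∈ ball (0 : Cn n) 1,
        IntegrableOn (charpentierDensity η z) (ball 0 1) ∧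
        (∀ ℓ ≤ q, IntegrableOn (fun w => phi n ℓ w z • dbarPow m η z w) (ball 0 1)) ∧
        (∀ k < m, Integrable (fun ζ : sphere (0 : Cn n) 1 => szego n ζ z • dbarPow k η z ζ)
          (volume : Measure (Cn n)).toSphere) ∧
        charpentierOp η z =
          ∑ k ∈ Finset.range m, c k • bdryOp (dbarPow k η z) z +
          ∑ ℓ ∈ Finset.range (q + 1), b ℓ • volOp (fun w => phi n ℓ w z) (dbarPow m η z)) ∧
    (∀ (s : ℕ) (hs : n < s), ∃ a : ℕ → ℕ → ℂ,
      ∀ q : ℕ, q < n → ∃ c : ℕ → ℂ, ∀ m : ℕ, ∃ b : ℕ → ℂ,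
      ∀ η : Cn n → AntiForm n (q + 1), ContDiffOn ℝ ∞ η (closedBall 0 1) →
      ∀ z ∈ ball (0 : Cn n) 1,
        IntegrableOn (charpentierDensity (extendForm hs.le η) (embFirst s z)) (ball 0 1) ∧
        (∀ ℓ ≤ q, IntegrableOn (fun w => phiAmel n s ℓ (a ℓ) w z • dbarPow m η z w) (ball 0 1)) ∧
        (∀ k < m, IntegrableOn (fun w => szegoAmel n s w z • dbarPow k η z w) (ball 0 1)) ∧
        amelOp hs.le η z =
          ∑ k ∈ Finset.range m, c k • volOp (fun w => szegoAmel n s w z) (dbarPow k η z) +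
          ∑ ℓ ∈ Finset.range (q + 1),
            b ℓ • volOp (fun w => phiAmel n s ℓ (a ℓ) w z) (dbarPow m η z)) := by
  refine ⟨fun q hq => ⟨bdrySeq (kernelConst n q) q, fun m => ⟨volSeq (kernelConst n q) q m,
    fun η hη z hz => ?_⟩⟩, fun s hs => ?_⟩
  · have hz1 : ‖z‖ < 1 := mem_ball_zero_iff.1 hz
    obtain ⟨h1, h2⟩ := charpentierOp_eq hq m hη hz
    exact ⟨h1, fun ℓ _ => integrableOn_phi_smul_dbarPow (by omega) hη m ℓ hz1,
      fun k _ => integrable_szego_smul_dbarPow hη k hz1, h2⟩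
  · obtain ⟨d, hd, rfl⟩ : ∃ d, 0 < d ∧ s = n + d := ⟨s - n, by omega, by omega⟩
    refine ⟨amelCoeff n d, fun q hq => ⟨fun k => bdrySeq (kernelConst (n + d) q) q k *
      (2 * d * (volume : Measure (Cn d)).real (ball 0 1) : ℝ),
      fun m => ⟨volSeq (kernelConst (n + d) q) q m,
      fun η hη z hz => ?_⟩⟩⟩
    have hz1 : ‖z‖ < 1 := mem_ball_zero_iff.1 hz
    have hz2 : embFirst (n + d) z ∈ ball (0 : Cn (n + d)) 1 := by
      rwa [mem_ball_zero_iff, norm_embFirst]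
    exact ⟨(charpentierOp_eq (by omega) m (contDiffOn_extendForm hs.le hη) hz2).1,
      fun ℓ hℓ => Integrable.of_eval fun J =>
        (slice_phi_smul_dbarPow hd hs.le hη m (by omega) hz1 J).1,
      fun k _ => integrableOn_szegoAmel_smul_dbarPow hη (n + d) k hz1,
      amelOp_eq hq hd hs.le m hη hz⟩
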